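/- Let $n,m\ge 1$. Cubes $Q\subset\mathbb R^n$ have sides parallel to the axes, side length $l(Q)>0$ and measure $|Q|$. For a Banach function space $X$ over $\mathbb R^n$ with Lebesgue measure (in the sense of Luxemburg and Bennett–Sharpley) put $\|f\|_{X,Q}=\|\delta_{l(Q)}(f\chi_Q)\|_X$, where $\delta_af(x)=f(ax)$; $L(\log L)^\alpha$ is the Orlicz space of the Young function $t(1+\log^+t)^\alpha$ with the Luxemburg norm, and $L=L(\log L)^0=L^1$. For $\vec X=(X_1,\dots,X_m)$ let $\mathcal M_{\vec X}\vec f(x)=\sup_{Q\ni x}\prod_{i=1}^m\|f_i\|_{X_i,Q}$, written $M_X$ if $m=1$ and $\vec X=(X)$. For $t,\delta>0$ and $\epsilon\ge 0$ let $\mathcal A_{(t,\delta,\epsilon)}=\{\vec y\in(\mathbb R^n)^m:\ \delta(1-\epsilon)t<\sum_{i=1}^m|y_i|\le 2\delta(1+\epsilon)t\}$. Let $\phi\in\mathfrak D$, that is, $\phi$ is a nonnegative locally integrable function on $(\mathbb R^n)^m$ and there are constants $\delta,\epsilon>0$ (fixed from now on) and $C$ with $$\sup_{\vec w\in\mathcal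 A_{(2^k,1,0)}}\phi(\vec w)\le \frac{C}{2^{knm}}\int_{\mathcal A_{(2^k,\delta,\epsilon)}}\phi(\vec y)\,d\vec y\qquad\text{for every }k\in\mathbb Z .$$ For $0<\theta\le1$ and $t>0$ let $$\Phi_\theta(t)=\Big[\sum_{\nu\in\mathbb Z,\ 2^{-\nu}\le t}\Big(\int_{\mathcal A_{(2^{-\nu},\delta,\epsilon)}}\phi(\vec y)\,d\vec y\Big)^\theta\Big]^{1/\theta}.$$ Let $$\mathcal T_\phi(\vec f)(x)=\int_{(\mathbb R^n)^m}\phi(x-y_1,\dots,x-y_m)\prod_{i=1}^mf_i(y_i)\,d\vec y ,$$ $$\mathcal T_{\vec b,\phi}(\vec f)(x)=\sum_{j=1}^m\big[b_j(x)\mathcal T_\phi(\vec f)(x)-\mathcal T_\phi(f_1,\dots,b_jf_j,\dots,f_m)(x)\big]$$ for $\vec b=(b_1,\dots,b_m)\in BMO^m$, and $\|\vec b\|_*=\max_j\|b_j\|_{*}$, where $\|b\|_*=\sup_Q\frac1{|Q|}\int_Q|b-b_Q|$ and $b_Q=\frac1{|Q|}\int_Qb$. Write $\mathcal T_{\vec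 b^\ell,\phi}$ for $\mathcal T_\phi$ if $\ell=0$ and for $\mathcal T_{\vec b,\phi}$ if $\ell=1$. **Theorem.** Let $\ell\in\{0,1\}$, $1<p_1,\dots,p_m<\infty$, $1/p=\sum_{i=1}^m1/p_i$, $1/m<p\le q<\infty$ and $\phi\in\mathfrak D$. For $k\in\{0,1\}$, $k\le\ell$, and $i,j\in\{1,\dots,m\}$ let $X^k,\tilde X^k,Y^k_{i,j},\tilde Y^k_{i,j}$ be Banach function spaces such that, for all measurable $f,g$ and every cube $Q$, $$\|fg\|_{L(\log L)^k,Q}\le2\|f\|_{X^k,Q}\|g\|_{\tilde X^k,Q},\qquad \|fg\|_{L(\log L)^{k\delta_{i,j}},Q}\le2\|f\|_{Y^k_{i,j},Q}\|g\|_{\tilde Y^k_{i,j},Q},$$ where $\delta_{i,j}$ is the Kronecker symbol. Suppose that for every $k\le\ell$ and every $j$ the operator $\mathcal M_{\vec{\tilde Y}{}^k_j}$, $\vec{\tilde Y}{}^k_j=(\tilde Y^k_{1,j},\dots,\tilde Y^k_{m,j})$, is bounded from $L^{p_1}(\mathbb R^n)\times\dots\times L^{p_m}(\mathbb R^n)$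 to $L^p(\mathbb R^n)$. For weights (nonnegative finite measurable functions) $u,v_1,\dots,v_m$ on $\mathbb R^n$, with $v_i^{-1}=\infty$ where $v_i=0$ and $0\cdot\infty=0$, let $$\mathbb W(\theta,\gamma,X,\mathbf Y)=\max_{1\le j\le m}\sup_Q\ \Phi_\theta(l(Q))\,|Q|^{1/q-1/p}\,\|u^\gamma\|_{X,Q}^{1/\gamma}\prod_{i=1}^m\|v_i^{-1}\|_{Y_{i,j},Q}.$$ Suppose that one of the following holds: i) $q>1$, $M_{\tilde X^k}$ is bounded on $L^{q'}(\mathbb R^n)$ for every $k\le\ell$ (where $1/q+1/q'=1$), and $\max\{\mathbb W(1,1,X^\ell,\mathbf Y^0),\ \ell\,\mathbb W(1,1,X^0,\mathbf Y^1)\}<\infty$; ii) $q\le1$ and $\max\{\mathbb W(q,q,L(\log L)^{\ell q},\mathbf Y^0),\ \ell\,\mathbb W(q,1,L,\mathbf Y^1)\}<\infty$. (For $\ell=0$ the terms with the factor $\ell$ are absent.) Then there is a constant $C_\ell$, which does not depend on $\vec f$ and depends on $\vec b$ only through $\|\vec b\|_*$ (and only if $\ell=1$), such that for all $\vec b\in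 BMO^m$ and all $\vec f\in L^{p_1}(v_1^{p_1})\times\dots\times L^{p_m}(v_m^{p_m})$ the integrals that define $\mathcal T_{\vec b^\ell,\phi}\vec f(x)$ converge absolutely for almost every $x$ with $u(x)\ne0$, and $$\Big(\int_{\mathbb R^n}\big(|\mathcal T_{\vec b^\ell,\phi}\vec f|\,u\big)^q\Big)^{1/q}\le C_\ell\prod_{i=1}^m\Big(\int_{\mathbb R^n}(|f_i|v_i)^{p_i}\Big)^{1/p_i}.$$ -/

import Mathlib

open MeasureTheory Set
open scoped ENNReal NNReal

noncomputable section

namespace MultPot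

/-- Euclidean space `ℝⁿ`. -/
abbrev E (n : ℕ) : Type := EuclideanSpace ℝ (Fin n)

/-- The closed cube with sides parallel to the axes, lower corner `a` and side length `l`. -/
def cube {n : ℕ} (a : E n) (l : ℝ) : Set (E n) :=
  {x | ∀ i, a i ≤ x i ∧ x i ≤ a i + l}

/-! ### Banach function spaces and averages -/

/-- A Banach function space over `ℝⁿ` with Lebesgue measure (in the sense of Luxemburg and of
Bennett and Sharpley), given by its function norm on `[0,∞]`-valued Lebesgue measurable functions;
the norm of a real function is that of its absolute value. -/
structure BanachFunctionSpace (n : ℕ) where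
  norm : (E n → ℝ≥0∞) → ℝ≥0∞
  norm_eq_zero_iff : ∀ f, AEMeasurable f volume → (norm f = 0 ↔ f =ᵐ[volume] 0)
  norm_smul : ∀ (c : ℝ≥0) f, AEMeasurable f volume → norm (fun x => c * f x) = c * norm f
  norm_add_le : ∀ f g, AEMeasurable f volume → AEMeasurable g volume →
    norm (fun x => f x + g x) ≤ norm f + norm g
  norm_mono : ∀ f g, AEMeasurable f volume → AEMeasurable g volume →
    (∀ᵐ x ∂volume, f x ≤ g x) → norm f ≤ norm g
  norm_iSup : ∀ f : ℕ → E n → ℝ≥0∞, (∀ k, AEMeasurable (f k) volume) →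
    (∀ᵐ x ∂volume, Monotone fun k => f k x) → norm (fun x => ⨆ k, f k x) = ⨆ k, norm (f k)
  norm_indicator_lt_top : ∀ A : Set (E n), MeasurableSet A → volume A < ∞ →
    norm (A.indicator fun _ => 1) < ∞
  lintegral_le : ∀ A : Set (E n), MeasurableSet A → volume A < ∞ →
    ∃ C : ℝ≥0, ∀ f, AEMeasurable f volume → ∫⁻ x in A, f x ≤ C * norm f

/-- The `X`-average `‖f‖_{X,Q} = ‖δ_{l(Q)}(f χ_Q)‖_X`, with `δ_a f (x) = f (a x)`, over the cube `Q`
with lower corner `a` and side length `l`, for a function norm `ρ = ‖·‖_X`. -/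
def avg {n : ℕ} (ρ : (E n → ℝ≥0∞) → ℝ≥0∞) (a : E n) (l : ℝ) (f : E n → ℝ≥0∞) : ℝ≥0∞ :=
  ρ fun x => (cube a l).indicator f (l • x)

/-- The Young function `t (1 + log⁺ t)^α`. -/
def youngLlog (α : ℝ) (t : ℝ≥0∞) : ℝ≥0∞ :=
  t * (1 + ENNReal.ofReal (Real.posLog t.toReal)) ^ α

/-- The Luxemburg norm of the Orlicz space `L (log L)^α` over `ℝⁿ`; `α = 0` gives `L = L¹`. -/
def normLlog {n : ℕ} (α : ℝ) (f : E n → ℝ≥0∞) : ℝ≥0∞ :=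
  sInf {r : ℝ≥0∞ | 0 < r ∧ ∫⁻ x, youngLlog α (f x / r) ≤ 1}

/-- The multilinear maximal operator `sup_{Q ∋ x} ∏ᵢ ‖fᵢ‖_{Xᵢ,Q}`. -/
def maximal {n m : ℕ} (X : Fin m → BanachFunctionSpace n) (f : Fin m → E n → ℝ≥0∞) (x : E n) :
    ℝ≥0∞ :=
  ⨆ (a : E n) (l : ℝ) (_ : 0 < l) (_ : x ∈ cube a l), ∏ i, avg (X i).norm a l (f i)

/-- The (quasi)norm of `L^p(ℝⁿ)`. -/
def lpNorm {n : ℕ} (p : ℝ) (f : E n → ℝ≥0∞) : ℝ≥0∞ :=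
  (∫⁻ x, f x ^ p) ^ (1 / p)

/-- The multilinear maximal operator is bounded from `L^{p₁} × ⋯ × L^{pₘ}` to `L^p`. -/
def MaximalBounded {n m : ℕ} (X : Fin m → BanachFunctionSpace n) (ps : Fin m → ℝ) (p : ℝ) : Prop :=
  ∃ C : ℝ≥0, ∀ f : Fin m → E n → ℝ≥0∞, (∀ i, AEMeasurable (f i) volume) →
    (∀ i, lpNorm (ps i) (f i) < ∞) →
    lpNorm p (maximal X f) ≤ C * ∏ i, lpNorm (ps i) (f i)

/-- The inequality `‖f g‖_{L (log L)^α,Q} ≤ 2 ‖f‖_{X,Q} ‖g‖_{Z,Q}` for every cube `Q`. -/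
def GenHolder {n : ℕ} (α : ℝ) (X Z : BanachFunctionSpace n) : Prop :=
  ∀ f g : E n → ℝ≥0∞, AEMeasurable f volume → AEMeasurable g volume →
    ∀ (a : E n) (l : ℝ), 0 < l →
      avg (normLlog α) a l (fun x => f x * g x) ≤ 2 * avg X.norm a l f * avg Z.norm a l g

/-! ### Kernels and operators -/

/-- The annulus `δ (1 - ε) t < ∑ᵢ |yᵢ| ≤ δ (1 + ε) 2 t` in `(ℝⁿ)ᵐ`. -/
def annulus (n m : ℕ) (t δ ε : ℝ) : Set (Fin m → E n) :=
  {y | δ * (1 - ε) * t < ∑ i, ‖y i‖ ∧ ∑ i, ‖y i‖ ≤ δ * (1 + ε) * (2 * t)}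

/-- The growth condition `𝔇` on the kernel `φ`, with the constants `δ` and `ε`. -/
structure ConditionD {n m : ℕ} (φ : (Fin m → E n) → ℝ) (δ ε : ℝ) : Prop where
  delta_pos : 0 < δ
  eps_pos : 0 < ε
  nonneg : ∀ y, 0 ≤ φ y
  locallyIntegrable : LocallyIntegrable φ volume
  growth : ∃ C : ℝ, ∀ k : ℤ, ∀ w ∈ annulus n m ((2 : ℝ) ^ k) 1 0,
    φ w ≤ C / (2 : ℝ) ^ (k * n * m) * ∫ y in annulus n m ((2 : ℝ) ^ k) δ ε, φ y

/-- `Φ_θ(t) = (∑_ν (∫_{A(2^{-ν},δ,ε)} φ)^θ)^{1/θ}`, over the integers `ν ≥ log_{1/2} t`, that is,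
those with `2^{-ν} ≤ t`. -/
def bigPhi {n m : ℕ} (φ : (Fin m → E n) → ℝ) (δ ε θ t : ℝ) : ℝ≥0∞ :=
  (∑' ν : {ν : ℤ // (2 : ℝ) ^ (-ν) ≤ t},
    (∫⁻ y in annulus n m ((2 : ℝ) ^ (-(ν : ℤ))) δ ε, ENNReal.ofReal (φ y)) ^ θ) ^ (1 / θ)

/-- The integrand `φ(x - y₁, …, x - yₘ) f₁(y₁) ⋯ fₘ(yₘ)`. -/
def integrand {n m : ℕ} (φ : (Fin m → E n) → ℝ) (f : Fin m → E n → ℝ) (x : E n)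
    (y : Fin m → E n) : ℝ :=
  φ (fun i => x - y i) * ∏ i, f i (y i)

/-- The multilinear potential operator. -/
def potential {n m : ℕ} (φ : (Fin m → E n) → ℝ) (f : Fin m → E n → ℝ) (x : E n) : ℝ :=
  ∫ y, integrand φ f x y

/-- The tuple `(f₁, …, bⱼ fⱼ, …, fₘ)`. -/
def mulAt {n m : ℕ} (b f : Fin m → E n → ℝ) (j : Fin m) : Fin m → E n → ℝ :=
  Function.update f j fun y => b j y * f j y

/-- The commutator `∑ⱼ (bⱼ T_φ(f) - T_φ(f₁, …, bⱼ fⱼ, …, fₘ))`. -/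
def commutator {n m : ℕ} (φ : (Fin m → E n) → ℝ) (b f : Fin m → E n → ℝ) (x : E n) : ℝ :=
  ∑ j, (b j x * potential φ f x - potential φ (mulAt b f j) x)

/-- The potential operator for `ℓ = 0` and its commutator for `ℓ = 1`. -/
def operator {n m : ℕ} (ℓ : Fin 2) (φ : (Fin m → E n) → ℝ) (b f : Fin m → E n → ℝ) (x : E n) : ℝ :=
  if ℓ = 0 then potential φ f x else commutator φ b f x

/-- All integrals in the definition of `operator ℓ φ b f x` converge absolutely. -/
def OperatorDefinedAt {n m : ℕ} (ℓ : Fin 2) (φ : (Fin m → E n) → ℝ) (b f : Fin m → E n → ℝ)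
    (x : E n) : Prop :=
  Integrable (integrand φ f x) volume ∧
    (ℓ = 1 → ∀ j, Integrable (integrand φ (mulAt b f j) x) volume)

/-- The seminorm `sup_Q |Q|⁻¹ ∫_Q |b - b_Q|`. -/
def bmoNorm {n : ℕ} (b : E n → ℝ) : ℝ≥0∞ :=
  ⨆ (a : E n) (l : ℝ) (_ : 0 < l), (volume (cube a l))⁻¹ *
    ∫⁻ x in cube a l, ‖b x - ⨍ y in cube a l, b y‖ₑ

/-- `b ∈ BMO`. -/
def IsBMO {n : ℕ} (b : E n → ℝ) : Prop :=
  LocallyIntegrable b volume ∧ bmoNorm b < ∞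

/-! ### Weights -/

/-- The quantity `𝕎(θ, γ, X, Y)` of the Fefferman–Phong type conditions; `ρ` is the norm of `X`.
Here `v⁻¹ = ∞` where `v = 0`. -/
def bigW {n m : ℕ} (φ : (Fin m → E n) → ℝ) (δ ε p q : ℝ) (u : E n → ℝ≥0) (v : Fin m → E n → ℝ≥0)
    (θ γ : ℝ) (ρ : (E n → ℝ≥0∞) → ℝ≥0∞) (Y : Fin m → Fin m → BanachFunctionSpace n) : ℝ≥0∞ :=
  ⨆ (j : Fin m) (a : E n) (l : ℝ) (_ : 0 < l),
    bigPhi φ δ ε θ l * volume (cube a l) ^ (1 / q - 1 / p) *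
      avg ρ a l (fun x => (u x : ℝ≥0∞) ^ γ) ^ (1 / γ) *
      ∏ i, avg (Y i j).norm a l (fun x => (v i x : ℝ≥0∞)⁻¹)

/-- `(∫ (|f| w)^p)^{1/p}`, the norm of `L^p(w^p)`. -/
def wNorm {n : ℕ} (p : ℝ) (w : E n → ℝ≥0) (f : E n → ℝ) : ℝ≥0∞ :=
  lpNorm p fun x => ‖f x‖ₑ * w x

end MultPot

end

open MeasureTheory Set
open scoped ENNReal NNReal

noncomputable section

namespace MultPot

/-! The kernel is cut into the annuli on which `∑ |x - yᵢ|` is comparable to `2 ^ k`. There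
condition 𝔇 bounds `φ` by its mean over an annulus of comparable radius, so the piece is at most a
constant times `shell φ δ ε k` times the product of the averages of the `|fᵢ|` over a cube of side
`16 * 2 ^ k` around `x`. By the one-third trick this cube can be taken from one of `2 ^ n` shifted
dyadic grids (`lintegral_majorant_le_liminf`). Each grid has a largest side `2 ^ N`; the bounds are
uniform in `N`, and Fatou's lemma removes it.

For the commutator, `|bⱼ(x) - bⱼ(yⱼ)|` is split at the mean of `bⱼ` over the cube `Q`. The
oscillation at `x` stays outside of the averages (`outerSum`) and, by John–Nirenberg, costs one
logarithm on the side of `u` and the dual function. The oscillation at `yⱼ` turns the average of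
`fⱼ` into an `L log L` average (`innerSum`). This is why `X^ℓ` is paired with `Y⁰`, and `X⁰` with
`Y¹`.

Each dyadic sum is treated by sparse domination (`lintegral_gridSum_le`). A cell is selected when
the average of some `fᵢ` exceeds `4 m` times its value on the last selected cell. Between selections
the product of averages is under control, the averages of the remaining function integrate to at
most `2 |Q|` times its average over the selected cell `Q`, and the coefficients add up to a tail
bounded by `Φ_θ(l(Q))`. Bad cells fill at most half of `Q`, so the selected cells can be replaced by
pairwise disjoint parts of them.

On a selected cell, the generalized Hölder inequality and the Fefferman–Phong condition leave
averages of `fᵢ vᵢ`, with the factor `|Q|^(1/p - 1/q)`, which is absorbed by a power of the `L^p`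
norm of the maximal function (`cell_estimate`). Since the parts are disjoint, averages may then be
replaced by maximal functions. For `q > 1` this is done after pairing with `g ∈ L^{q'}`, by Hölder's
inequality (`lpNorm_gridSum_le`). For `q ≤ 1` the inequality `(∑ a)^q ≤ ∑ a^q` replaces duality
(`lintegral_rpow_gridSum_le`), whence `Φ_q` and the averages of `u^q`.

Luxemburg norms are not additive over cells. Their modular is, so the estimates for them use one
common level `r` on all subcells (`mul_orl_le`). The John–Nirenberg inequality comes from the same
stopping time, through the exponential decay of the number of selected cells
(`Nested.measure_selCount_le`). -/

/-! ### Stopping times along nested countable partitions -/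

/-- A nested sequence of countable measurable partitions: the cells of level `k` are the fibres of
`idx k`. -/
structure Nested {Ω ι : Type*} [MeasurableSpace Ω] [MeasurableSpace ι] (idx : ℕ → Ω → ι) : Prop where
  measurable : ∀ k, Measurable (idx k)
  succ : ∀ k x y, idx (k + 1) x = idx (k + 1) y → idx k x = idx k y

open Classical in
/-- The level of the last selected cell around `x`, among the levels up to `k`, when a new cell is
selected as soon as it is `bad` for the last one. -/
def stopLevel {Ω ι : Type*} (idx : ℕ → Ω → ι) (bad : ℕ → ι → ℕ → ι → Prop) : ℕ → Ω → ℕ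
  | 0, _ => 0
  | k + 1, x =>
    if bad (stopLevel idx bad k x) (idx (stopLevel idx bad k x) x) (k + 1) (idx (k + 1) x) then k + 1
    else stopLevel idx bad k x

/-- The union of the selected cells of level `k`. -/
def selected {Ω ι : Type*} (idx : ℕ → Ω → ι) (bad : ℕ → ι → ℕ → ι → Prop) (k : ℕ) : Set Ω :=
  {x | stopLevel idx bad k x = k}

/-- The part of the selected cells of level `k` that is covered by no smaller selected cell. -/
def lastSelected {Ω ι : Type*} (idx : ℕ → Ω → ι) (bad : ℕ → ι → ℕ → ι → Prop) (k : ℕ) : Set Ω :=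
  {x | x ∈ selected idx bad k ∧ ∀ i, k < i → x ∉ selected idx bad i}

/-- The points of a cell of level `k` that lie in a smaller bad cell. -/
def badSet {Ω ι : Type*} (idx : ℕ → Ω → ι) (bad : ℕ → ι → ℕ → ι → Prop) (k : ℕ) (z : ι) : Set Ω :=
  {x | idx k x = z ∧ ∃ i, k < i ∧ bad k z i (idx i x)}

open Classical in
/-- The number of selected cells around `x` of the levels `1, …, k`. -/
def selCount {Ω ι : Type*} (idx : ℕ → Ω → ι) (bad : ℕ → ι → ℕ → ι → Prop) : ℕ → Ω → ℕ
  | 0, _ => 0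
  | k + 1, x => selCount idx bad k x + if x ∈ selected idx bad (k + 1) then 1 else 0

section Stop

variable {Ω ι : Type*} {idx : ℕ → Ω → ι} {bad : ℕ → ι → ℕ → ι → Prop}

theorem stopLevel_le (k : ℕ) (x : Ω) : stopLevel idx bad k x ≤ k := by
  induction k with
  | zero => exact le_rfl
  | succ k ih =>
    rw [stopLevel]
    split_ifs
    · exact le_rfl
    · exact ih.trans k.le_succ

theorem stopLevel_succ_or (k : ℕ) (x : Ω) :
    stopLevel idx bad (k + 1) x = k + 1 ∨
      stopLevel idx bad (k + 1) x = stopLevel idx bad k x := by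
  rw [stopLevel]
  split_ifs
  · exact Or.inl rfl
  · exact Or.inr rfl

theorem stopLevel_stopLevel (k : ℕ) (x : Ω) :
    stopLevel idx bad (stopLevel idx bad k x) x = stopLevel idx bad k x := by
  induction k with
  | zero => rfl
  | succ k ih =>
    rcases stopLevel_succ_or (idx := idx) (bad := bad) k x with h | h
    · rw [h, h]
    · rw [h, ih]

theorem not_bad_stopLevel (hself : ∀ k z, ¬ bad k z k z) (k : ℕ) (x : Ω) :
    ¬ bad (stopLevel idx bad k x) (idx (stopLevel idx bad k x) x) k (idx k x) := by
  cases k with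
  | zero => exact hself _ _
  | succ k =>
    by_cases hb : bad (stopLevel idx bad k x) (idx (stopLevel idx bad k x) x) (k + 1)
        (idx (k + 1) x)
    · have : stopLevel idx bad (k + 1) x = k + 1 := by rw [stopLevel, if_pos hb]
      rw [this]; exact hself _ _
    · have : stopLevel idx bad (k + 1) x = stopLevel idx bad k x := by rw [stopLevel, if_neg hb]
      rwa [this]

theorem lastSelected_disjoint : Pairwise (Function.onFun Disjoint (lastSelected idx bad)) := by
  intro a b hab
  refine Set.disjoint_left.2 fun x hx hx' => ?_
  rcases lt_or_gt_of_ne hab with hlt | hlt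
  · exact hx.2 b hlt hx'.1
  · exact hx'.2 a hlt hx.1

/-- Were no later cell around `x` bad for the one of level `j`, the stopping level would stay at `j`
for ever. Hence whatever a selected cell loses to later selections lies in its bad set. -/
theorem mem_badSet_of_selected {j k : ℕ} (hjk : j < k) {x : Ω} (hj : x ∈ selected idx bad j)
    (hk : x ∈ selected idx bad k) : x ∈ badSet idx bad j (idx j x) := by
  by_contra hcon
  have hnb : ∀ i, j < i → ¬ bad j (idx j x) i (idx i x) := fun i hi hb => hcon ⟨rfl, i, hi, hb⟩
  have : ∀ i, j ≤ i → stopLevel idx bad i x = j := by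
    intro i hi
    induction i, hi using Nat.le_induction with
    | base => exact hj
    | succ i hi ih =>
      rw [stopLevel, ih, if_neg (hnb (i + 1) (Nat.lt_succ_of_le hi))]
  have h1 := this k hjk.le
  have h2 : stopLevel idx bad k x = k := hk
  omega

theorem selCount_mono {j k : ℕ} (hjk : j ≤ k) (x : Ω) :
    selCount idx bad j x ≤ selCount idx bad k x := by
  induction k, hjk using Nat.le_induction with
  | base => exact le_rfl
  | succ k _ ih => exact ih.trans (Nat.le_add_right _ _)

/-- The count changes only at selections, and none occurs after the last one. -/
theorem selCount_stopLevel (k : ℕ) (x : Ω) :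
    selCount idx bad (stopLevel idx bad k x) x = selCount idx bad k x := by
  induction k with
  | zero => rfl
  | succ k ih =>
    by_cases h : stopLevel idx bad (k + 1) x = k + 1
    · rw [h]
    · have h' := (stopLevel_succ_or (idx := idx) (bad := bad) k x).resolve_left h
      have hn : x ∉ selected idx bad (k + 1) := h
      rw [h', ih, selCount, if_neg hn, add_zero]

end Stop

section Nested

variable {Ω ι : Type*} [MeasurableSpace Ω] [MeasurableSpace ι] {idx : ℕ → Ω → ι}
  {bad : ℕ → ι → ℕ → ι → Prop}

theorem Nested.eq_of_le (h : Nested idx) {j k : ℕ} (hjk : j ≤ k) {x y : Ω}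
    (hxy : idx k x = idx k y) : idx j x = idx j y := by
  induction k, hjk using Nat.le_induction with
  | base => exact hxy
  | succ k _ ih => exact ih (h.succ k x y hxy)

theorem Nested.stopLevel_eq (h : Nested idx) {k : ℕ} {x y : Ω} (hxy : idx k x = idx k y) :
    stopLevel idx bad k x = stopLevel idx bad k y := by
  induction k with
  | zero => rfl
  | succ k ih =>
    have hk := h.succ k x y hxy
    have h1 := ih hk
    have h2 : idx (stopLevel idx bad k x) x = idx (stopLevel idx bad k x) y :=
      h.eq_of_le (stopLevel_le k x) hk
    rw [stopLevel, stopLevel, ← h1, h2, hxy]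

theorem Nested.selected_saturated (h : Nested idx) (k : ℕ) (x y : Ω) (hxy : idx k x = idx k y)
    (hx : x ∈ selected idx bad k) : y ∈ selected idx bad k := by
  have := h.stopLevel_eq (bad := bad) hxy
  simp only [selected, mem_ofPred_eq] at hx ⊢
  rw [← this, hx]

theorem Nested.selCount_eq (h : Nested idx) {k : ℕ} {x y : Ω} (hxy : idx k x = idx k y) :
    selCount idx bad k x = selCount idx bad k y := by
  induction k with
  | zero => rfl
  | succ k ih =>
    have hs : x ∈ selected idx bad (k + 1) ↔ y ∈ selected idx bad (k + 1) :=
      ⟨h.selected_saturated _ x y hxy, h.selected_saturated _ y x hxy.symm⟩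
    rw [selCount, selCount, ih (h.succ k x y hxy)]
    by_cases hx : x ∈ selected idx bad (k + 1)
    · rw [if_pos hx, if_pos (hs.1 hx)]
    · rw [if_neg hx, if_neg fun hy => hx (hs.2 hy)]

theorem Nested.measurableSet_cell [MeasurableSingletonClass ι] (h : Nested idx) (k : ℕ) (z : ι) :
    MeasurableSet (idx k ⁻¹' {z}) := h.measurable k (measurableSet_singleton z)

variable [Countable ι] [MeasurableSingletonClass ι]

theorem Nested.measurable_comp (h : Nested idx) (k : ℕ) {β : Type*} [MeasurableSpace β] (G : ι → β) :
    Measurable fun x => G (idx k x) := (measurable_of_countable G).comp (h.measurable k)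

/-- A function that is constant on the cells of level `k` is measurable. -/
theorem Nested.measurable_of_factors (h : Nested idx) {β : Type*} [MeasurableSpace β] {k : ℕ}
    {f : Ω → β} (hf : ∀ x y, idx k x = idx k y → f x = f y) : Measurable f := by
  by_cases hΩ : Nonempty Ω
  · have : Nonempty β := hΩ.map f
    have hfac : Function.FactorsThrough f (idx k) := fun x y hxy => hf x y hxy
    have : f = Function.extend (idx k) f (fun _ => Classical.arbitrary β) ∘ idx k :=
      (hfac.extend_comp _).symm
    rw [this]
    exact h.measurable_comp k _
  · rw [not_nonempty_iff] at hΩ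
    exact measurable_of_empty f

theorem Nested.measurableSet_of_saturated (h : Nested idx) {k : ℕ} {A : Set Ω}
    (hA : ∀ x y, idx k x = idx k y → x ∈ A → y ∈ A) : MeasurableSet A :=
  measurableSet_setOfPred.2 (h.measurable_of_factors (k := k) (f := fun x => x ∈ A) fun x y hxy =>
    propext ⟨hA x y hxy, hA y x hxy.symm⟩)

/-- Inequalities between two measures on the cells of level `k` add up. -/
theorem Nested.measure_le_of_saturated (h : Nested idx) {k : ℕ} {A : Set Ω}
    (hA : ∀ x y, idx k x = idx k y → x ∈ A → y ∈ A) {μ ν : Measure Ω}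
    (hμν : ∀ x ∈ A, μ (idx k ⁻¹' {idx k x}) ≤ ν (idx k ⁻¹' {idx k x})) : μ A ≤ ν A := by
  have hAm := h.measurableSet_of_saturated hA
  have key : ∀ ρ : Measure Ω, ρ A = ∑' z, ρ (A ∩ idx k ⁻¹' {z}) := by
    intro ρ
    rw [← measure_iUnion]
    · congr 1; ext x; simp
    · intro z z' hz
      refine Set.disjoint_left.2 fun x hx hx' => hz ?_
      rw [← hx.2, ← hx'.2]
    · exact fun z => hAm.inter (h.measurableSet_cell k z)
  rw [key μ, key ν]
  refine ENNReal.tsum_le_tsum fun z => ?_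
  rcases (A ∩ idx k ⁻¹' {z}).eq_empty_or_nonempty with he | ⟨x, hx, rfl⟩
  · simp [he]
  · have : A ∩ idx k ⁻¹' {idx k x} = idx k ⁻¹' {idx k x} :=
      inter_eq_right.2 fun y hy => hA x y (Eq.symm hy) hx
    rw [this]
    exact hμν x hx

/-- Inequalities between integrals over the cells of level `k` add up. -/
theorem Nested.lintegral_le_of_saturated (h : Nested idx) {k : ℕ} {A : Set Ω}
    (hA : ∀ x y, idx k x = idx k y → x ∈ A → y ∈ A) {μ : Measure Ω} {f g : Ω → ℝ≥0∞}
    (hfg : ∀ x ∈ A, ∫⁻ y in idx k ⁻¹' {idx k x}, f y ∂μ ≤ ∫⁻ y in idx k ⁻¹' {idx k x}, g y ∂μ) :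
    ∫⁻ y in A, f y ∂μ ≤ ∫⁻ y in A, g y ∂μ := by
  have hAm := h.measurableSet_of_saturated hA
  rw [← withDensity_apply _ hAm, ← withDensity_apply _ hAm]
  refine h.measure_le_of_saturated hA fun x hx => ?_
  rw [withDensity_apply _ (h.measurableSet_cell _ _), withDensity_apply _ (h.measurableSet_cell _ _)]
  exact hfg x hx

/-- The weak type `(1,1)` inequality for the maximal operator of a nested sequence of partitions. -/
theorem Nested.weak_type (h : Nested idx) (μ : Measure Ω) (w : Ω → ℝ≥0∞) (j : ℕ) (z : ι) :
    μ {x | idx j x = z ∧ ∃ k, j ≤ k ∧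
      μ (idx k ⁻¹' {idx k x}) < ∫⁻ y in idx k ⁻¹' {idx k x}, w y ∂μ} ≤
      ∫⁻ y in idx j ⁻¹' {z}, w y ∂μ := by
  classical
  let P : ℕ → Ω → Prop := fun k x =>
    j ≤ k ∧ μ (idx k ⁻¹' {idx k x}) < ∫⁻ y in idx k ⁻¹' {idx k x}, w y ∂μ
  have hP : ∀ {k x y}, idx k x = idx k y → P k x → P k y := by
    intro k x y hxy hx
    simp only [P] at hx ⊢
    rwa [← hxy]
  -- `T k` collects the points whose first large cell has level `k`. These sets are disjoint and are
  -- unions of cells of level `k`, so the inequality on single cells adds up without overlap.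
  let T : ℕ → Set Ω := fun k => {x | idx j x = z ∧ P k x ∧ ∀ i < k, ¬ P i x}
  have hTs : ∀ k x y, idx k x = idx k y → x ∈ T k → y ∈ T k := by
    rintro k x y hxy ⟨h1, h2, h3⟩
    refine ⟨?_, hP hxy h2, fun i hi hy => h3 i hi (hP (h.eq_of_le hi.le hxy.symm) hy)⟩
    rw [← h1]; exact h.eq_of_le h2.1 hxy.symm
  have hTm : ∀ k, MeasurableSet (T k) := fun k => h.measurableSet_of_saturated (hTs k)
  have hdisj : Pairwise (Function.onFun Disjoint T) := by
    intro a b hab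
    refine Set.disjoint_left.2 fun x hx hx' => ?_
    rcases lt_or_gt_of_ne hab with hlt | hlt
    · exact hx'.2.2 a hlt hx.2.1
    · exact hx.2.2 b hlt hx'.2.1
  have hsub : {x | idx j x = z ∧ ∃ k, j ≤ k ∧
      μ (idx k ⁻¹' {idx k x}) < ∫⁻ y in idx k ⁻¹' {idx k x}, w y ∂μ} ⊆ ⋃ k, T k := by
    rintro x ⟨hx, hk⟩
    exact mem_iUnion.2 ⟨Nat.find (p := fun k => P k x) hk, hx, Nat.find_spec (p := fun k => P k x) hk,
      fun i hi => Nat.find_min (p := fun k => P k x) hk hi⟩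
  calc _ ≤ μ (⋃ k, T k) := measure_mono hsub
    _ ≤ ∑' k, μ (T k) := measure_iUnion_le _
    _ ≤ ∑' k, ∫⁻ y in T k, w y ∂μ := by
      refine ENNReal.tsum_le_tsum fun k => ?_
      rw [← withDensity_apply _ (hTm k)]
      refine h.measure_le_of_saturated (hTs k) fun x hx => ?_
      rw [withDensity_apply _ (h.measurableSet_cell _ _)]
      exact hx.2.1.2.le
    _ = ∫⁻ y in ⋃ k, T k, w y ∂μ := (lintegral_iUnion hTm hdisj _).symm
    _ ≤ _ := lintegral_mono_set (iUnion_subset fun k x hx => hx.1)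

theorem Nested.measurableSet_selected (h : Nested idx) (k : ℕ) :
    MeasurableSet (selected idx bad k) := h.measurableSet_of_saturated (h.selected_saturated k)

theorem Nested.measurableSet_lastSelected (h : Nested idx) (k : ℕ) :
    MeasurableSet (lastSelected idx bad k) := by
  have : lastSelected idx bad k =
      selected idx bad k ∩ ⋂ i, ⋂ (_ : k < i), (selected idx bad i)ᶜ := by
    ext x; simp [lastSelected]
  rw [this]
  exact (h.measurableSet_selected k).inter
    (.iInter fun i => .iInter fun _ => (h.measurableSet_selected i).compl)

/-- If bad cells cover at most half of a cell, then the integral over the selected cells is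
controlled by that over their disjoint parts. -/
theorem Nested.lintegral_selected_le (h : Nested idx) {μ : Measure Ω}
    (hfin : ∀ k z, μ (idx k ⁻¹' {z}) < ∞)
    (hbad : ∀ k z, μ (badSet idx bad k z) ≤ 2⁻¹ * μ (idx k ⁻¹' {z})) (G : ι → ℝ≥0∞) (k : ℕ) :
    ∫⁻ x in selected idx bad k, G (idx k x) ∂μ ≤
      2 * ∫⁻ x in lastSelected idx bad k, G (idx k x) ∂μ := by
  have hGm : Measurable fun x => G (idx k x) := h.measurable_comp k G
  have hLm := h.measurableSet_lastSelected (bad := bad) k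
  have hsub : lastSelected idx bad k ⊆ selected idx bad k := fun x hx => hx.1
  have hrw : 2 * ∫⁻ x in lastSelected idx bad k, G (idx k x) ∂μ =
      ∫⁻ x in selected idx bad k,
        (lastSelected idx bad k).indicator (fun x => 2 * G (idx k x)) x ∂μ := by
    rw [← lintegral_const_mul _ hGm, lintegral_indicator hLm, Measure.restrict_restrict hLm,
      inter_eq_left.2 hsub]
  rw [hrw]
  refine h.lintegral_le_of_saturated (h.selected_saturated k) fun x hx => ?_
  set P := idx k ⁻¹' {idx k x} with hP
  have hPm : MeasurableSet P := h.measurableSet_cell _ _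
  have h1 : ∫⁻ y in P, G (idx k y) ∂μ = G (idx k x) * μ P := by
    rw [← setLIntegral_const]
    refine setLIntegral_congr_fun hPm fun y hy => ?_
    have : idx k y = idx k x := hy
    simp only [this]
  have h2 : ∫⁻ y in P, (lastSelected idx bad k).indicator (fun x => 2 * G (idx k x)) y ∂μ =
      2 * G (idx k x) * μ (lastSelected idx bad k ∩ P) := by
    rw [lintegral_indicator hLm, Measure.restrict_restrict hLm, ← setLIntegral_const]
    refine setLIntegral_congr_fun (hLm.inter hPm) fun y hy => ?_
    have : idx k y = idx k x := hy.2
    simp only [this]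
  rw [h1, h2]
  -- The lost part of a selected cell is contained in its bad set, so at least half of the cell
  -- survives; this is the factor 2.
  have h3 : P \ lastSelected idx bad k ⊆ badSet idx bad k (idx k x) := by
    rintro y ⟨hyP, hy⟩
    have hyk : y ∈ selected idx bad k := h.selected_saturated k x y (Eq.symm hyP) hx
    have hyP' : idx k y = idx k x := hyP
    simp only [lastSelected, mem_ofPred_eq, not_and, not_forall, not_not] at hy
    obtain ⟨i, hi, hyi⟩ := hy hyk
    rw [← hyP']
    exact mem_badSet_of_selected hi hyk hyi
  have h4 : μ P ≤ μ (lastSelected idx bad k ∩ P) + 2⁻¹ * μ P := by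
    calc μ P = μ (P ∩ lastSelected idx bad k) + μ (P \ lastSelected idx bad k) :=
          (measure_inter_add_sdiff _ hLm).symm
      _ ≤ _ := by
        rw [inter_comm]
        gcongr
        exact (measure_mono h3).trans (hbad _ _)
  have hhalf : 2⁻¹ * μ P + 2⁻¹ * μ P = μ P := by
    rw [← add_mul, ENNReal.inv_two_add_inv_two, one_mul]
  have h5 : 2⁻¹ * μ P ≤ μ (lastSelected idx bad k ∩ P) := by
    have hne : 2⁻¹ * μ P ≠ ∞ := ENNReal.mul_ne_top (by simp) (hfin _ _).ne
    refine (ENNReal.add_le_add_iff_right hne).1 ?_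
    rwa [hhalf]
  calc G (idx k x) * μ P = 2 * G (idx k x) * (2⁻¹ * μ P) := by
        rw [← hhalf]; nth_rw 1 [← two_mul]; rw [hhalf]; ring
    _ ≤ _ := by gcongr

/-- The sparse domination of a sum over all cells by a sum over selected cells. -/
theorem Nested.lintegral_tsum_le_selected (h : Nested idx) {μ : Measure Ω}
    (hself : ∀ k z, ¬ bad k z k z) (c : ℕ → ℝ≥0∞) (H F : ℕ → ι → ℝ≥0∞) (K C : ℝ≥0∞)
    (hF : ∀ j z k z', ¬ bad j z k z' → F k z' ≤ K * F j z)
    (hH : ∀ j k z, j ≤ k → ∫⁻ x in idx j ⁻¹' {z}, H k (idx k x) ∂μ ≤ C * (μ (idx j ⁻¹' {z}) * H j z)) :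
    ∫⁻ x, ∑' k, c k * (H k (idx k x) * F k (idx k x)) ∂μ ≤
      K * C * ∑' j, ∫⁻ x in selected idx bad j,
        (∑' k, c (j + k)) * (H j (idx j x) * F j (idx j x)) ∂μ := by
  have hmeas : ∀ (G : ℕ → ι → ℝ≥0∞) k, Measurable fun x => G k (idx k x) := fun G k =>
    h.measurable_comp k (G k)
  have hm1 : ∀ j k, Measurable fun x => H k (idx k x) * (K * F j (idx j x)) := fun j k =>
    (hmeas H _).mul ((hmeas F _).const_mul _)
  have hm2 : ∀ j, Measurable fun x => K * C * (H j (idx j x) * F j (idx j x)) := fun j =>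
    ((hmeas H _).mul (hmeas F _)).const_mul _
  have hm3 : ∀ j, Measurable fun x => (∑' k, c (j + k)) * (H j (idx j x) * F j (idx j x)) := fun j =>
    ((hmeas H _).mul (hmeas F _)).const_mul _
  let S := selected idx bad
  have hSm : ∀ j, MeasurableSet (S j) := fun j => h.measurableSet_selected j
  have hpt : ∀ x, ∑' k, c k * (H k (idx k x) * F k (idx k x)) ≤
      ∑' j, ∑' k, (S j).indicator (fun x => c (j + k) * (H (j + k) (idx (j + k) x) *
        (K * F j (idx j x)))) x := by
    intro x
    rw [← ENNReal.tsum_prod (f := fun j k => (S j).indicator (fun x => c (j + k) *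
      (H (j + k) (idx (j + k) x) * (K * F j (idx j x)))) x)]
    -- Each level `k` is charged to its stopping level and the excess over it. The pair determines
    -- `k`, so no term of the double sum is used twice.
    have hinj : Function.Injective fun k => (stopLevel idx bad k x, k - stopLevel idx bad k x) := by
      intro a b hab
      have ha := stopLevel_le (idx := idx) (bad := bad) a x
      have hb := stopLevel_le (idx := idx) (bad := bad) b x
      simp only [Prod.mk.injEq] at hab
      omega
    refine le_trans (ENNReal.tsum_le_tsum fun k => ?_)
      (ENNReal.tsum_comp_le_tsum_of_injective hinj _)
    have hmem : x ∈ S (stopLevel idx bad k x) := stopLevel_stopLevel k x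
    have hk : stopLevel idx bad k x + (k - stopLevel idx bad k x) = k :=
      Nat.add_sub_cancel' (stopLevel_le k x)
    simp only [indicator_of_mem hmem, hk]
    gcongr
    exact hF _ _ _ _ (not_bad_stopLevel hself k x)
  calc ∫⁻ x, ∑' k, c k * (H k (idx k x) * F k (idx k x)) ∂μ
      ≤ ∫⁻ x, ∑' j, ∑' k, (S j).indicator (fun x => c (j + k) * (H (j + k) (idx (j + k) x) *
        (K * F j (idx j x)))) x ∂μ := lintegral_mono hpt
    _ = ∑' j, ∑' k, ∫⁻ x in S j, c (j + k) * (H (j + k) (idx (j + k) x) *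
        (K * F j (idx j x))) ∂μ := by
      have hm' : ∀ j k, Measurable ((S j).indicator (fun x => c (j + k) *
          (H (j + k) (idx (j + k) x) * (K * F j (idx j x))))) := fun j k =>
        ((hm1 _ _).const_mul _).indicator (hSm j)
      rw [lintegral_tsum fun j => (Measurable.tsum fun k => hm' j k).aemeasurable]
      congr 1; ext j
      rw [lintegral_tsum fun k => (hm' j k).aemeasurable]
      congr 1; ext k
      rw [lintegral_indicator (hSm j)]
    _ ≤ ∑' j, ∑' k, ∫⁻ x in S j, c (j + k) * (K * C * (H j (idx j x) * F j (idx j x))) ∂μ := by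
      refine ENNReal.tsum_le_tsum fun j => ENNReal.tsum_le_tsum fun k => ?_
      rw [lintegral_const_mul _ (hm1 _ _), lintegral_const_mul _ (hm2 _)]
      gcongr c (j + k) * ?_
      refine h.lintegral_le_of_saturated (h.selected_saturated j) fun x _ => ?_
      have hcell := h.measurableSet_cell j (idx j x)
      calc ∫⁻ y in idx j ⁻¹' {idx j x}, H (j + k) (idx (j + k) y) * (K * F j (idx j y)) ∂μ
          = ∫⁻ y in idx j ⁻¹' {idx j x}, H (j + k) (idx (j + k) y) * (K * F j (idx j x)) ∂μ := by
            refine setLIntegral_congr_fun hcell fun y hy => ?_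
            have : idx j y = idx j x := hy
            simp only [this]
        _ = (∫⁻ y in idx j ⁻¹' {idx j x}, H (j + k) (idx (j + k) y) ∂μ) * (K * F j (idx j x)) :=
            lintegral_mul_const _ (hmeas H _)
        _ ≤ C * (μ (idx j ⁻¹' {idx j x}) * H j (idx j x)) * (K * F j (idx j x)) := by
            gcongr
            exact hH j (j + k) _ (Nat.le_add_right _ _)
        _ = K * C * (H j (idx j x) * F j (idx j x)) * μ (idx j ⁻¹' {idx j x}) := by ring
        _ = ∫⁻ y in idx j ⁻¹' {idx j x}, K * C * (H j (idx j x) * F j (idx j x)) ∂μ := by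
            rw [setLIntegral_const]
        _ = _ := by
            refine setLIntegral_congr_fun hcell fun y hy => ?_
            have : idx j y = idx j x := hy
            simp only [this]
    _ = _ := by
      rw [← ENNReal.tsum_mul_left]
      congr 1; ext j
      rw [← lintegral_tsum fun k => ((hm2 _).const_mul _).aemeasurable,
        ← lintegral_const_mul _ (hm3 _)]
      congr 1; ext x
      rw [ENNReal.tsum_mul_right]
      ring

/-- If bad cells cover at most the proportion `η` of a cell, then the points with at least `i`
selected cells around them cover at most the proportion `η ^ i` of a cell of level `0`. -/
theorem Nested.measure_selCount_le (h : Nested idx) {μ : Measure Ω} {η : ℝ≥0∞}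
    (hbad : ∀ k z, μ (badSet idx bad k z) ≤ η * μ (idx k ⁻¹' {z})) (z : ι) (i : ℕ) :
    μ {x | idx 0 x = z ∧ ∃ k, i ≤ selCount idx bad k x} ≤ η ^ i * μ (idx 0 ⁻¹' {z}) := by
  induction i with
  | zero =>
    rw [pow_zero, one_mul]
    exact measure_mono fun x hx => hx.1
  | succ i ih =>
    -- For `i > 0` these are the cells at which the `i`-th selection takes place; for `i = 0` only
    -- level `0` contributes. A point lies in at most one `T k`, and the next selection around it
    -- takes place inside the bad set of that cell, which costs another factor `η`.
    let T : ℕ → Set Ω := fun k => {x | idx 0 x = z ∧ x ∈ selected idx bad k ∧ selCount idx bad k x = i}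
    let B : ℕ → Set Ω := fun k => {x | x ∈ badSet idx bad k (idx k x)}
    have hTs : ∀ k x y, idx k x = idx k y → x ∈ T k → y ∈ T k := by
      rintro k x y hxy ⟨h1, h2, h3⟩
      exact ⟨by rw [← h1]; exact (h.eq_of_le (Nat.zero_le k) hxy).symm,
        h.selected_saturated k x y hxy h2, by rw [← h3]; exact (h.selCount_eq hxy).symm⟩
    have hTm : ∀ k, MeasurableSet (T k) := fun k => h.measurableSet_of_saturated (hTs k)
    have hlt : ∀ a b, a < b → ∀ x, x ∈ T a → x ∈ T b → False := by
      rintro a b hab x ⟨_, _, h3⟩ ⟨_, h2', h3'⟩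
      obtain ⟨b, rfl⟩ := Nat.exists_eq_succ_of_ne_zero (Nat.ne_zero_of_lt hab)
      have := selCount_mono (idx := idx) (bad := bad) (Nat.le_of_lt_succ hab) x
      rw [Nat.succ_eq_add_one, selCount, if_pos h2'] at h3'
      omega
    have hdisj : Pairwise (Function.onFun Disjoint T) := by
      intro a b hab
      refine Set.disjoint_left.2 fun x hx hx' => ?_
      rcases lt_or_gt_of_ne hab with hl | hl
      · exact hlt a b hl x hx hx'
      · exact hlt b a hl x hx' hx
    have hsub : {x | idx 0 x = z ∧ ∃ k, i + 1 ≤ selCount idx bad k x} ⊆ ⋃ k, T k ∩ B k := by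
      rintro x ⟨hx, k, hk⟩
      have hex : ∃ k, i + 1 ≤ selCount idx bad k x := ⟨k, hk⟩
      classical
      set k0 := Nat.find hex with hk0
      have hspec : i + 1 ≤ selCount idx bad k0 x := Nat.find_spec hex
      have hk0' : k0 ≠ 0 := by
        intro h0
        rw [h0] at hspec
        simp [selCount] at hspec
      obtain ⟨k1, hk1⟩ := Nat.exists_eq_succ_of_ne_zero hk0'
      have hlt1 : ¬ i + 1 ≤ selCount idx bad k1 x := Nat.find_min hex (by omega)
      rw [hk1, Nat.succ_eq_add_one, selCount] at hspec
      have hsel : x ∈ selected idx bad (k1 + 1) := by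
        by_contra hn
        rw [if_neg hn] at hspec
        omega
      rw [if_pos hsel] at hspec
      refine mem_iUnion.2 ⟨stopLevel idx bad k1 x, ⟨hx, stopLevel_stopLevel k1 x, ?_⟩, ?_⟩
      · rw [selCount_stopLevel]; omega
      · exact mem_badSet_of_selected (Nat.lt_succ_of_le (stopLevel_le k1 x))
          (stopLevel_stopLevel k1 x) hsel
    calc _ ≤ μ (⋃ k, T k ∩ B k) := measure_mono hsub
      _ ≤ ∑' k, μ (T k ∩ B k) := measure_iUnion_le _
      _ ≤ ∑' k, (η • μ) (T k) := by
        refine ENNReal.tsum_le_tsum fun k => ?_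
        rw [← Measure.restrict_apply (hTm k)]
        refine h.measure_le_of_saturated (hTs k) fun x _ => ?_
        rw [Measure.restrict_apply (h.measurableSet_cell _ _)]
        refine le_trans (measure_mono ?_) (hbad k (idx k x))
        rintro y ⟨hy1, hy2⟩
        have hy1' : idx k y = idx k x := hy1
        rw [← hy1']
        exact hy2
      _ = η * μ (⋃ k, T k) := by
        rw [← measure_iUnion hdisj hTm, Measure.smul_apply, smul_eq_mul]
      _ ≤ η * (η ^ i * μ (idx 0 ⁻¹' {z})) := by
        gcongr
        refine le_trans (measure_mono ?_) ih
        exact iUnion_subset fun k x hx => ⟨hx.1, k, hx.2.2.ge⟩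
      _ = _ := by ring

end Nested

/-! ### Luxemburg averages -/

theorem youngLlog_zero (α : ℝ) : youngLlog α 0 = 0 := by simp [youngLlog]

/-- The only consequence of convexity that is needed. The value at `∞` is `∞`, because `toReal`
sends `∞` to `0` and the logarithmic factor is then `1`. -/
theorem youngLlog_mul_le {α : ℝ} (hα : 0 ≤ α) {s t : ℝ≥0∞} (hs : s ≤ 1) (hs0 : s ≠ 0) :
    youngLlog α (s * t) ≤ s * youngLlog α t := by
  rcases eq_or_ne t ∞ with rfl | ht
  · simp [youngLlog, hs0]
  · rw [youngLlog, youngLlog, mul_assoc]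
    gcongr
    exact mul_le_of_le_one_left zero_le hs

theorem youngLlog_mono {α : ℝ} (hα : 0 ≤ α) {s t : ℝ≥0∞} (hst : s ≤ t) :
    youngLlog α s ≤ youngLlog α t := by
  rcases eq_or_ne t ∞ with rfl | ht
  · simp [youngLlog]
  · rw [youngLlog, youngLlog]
    gcongr

theorem le_youngLlog {α : ℝ} (hα : 0 ≤ α) (t : ℝ≥0∞) : t ≤ youngLlog α t := by
  rw [youngLlog]
  refine le_mul_of_one_le_right zero_le ?_
  exact (ENNReal.one_rpow α).symm.trans_le (ENNReal.rpow_le_rpow le_self_add hα)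

theorem youngLlog_zero_left (t : ℝ≥0∞) : youngLlog 0 t = t := by simp [youngLlog]

/-- The Luxemburg average of `h` for the Young function `t (1 + log⁺ t)^α`, with respect to the
normalization of the measure `μ`. -/
def orl {Ω : Type*} [MeasurableSpace Ω] (α : ℝ) (μ : Measure Ω) (h : Ω → ℝ≥0∞) : ℝ≥0∞ :=
  sInf {r : ℝ≥0∞ | 0 < r ∧ ∫⁻ x, youngLlog α (h x / r) ∂μ ≤ μ univ}

section orl

variable {Ω : Type*} [MeasurableSpace Ω] {α : ℝ} {μ : Measure Ω} {h : Ω → ℝ≥0∞}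

/-- Levels strictly above the norm make it unnecessary to know whether the infimum is attained. -/
theorem lintegral_young_le_of_orl_lt (hα : 0 ≤ α) {r : ℝ≥0∞} (hr : orl α μ h < r) :
    ∫⁻ x, youngLlog α (h x / r) ∂μ ≤ μ univ := by
  obtain ⟨r', ⟨_, hr'⟩, hlt⟩ := sInf_lt_iff.1 hr
  refine le_trans (lintegral_mono fun x => youngLlog_mono hα ?_) hr'
  gcongr

theorem orl_le {r : ℝ≥0∞} (hr : 0 < r) (h' : ∫⁻ x, youngLlog α (h x / r) ∂μ ≤ μ univ) :
    orl α μ h ≤ r := sInf_le ⟨hr, h'⟩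

/-- Allows a bound by a Luxemburg norm to be proved at finite levels `r` above it, where the modular
inequality is available. -/
theorem le_mul_of_forall_lt {a M N : ℝ≥0∞} (hM : M ≠ 0) (hM' : M ≠ ∞)
    (H : ∀ r, N < r → r < ∞ → a ≤ M * r) : a ≤ M * N := by
  have : a / M ≤ N := by
    refine le_of_forall_gt_imp_ge_of_dense fun r hr => ?_
    rcases eq_or_ne r ∞ with rfl | hr'
    · exact le_top
    · exact ENNReal.div_le_of_le_mul' (H r hr hr'.lt_top)
  rw [mul_comm]
  exact (ENNReal.div_le_iff hM hM').1 this

theorem lintegral_le_orl (hα : 0 ≤ α) (h0 : μ univ ≠ 0) (h1 : μ univ ≠ ∞) :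
    ∫⁻ x, h x ∂μ ≤ μ univ * orl α μ h := by
  refine le_mul_of_forall_lt h0 h1 fun r hr hr' => ?_
  have hr0 : r ≠ 0 := (zero_le.trans_lt hr).ne'
  have h2 : ∫⁻ x, r⁻¹ * h x ∂μ ≤ μ univ := by
    refine le_trans (lintegral_mono fun x => ?_) (lintegral_young_le_of_orl_lt hα hr)
    rw [mul_comm, ← div_eq_mul_inv]
    exact le_youngLlog hα _
  rw [lintegral_const_mul' _ _ (ENNReal.inv_ne_top.2 hr0)] at h2
  rw [mul_comm]
  exact (ENNReal.inv_mul_le_iff hr0 hr'.ne).1 h2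

/-- The level `r * s` with `s = 1 + A / μ univ` is admissible, since enlarging the level by `s`
divides the modular by at least `s`. For fixed `r` the right side is additive in `μ`, unlike the
norm itself. -/
theorem mul_orl_le (hα : 0 ≤ α) (h0 : μ univ ≠ 0) (h1 : μ univ ≠ ∞) {r : ℝ≥0∞} (hr0 : r ≠ 0)
    (hr1 : r ≠ ∞) :
    μ univ * orl α μ h ≤ r * (μ univ + ∫⁻ x, youngLlog α (h x / r) ∂μ) := by
  set A := ∫⁻ x, youngLlog α (h x / r) ∂μ with hA
  rcases eq_or_ne A ∞ with hAt | hAt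
  · rw [hAt, add_top, ENNReal.mul_top hr0]; exact le_top
  set s := 1 + A / μ univ with hs
  have hs1 : 1 ≤ s := le_self_add
  have hst : s ≠ ∞ := ENNReal.add_ne_top.2 ⟨ENNReal.one_ne_top, ENNReal.div_ne_top hAt h0⟩
  have hs0 : s ≠ 0 := (zero_lt_one.trans_le hs1).ne'
  have hMs : μ univ * s = μ univ + A := by
    rw [hs, mul_add, mul_one, ENNReal.mul_div_cancel h0 h1]
  have key : orl α μ h ≤ r * s := by
    refine orl_le (pos_iff_ne_zero.2 (mul_ne_zero hr0 hs0)) ?_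
    calc ∫⁻ x, youngLlog α (h x / (r * s)) ∂μ ≤ ∫⁻ x, s⁻¹ * youngLlog α (h x / r) ∂μ := by
          refine lintegral_mono fun x => ?_
          have : h x / (r * s) = s⁻¹ * (h x / r) := by
            rw [div_eq_mul_inv, div_eq_mul_inv, ENNReal.mul_inv (Or.inl hr0) (Or.inl hr1)]; ring
          rw [this]
          exact youngLlog_mul_le hα (ENNReal.inv_le_one.2 hs1) (ENNReal.inv_ne_zero.2 hst)
      _ = s⁻¹ * A := lintegral_const_mul' _ _ (ENNReal.inv_ne_top.2 hs0)
      _ ≤ μ univ := by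
        rw [ENNReal.inv_mul_le_iff hs0 hst, mul_comm, hMs]
        exact le_add_self
  calc μ univ * orl α μ h ≤ μ univ * (r * s) := by gcongr
    _ = r * (μ univ * s) := by ring
    _ = _ := by rw [hMs]

theorem orl_congr {h' : Ω → ℝ≥0∞} (hh : h =ᵐ[μ] h') : orl α μ h = orl α μ h' := by
  have : ∀ r : ℝ≥0∞, ∫⁻ x, youngLlog α (h x / r) ∂μ = ∫⁻ x, youngLlog α (h' x / r) ∂μ := fun r =>
    lintegral_congr_ae (by filter_upwards [hh] with x hx; rw [hx])
  simp only [orl, this]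

theorem orl_eq_zero_of_ae (hh : h =ᵐ[μ] 0) : orl α μ h = 0 := by
  rw [orl_congr hh]
  refine le_antisymm (le_of_forall_gt_imp_ge_of_dense fun r hr => ?_) zero_le
  refine orl_le hr ?_
  simp [youngLlog_zero]

theorem ae_eq_zero_of_orl (hα : 0 ≤ α) (h0 : μ univ ≠ 0) (h1 : μ univ ≠ ∞)
    (hm : AEMeasurable h μ) (hh : orl α μ h = 0) : h =ᵐ[μ] 0 := by
  have := lintegral_le_orl (h := h) hα h0 h1
  rw [hh, mul_zero, nonpos_iff_eq_zero] at this
  exact (lintegral_eq_zero_iff' hm).1 this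

theorem mul_orl_zero_le (h0 : μ univ ≠ 0) (h1 : μ univ ≠ ∞) (hm : AEMeasurable h μ) :
    μ univ * orl 0 μ h ≤ ∫⁻ x, h x ∂μ := by
  rcases eq_or_ne (∫⁻ x, h x ∂μ) 0 with hz | hz
  · rw [orl_eq_zero_of_ae ((lintegral_eq_zero_iff' hm).1 hz)]
    simp
  rcases eq_or_ne (∫⁻ x, h x ∂μ) ∞ with ht | ht
  · rw [ht]; exact le_top
  have : orl 0 μ h ≤ (∫⁻ x, h x ∂μ) / μ univ := by
    refine orl_le (ENNReal.div_pos hz h1) ?_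
    simp_rw [youngLlog_zero_left, div_eq_mul_inv]
    have hne : ((∫⁻ x, h x ∂μ) * (μ univ)⁻¹)⁻¹ ≠ ∞ :=
      ENNReal.inv_ne_top.2 (mul_ne_zero hz (ENNReal.inv_ne_zero.2 h1))
    rw [lintegral_mul_const' _ _ hne, ENNReal.mul_inv (Or.inl hz) (Or.inl ht), inv_inv,
      ← mul_assoc, ENNReal.mul_inv_cancel hz ht, one_mul]
  calc μ univ * orl 0 μ h ≤ μ univ * ((∫⁻ x, h x ∂μ) / μ univ) := by gcongr
    _ = _ := ENNReal.mul_div_cancel h0 h1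

end orl

/-! ### Cubes and dyadic grids -/

theorem measurableSet_cube {n : ℕ} (a : E n) (l : ℝ) : MeasurableSet (cube a l) := by
  have : cube a l = ⋂ i, {x : E n | a i ≤ x i ∧ x i ≤ a i + l} := by ext; simp [cube]
  rw [this]
  refine .iInter fun i => ?_
  have hm : Measurable fun x : E n => x i := by fun_prop
  exact (measurableSet_le measurable_const hm).inter (measurableSet_le hm measurable_const)

theorem volume_cube {n : ℕ} (a : E n) {l : ℝ} (hl : 0 ≤ l) :
    volume (cube a l) = ENNReal.ofReal (l ^ n) := by
  have h := (EuclideanSpace.volume_preserving_symm_measurableEquiv_toLp (Fin n)).measure_preimage_equiv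
    (Set.Icc (fun i => a i) (fun i => a i + l))
  rw [Real.volume_Icc_pi] at h
  have hs : (MeasurableEquiv.toLp 2 (Fin n → ℝ)).symm ⁻¹' (Set.Icc (fun i => a i) fun i => a i + l) =
      cube a l := by
    ext x
    simp only [mem_preimage, Set.mem_Icc, Pi.le_def, cube, mem_ofPred_eq]
    exact ⟨fun h i => ⟨h.1 i, h.2 i⟩, fun h => ⟨fun i => (h i).1, fun i => (h i).2⟩⟩
  rw [hs] at h
  rw [h]
  simp [ENNReal.ofReal_pow hl]

theorem volume_cube_ne_zero {n : ℕ} (a : E n) {l : ℝ} (hl : 0 < l) : volume (cube a l) ≠ 0 := by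
  rw [volume_cube a hl.le]
  exact (ENNReal.ofReal_pos.2 (pow_pos hl n)).ne'

theorem volume_cube_ne_top {n : ℕ} (a : E n) {l : ℝ} (hl : 0 < l) : volume (cube a l) ≠ ∞ := by
  rw [volume_cube a hl.le]
  exact ENNReal.ofReal_ne_top

theorem lintegral_comp_smul {n : ℕ} {l : ℝ} (hl : 0 < l) (G : E n → ℝ≥0∞) :
    ∫⁻ x, G (l • x) = (ENNReal.ofReal (l ^ n))⁻¹ * ∫⁻ x, G x := by
  have h1 := Measure.map_addHaar_smul (volume : Measure (E n)) hl.ne'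
  have h2 := lintegral_map_equiv (μ := (volume : Measure (E n))) G
    (Homeomorph.smulOfNeZero l hl.ne').toMeasurableEquiv
  have h3 : ⇑(Homeomorph.smulOfNeZero (α := E n) l hl.ne').toMeasurableEquiv = fun x => l • x := rfl
  rw [h3, h1, lintegral_smul_measure] at h2
  rw [← h2, finrank_euclideanSpace_fin, abs_of_pos (by positivity),
    ENNReal.ofReal_inv_of_pos (by positivity), smul_eq_mul]

/-- Luxemburg averages over cubes, without dilations. -/
theorem avg_normLlog {n : ℕ} (α : ℝ) (a : E n) {l : ℝ} (hl : 0 < l) (h : E n → ℝ≥0∞) :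
    avg (normLlog α) a l h = orl α (volume.restrict (cube a l)) h := by
  rw [avg, normLlog, orl]
  congr 1
  ext r
  refine and_congr_right fun hr => ?_
  have h1 : ∀ x, youngLlog α ((cube a l).indicator h x / r) =
      (cube a l).indicator (fun x => youngLlog α (h x / r)) x := by
    intro x
    by_cases hx : x ∈ cube a l
    · simp [hx]
    · simp [hx, youngLlog_zero]
  rw [lintegral_comp_smul hl (fun x => youngLlog α ((cube a l).indicator h x / r))]
  simp_rw [h1]
  rw [lintegral_indicator (measurableSet_cube a l), Measure.restrict_apply_univ, volume_cube a hl.le,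
    ENNReal.inv_mul_le_iff (by positivity) ENNReal.ofReal_ne_top, mul_one]

/-- The index of the half-open cube of side `L / 2 ^ k` around `x` in the dyadic grid with the
offset `τ`. -/
def gridIdx {n : ℕ} (τ : E n) (L : ℝ) (k : ℕ) (x : E n) : Fin n → ℤ :=
  fun i => ⌊(x i - τ i) / (L / 2 ^ k)⌋

/-- The lower corner of the cube of level `k` and index `z`. -/
def gridCorner {n : ℕ} (τ : E n) (L : ℝ) (k : ℕ) (z : Fin n → ℤ) : E n :=
  WithLp.toLp 2 fun i => τ i + z i * (L / 2 ^ k)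

section Grid

variable {n : ℕ} (τ : E n) {L : ℝ} (hL : 0 < L)

theorem nested_gridIdx (L : ℝ) : Nested (gridIdx τ L) where
  measurable k := by
    refine measurable_pi_lambda _ fun i => ?_
    exact Int.measurable_floor.comp (by fun_prop)
  succ k x y h := by
    ext i
    have hi := congrFun h i
    have key : ∀ t : ℝ, ⌊t / (L / 2 ^ k)⌋ = ⌊t / (L / 2 ^ (k + 1))⌋ / 2 := by
      intro t
      have := Int.floor_div_natCast (t / (L / 2 ^ (k + 1))) 2
      rw [Nat.cast_ofNat] at this
      rw [show ((2 : ℕ) : ℤ) = 2 from rfl] at this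
      rw [← this]
      congr 1
      rw [pow_succ]
      field_simp
    simp only [gridIdx] at hi ⊢
    rw [key, key, hi]

theorem gridCell_eq (hL : 0 < L) (k : ℕ) (z : Fin n → ℤ) :
    gridIdx τ L k ⁻¹' {z} = {x | ∀ i, x i ∈ Set.Ico (gridCorner τ L k z i)
      (gridCorner τ L k z i + L / 2 ^ k)} := by
  ext x
  have hs : 0 < L / 2 ^ k := by positivity
  simp only [mem_preimage, mem_singleton_iff, funext_iff, gridIdx, mem_ofPred_eq, gridCorner,
    Int.floor_eq_iff, Set.mem_Ico]
  refine forall_congr' fun i => ?_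
  rw [le_div_iff₀ hs, div_lt_iff₀ hs]
  constructor
  · rintro ⟨h1, h2⟩; constructor <;> linarith
  · rintro ⟨h1, h2⟩; constructor <;> linarith

theorem gridCell_subset_cube (hL : 0 < L) (k : ℕ) (z : Fin n → ℤ) :
    gridIdx τ L k ⁻¹' {z} ⊆ cube (gridCorner τ L k z) (L / 2 ^ k) := by
  rw [gridCell_eq τ hL]
  exact fun x hx i => ⟨(hx i).1, (hx i).2.le⟩

theorem volume_gridCell (hL : 0 < L) (k : ℕ) (z : Fin n → ℤ) :
    volume (gridIdx τ L k ⁻¹' {z}) = ENNReal.ofReal ((L / 2 ^ k) ^ n) := by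
  have h := (EuclideanSpace.volume_preserving_symm_measurableEquiv_toLp (Fin n)).measure_preimage_equiv
    (Set.univ.pi fun i => Set.Ico (gridCorner τ L k z i) (gridCorner τ L k z i + L / 2 ^ k))
  rw [Real.volume_pi_Ico] at h
  have hs : (MeasurableEquiv.toLp 2 (Fin n → ℝ)).symm ⁻¹' (Set.univ.pi fun i =>
      Set.Ico (gridCorner τ L k z i) (gridCorner τ L k z i + L / 2 ^ k)) =
      gridIdx τ L k ⁻¹' {z} := by
    rw [gridCell_eq τ hL]
    ext x
    simp only [mem_preimage, Set.mem_univ_pi, mem_ofPred_eq]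
    rfl
  rw [hs] at h
  rw [h]
  simp [ENNReal.ofReal_pow (show 0 ≤ L / 2 ^ k by positivity)]

theorem volume_gridCell_ne_zero (hL : 0 < L) (k : ℕ) (z : Fin n → ℤ) :
    volume (gridIdx τ L k ⁻¹' {z}) ≠ 0 := by
  rw [volume_gridCell τ hL]
  exact (ENNReal.ofReal_pos.2 (by positivity)).ne'

theorem volume_gridCell_ne_top (hL : 0 < L) (k : ℕ) (z : Fin n → ℤ) :
    volume (gridIdx τ L k ⁻¹' {z}) ≠ ∞ := by
  rw [volume_gridCell τ hL]
  exact ENNReal.ofReal_ne_top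

/-- Averages are taken over closed cubes, partitions consist of half-open cells; the difference is a
null set. -/
theorem restrict_gridCell (hL : 0 < L) (k : ℕ) (z : Fin n → ℤ) :
    (volume : Measure (E n)).restrict (cube (gridCorner τ L k z) (L / 2 ^ k)) =
      volume.restrict (gridIdx τ L k ⁻¹' {z}) := by
  refine Measure.restrict_congr_set (ae_eq_of_subset_of_measure_ge (gridCell_subset_cube τ hL k z) ?_
    ((nested_gridIdx τ L).measurableSet_cell k z).nullMeasurableSet
    (volume_cube_ne_top _ (by positivity))).symm
  rw [volume_gridCell τ hL, volume_cube _ (by positivity)]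

/-- The Luxemburg average over the cell of level `k` and index `z`. -/
def gridOrl (τ : E n) (L α : ℝ) (h : E n → ℝ≥0∞) (k : ℕ) (z : Fin n → ℤ) : ℝ≥0∞ :=
  orl α (volume.restrict (gridIdx τ L k ⁻¹' {z})) h

theorem gridOrl_eq_avg (hL : 0 < L) (α : ℝ) (h : E n → ℝ≥0∞) (k : ℕ) (z : Fin n → ℤ) :
    gridOrl τ L α h k z = avg (normLlog α) (gridCorner τ L k z) (L / 2 ^ k) h := by
  rw [avg_normLlog _ _ (by positivity), restrict_gridCell τ hL, gridOrl]

/-- For `r` above the norm on the large cell, `mul_orl_le` with this same `r` bounds each subcell by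
`r` times its volume plus its modular. Both add up to at most the volume of the large cell, hence
the factor 2. -/
theorem setLIntegral_gridOrl_le (hL : 0 < L) {α : ℝ} (hα : 0 ≤ α) (h : E n → ℝ≥0∞) (j k : ℕ)
    (z : Fin n → ℤ) (hjk : j ≤ k) :
    ∫⁻ x in gridIdx τ L j ⁻¹' {z}, gridOrl τ L α h k (gridIdx τ L k x) ≤
      2 * (volume (gridIdx τ L j ⁻¹' {z}) * gridOrl τ L α h j z) := by
  have hN := nested_gridIdx τ L
  rw [← mul_assoc]
  refine le_mul_of_forall_lt
    (mul_ne_zero two_ne_zero (volume_gridCell_ne_zero τ hL j z))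
    (ENNReal.mul_ne_top ENNReal.ofNat_ne_top (volume_gridCell_ne_top τ hL j z)) fun r hr hr' => ?_
  have hr0 : r ≠ 0 := (zero_le.trans_lt hr).ne'
  calc ∫⁻ x in gridIdx τ L j ⁻¹' {z}, gridOrl τ L α h k (gridIdx τ L k x)
      ≤ ∫⁻ x in gridIdx τ L j ⁻¹' {z}, r * (1 + youngLlog α (h x / r)) := by
        refine hN.lintegral_le_of_saturated (k := k) ?_ fun x _ => ?_
        · intro x y hxy hx
          exact (hN.eq_of_le hjk hxy).symm.trans hx
        · have h1 : ∫⁻ y in gridIdx τ L k ⁻¹' {gridIdx τ L k x}, gridOrl τ L α h k (gridIdx τ L k y) =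
              gridOrl τ L α h k (gridIdx τ L k x) *
                volume (gridIdx τ L k ⁻¹' {gridIdx τ L k x}) := by
            rw [← setLIntegral_const]
            refine setLIntegral_congr_fun (hN.measurableSet_cell _ _) fun y hy => ?_
            have : gridIdx τ L k y = gridIdx τ L k x := hy
            simp only [this]
          rw [h1, lintegral_const_mul' _ _ hr'.ne, lintegral_add_left measurable_const,
            setLIntegral_const, one_mul, mul_comm]
          have := mul_orl_le (h := h) (r := r)
            (μ := volume.restrict (gridIdx τ L k ⁻¹' {gridIdx τ L k x})) hα
            (by rw [Measure.restrict_apply_univ]; exact volume_gridCell_ne_zero τ hL _ _)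
            (by rw [Measure.restrict_apply_univ]; exact volume_gridCell_ne_top τ hL _ _) hr0 hr'.ne
          rwa [Measure.restrict_apply_univ] at this
    _ = r * (volume (gridIdx τ L j ⁻¹' {z}) +
          ∫⁻ x in gridIdx τ L j ⁻¹' {z}, youngLlog α (h x / r)) := by
        rw [lintegral_const_mul' _ _ hr'.ne, lintegral_add_left measurable_const,
            setLIntegral_const, one_mul]
    _ ≤ r * (volume (gridIdx τ L j ⁻¹' {z}) + volume (gridIdx τ L j ⁻¹' {z})) := by
        gcongr
        have := lintegral_young_le_of_orl_lt hα hr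
        rwa [Measure.restrict_apply_univ] at this
    _ = _ := by ring

/-- A large norm on a subcell means a large modular at the level `K * r`, so the weak type
inequality applies to the modular, and its integral gains `K⁻¹` by `youngLlog_mul_le`. -/
theorem measure_gridOrl_lt_le (hL : 0 < L) {α : ℝ} (hα : 0 ≤ α) {h : E n → ℝ≥0∞}
    (hm : AEMeasurable h volume) {K : ℝ≥0∞} (hK : 1 ≤ K) (hK' : K ≠ ∞) (j : ℕ) (z : Fin n → ℤ) :
    volume {x | gridIdx τ L j x = z ∧
      ∃ k, j < k ∧ 2 * K * gridOrl τ L α h j z < gridOrl τ L α h k (gridIdx τ L k x)} ≤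
      K⁻¹ * volume (gridIdx τ L j ⁻¹' {z}) := by
  have hN := nested_gridIdx τ L
  have hK0 : K ≠ 0 := (zero_lt_one.trans_le hK).ne'
  have hcz : ∀ k z, (volume.restrict (gridIdx τ L k ⁻¹' {z})) univ ≠ 0 := fun k z => by
    rw [Measure.restrict_apply_univ]; exact volume_gridCell_ne_zero τ hL _ _
  have hct : ∀ k z, (volume.restrict (gridIdx τ L k ⁻¹' {z})) univ ≠ ∞ := fun k z => by
    rw [Measure.restrict_apply_univ]; exact volume_gridCell_ne_top τ hL _ _
  set N := gridOrl τ L α h j z with hNdef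
  rcases eq_or_ne N 0 with hN0 | hN0
  · have hz := ae_eq_zero_of_orl hα (hcz j z) (hct j z) hm.restrict hN0
    have he : {x | gridIdx τ L j x = z ∧
      ∃ k, j < k ∧ 2 * K * N < gridOrl τ L α h k (gridIdx τ L k x)} = ∅ := by
      refine eq_empty_of_forall_notMem ?_
      rintro x ⟨hx, k, hk, hlt⟩
      have hsub : gridIdx τ L k ⁻¹' {gridIdx τ L k x} ⊆ gridIdx τ L j ⁻¹' {z} := fun y hy => by
        rw [← hx]; exact hN.eq_of_le hk.le hy
      have : gridOrl τ L α h k (gridIdx τ L k x) = 0 :=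
        orl_eq_zero_of_ae (ae_restrict_of_ae_restrict_of_subset hsub hz)
      rw [this] at hlt
      exact not_lt_zero hlt
    rw [he]; simp
  rcases eq_or_ne N ∞ with hNt | hNt
  · have he : {x | gridIdx τ L j x = z ∧
      ∃ k, j < k ∧ 2 * K * N < gridOrl τ L α h k (gridIdx τ L k x)} = ∅ := by
      refine eq_empty_of_forall_notMem ?_
      rintro x ⟨hx, k, hk, hlt⟩
      rw [hNt, ENNReal.mul_top (mul_ne_zero two_ne_zero hK0)] at hlt
      exact not_top_lt hlt
    rw [he]; simp
  -- Twice the norm is a level strictly above it, which gives the modular bound; this is the 2 in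
  -- the threshold `2 * K`.
  set r := 2 * N with hr
  have hr0 : r ≠ 0 := mul_ne_zero two_ne_zero hN0
  have hrt : r ≠ ∞ := ENNReal.mul_ne_top ENNReal.ofNat_ne_top hNt
  have hNr : N < r := by
    rw [hr, two_mul]
    exact ENNReal.lt_add_right hNt hN0
  calc _ ≤ volume {x | gridIdx τ L j x = z ∧ ∃ k, j ≤ k ∧
      volume (gridIdx τ L k ⁻¹' {gridIdx τ L k x}) <
        ∫⁻ y in gridIdx τ L k ⁻¹' {gridIdx τ L k x}, youngLlog α (h y / (K * r))} := by
        refine measure_mono ?_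
        rintro x ⟨hx, k, hk, hlt⟩
        refine ⟨hx, k, hk.le, ?_⟩
        by_contra hcon
        rw [not_lt] at hcon
        refine absurd hlt (not_lt.2 ?_)
        rw [show 2 * K * N = K * r by rw [hr]; ring]
        refine orl_le (pos_iff_ne_zero.2 (mul_ne_zero hK0 hr0)) ?_
        rwa [Measure.restrict_apply_univ]
    _ ≤ ∫⁻ y in gridIdx τ L j ⁻¹' {z}, youngLlog α (h y / (K * r)) := hN.weak_type _ _ j z
    _ ≤ ∫⁻ y in gridIdx τ L j ⁻¹' {z}, K⁻¹ * youngLlog α (h y / r) := by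
        refine lintegral_mono fun y => ?_
        have : h y / (K * r) = K⁻¹ * (h y / r) := by
          rw [div_eq_mul_inv, div_eq_mul_inv, ENNReal.mul_inv (Or.inl hK0) (Or.inl hK')]; ring
        simp only [this]
        exact youngLlog_mul_le hα (ENNReal.inv_le_one.2 hK) (ENNReal.inv_ne_zero.2 hK')
    _ = K⁻¹ * ∫⁻ y in gridIdx τ L j ⁻¹' {z}, youngLlog α (h y / r) :=
        lintegral_const_mul' _ _ (ENNReal.inv_ne_top.2 hK0)
    _ ≤ _ := by
        gcongr
        have := lintegral_young_le_of_orl_lt hα hNr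
        rwa [Measure.restrict_apply_univ] at this

end Grid

/-! ### The John–Nirenberg inequality -/

/-- The factor `n + 1` dominates the `√n` of the diameter and keeps the radius positive even for `n
= 0`. -/
theorem integrableOn_gridCell {n : ℕ} {b : E n → ℝ} (hb : LocallyIntegrable b volume) (τ : E n)
    {L : ℝ} (hL : 0 < L) (k : ℕ) (x : E n) :
    gridIdx τ L k ⁻¹' {gridIdx τ L k x} ⊆ Metric.closedBall x ((n + 1) * (L / 2 ^ k)) ∧
      IntegrableOn b (gridIdx τ L k ⁻¹' {gridIdx τ L k x}) volume := by
  have hs : 0 < L / 2 ^ k := by positivity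
  have hsub : gridIdx τ L k ⁻¹' {gridIdx τ L k x} ⊆ Metric.closedBall x ((n + 1) * (L / 2 ^ k)) := by
    have hx : x ∈ gridIdx τ L k ⁻¹' {gridIdx τ L k x} := rfl
    intro y hy
    rw [gridCell_eq τ hL] at hx hy
    rw [Metric.mem_closedBall, EuclideanSpace.dist_eq]
    refine Real.sqrt_le_iff.2 ⟨by positivity, ?_⟩
    calc ∑ i, dist (y i) (x i) ^ 2 ≤ ∑ _i : Fin n, (L / 2 ^ k) ^ 2 := by
          refine Finset.sum_le_sum fun i _ => ?_
          have h1 := hx i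
          have h2 := hy i
          simp only [Set.mem_Ico] at h1 h2
          have : dist (y i) (x i) ≤ L / 2 ^ k := by
            rw [Real.dist_eq, abs_le]; constructor <;> linarith
          gcongr
      _ = n * (L / 2 ^ k) ^ 2 := by simp
      _ ≤ ((n + 1) * (L / 2 ^ k)) ^ 2 := by
          rw [mul_pow]
          gcongr
          nlinarith [(Nat.cast_nonneg n : (0 : ℝ) ≤ n)]
  exact ⟨hsub, (hb.integrableOn_isCompact (isCompact_closedBall _ _)).mono_set hsub⟩

/-- Lebesgue's differentiation theorem along the cells of a dyadic grid. -/
theorem ae_tendsto_gridAverage {n : ℕ} {b : E n → ℝ} (hb : LocallyIntegrable b volume) (τ : E n)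
    {L : ℝ} (hL : 0 < L) :
    ∀ᵐ x, Filter.Tendsto (fun k => ⨍ y in gridIdx τ L k ⁻¹' {gridIdx τ L k x}, b y) Filter.atTop
      (nhds (b x)) := by
  -- The balls used below are centred at `x` itself, so the admissible displacement of the centres
  -- may be `0`. A cell fills a fixed proportion of its ball, and the averages over the balls
  -- control those over the cells.
  filter_upwards [IsUnifLocDoublingMeasure.ae_tendsto_average_norm_sub volume hb 0] with x hx
  have hδ : Filter.Tendsto (fun k : ℕ => (n + 1) * (L / 2 ^ k)) Filter.atTop
      (nhdsWithin 0 (Set.Ioi 0)) := by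
    refine tendsto_nhdsWithin_iff.2 ⟨?_, Filter.Eventually.of_forall fun k => ?_⟩
    · have h1 : Filter.Tendsto (fun k : ℕ => ((n + 1) * L) * ((1 / 2 : ℝ)) ^ k) Filter.atTop
          (nhds (((n + 1) * L) * 0)) :=
        (tendsto_pow_atTop_nhds_zero_of_lt_one (by norm_num) (by norm_num)).const_mul _
      rw [mul_zero] at h1
      refine h1.congr fun k => ?_
      rw [one_div, inv_pow]; ring
    · show (0 : ℝ) < (n + 1) * (L / 2 ^ k)
      positivity
  have h0 := hx (fun _ => x) _ hδ (Filter.Eventually.of_forall fun k => by simp)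
  set V : ℝ := volume.real (Metric.closedBall (0 : E n) 1)
  have h1 := h0.const_mul ((n + 1) ^ n * V)
  rw [mul_zero] at h1
  rw [tendsto_iff_norm_sub_tendsto_zero]
  refine squeeze_zero (fun k => norm_nonneg _) (fun k => ?_) h1
  have hs : 0 < L / 2 ^ k := by positivity
  obtain ⟨hsub, hint⟩ := integrableOn_gridCell hb τ hL k x
  set Q := gridIdx τ L k ⁻¹' {gridIdx τ L k x}
  set D := Metric.closedBall x ((n + 1) * (L / 2 ^ k))
  have hQ0 : volume Q ≠ 0 := volume_gridCell_ne_zero τ hL _ _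
  have hQt : volume Q ≠ ∞ := volume_gridCell_ne_top τ hL _ _
  have hQr : volume.real Q = (L / 2 ^ k) ^ n := by
    rw [Measure.real, volume_gridCell τ hL, ENNReal.toReal_ofReal (by positivity)]
  have hDr : volume.real D = ((n + 1) * (L / 2 ^ k)) ^ n * V := by
    rw [Measure.real, Measure.addHaar_closedBall' _ _ (by positivity), ENNReal.toReal_mul,
      ENNReal.toReal_ofReal (by positivity), finrank_euclideanSpace_fin]
    rfl
  have hV : 0 < V := ENNReal.toReal_pos (Metric.measure_closedBall_pos _ _ one_pos).ne'
    measure_closedBall_lt_top.ne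
  have hintD : IntegrableOn (fun y => ‖b y - b x‖) D volume :=
    ((hb.integrableOn_isCompact (isCompact_closedBall _ _)).sub
      (integrableOn_const measure_closedBall_lt_top.ne)).norm
  have hc : (⨍ y in Q, b y) - b x = ⨍ y in Q, (b y - b x) := by
    rw [setAverage_eq, setAverage_eq, integral_sub hint (integrableOn_const hQt), setIntegral_const,
      smul_sub, smul_smul, inv_mul_cancel₀, one_smul]
    rw [hQr]; positivity
  calc ‖(⨍ y in Q, b y) - b x‖ = ‖⨍ y in Q, (b y - b x)‖ := by rw [hc]
    _ ≤ (volume.real Q)⁻¹ * ∫ y in Q, ‖b y - b x‖ := by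
      rw [setAverage_eq, norm_smul, Real.norm_of_nonneg (by positivity)]
      gcongr
      exact norm_integral_le_integral_norm _
    _ ≤ (volume.real Q)⁻¹ * ∫ y in D, ‖b y - b x‖ := by
      exact mul_le_mul_of_nonneg_left (setIntegral_mono_set hintD
        (Filter.Eventually.of_forall fun y => norm_nonneg _) hsub.eventuallyLE) (by positivity)
    _ = _ := by
      rw [setAverage_eq, hQr, hDr, smul_eq_mul, mul_pow]
      field_simp

theorem mul_enorm_setAverage_sub_le {Ω : Type*} [MeasurableSpace Ω] {μ : Measure Ω} {Q : Set Ω}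
    (h0 : μ Q ≠ 0) (ht : μ Q ≠ ∞) {b : Ω → ℝ} (hb : IntegrableOn b Q μ) (c : ℝ) :
    μ Q * ‖(⨍ y in Q, b y ∂μ) - c‖ₑ ≤ ∫⁻ y in Q, ‖b y - c‖ₑ ∂μ := by
  have hr : μ.real Q ≠ 0 := (ENNReal.toReal_pos h0 ht).ne'
  have hc : ∫ y in Q, (b y - c) ∂μ = μ.real Q * ((⨍ y in Q, b y ∂μ) - c) := by
    rw [setAverage_eq, integral_sub hb (integrableOn_const ht), setIntegral_const, smul_eq_mul,
      smul_eq_mul, mul_sub, mul_inv_cancel_left₀ hr]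
  have : μ Q * ‖(⨍ y in Q, b y ∂μ) - c‖ₑ = ‖∫ y in Q, (b y - c) ∂μ‖ₑ := by
    rw [hc, enorm_mul]
    congr 1
    rw [Measure.real, Real.enorm_of_nonneg ENNReal.toReal_nonneg, ENNReal.ofReal_toReal ht]
  rw [this]
  exact enorm_integral_le_lintegral_enorm _

/-- The elementary inequality behind the duality of `exp L` and `L log L`. -/
theorem one_add_rpow_mul_le {σ : ℝ} (h0 : 0 ≤ σ) (h1 : σ ≤ 1) (i : ℕ) (t : ℝ≥0∞) :
    (1 + (i : ℝ≥0∞)) ^ σ * t ≤ 2 * youngLlog σ t + 4 ^ i := by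
  -- Below the threshold, `1 + i ≤ 2 ^ i` and `t ≤ 2 ^ i` give `4 ^ i`. Above it, `log t > i log 2 >
  -- i / 2`, so that `1 + i ≤ 2 (1 + log⁺ t)`.
  rcases le_or_gt t (2 ^ i) with ht | ht
  · refine le_trans ?_ le_add_self
    have hi : (1 + (i : ℝ≥0∞)) ≤ 2 ^ i := by
      have : 1 + i ≤ 2 ^ i := by rw [add_comm]; exact Nat.lt_two_pow_self
      exact_mod_cast this
    calc (1 + (i : ℝ≥0∞)) ^ σ * t ≤ (1 + (i : ℝ≥0∞)) ^ (1 : ℝ) * 2 ^ i := by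
          gcongr
          exact le_self_add
      _ ≤ 2 ^ i * 2 ^ i := by rw [ENNReal.rpow_one]; gcongr
      _ = 4 ^ i := by rw [← mul_pow]; norm_num
  · refine le_trans ?_ le_self_add
    rcases eq_or_ne t ∞ with rfl | htt
    · simp [youngLlog]
    have hreal : (2 : ℝ) ^ i < t.toReal := by
      have := (ENNReal.toReal_lt_toReal (by simp) htt).2 ht
      simpa using this
    have hlog : (i : ℝ) * Real.log 2 < Real.log t.toReal := by
      rw [← Real.log_pow]
      exact Real.log_lt_log (by positivity) hreal
    have hl2 := Real.log_two_gt_d9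
    have hpl : Real.log t.toReal ≤ Real.posLog t.toReal := le_max_right _ _
    have hi0 : (0 : ℝ) ≤ i := Nat.cast_nonneg i
    have hmain : 1 + (i : ℝ) ≤ 2 * (1 + Real.posLog t.toReal) := by nlinarith
    have hE : 1 + (i : ℝ≥0∞) ≤ 2 * (1 + ENNReal.ofReal (Real.posLog t.toReal)) := by
      have := ENNReal.ofReal_le_ofReal hmain
      rw [ENNReal.ofReal_add zero_le_one hi0, ENNReal.ofReal_mul zero_le_two,
        ENNReal.ofReal_add zero_le_one Real.posLog_nonneg] at this
      simpa using this
    calc (1 + (i : ℝ≥0∞)) ^ σ * t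
        ≤ (2 * (1 + ENNReal.ofReal (Real.posLog t.toReal))) ^ σ * t := by gcongr
      _ = 2 ^ σ * youngLlog σ t := by
          rw [ENNReal.mul_rpow_of_nonneg _ _ h0, youngLlog]; ring
      _ ≤ 2 ^ (1 : ℝ) * youngLlog σ t := by
          gcongr
          exact one_le_two
      _ = _ := by rw [ENNReal.rpow_one]

/-- The bound `B` for the mean oscillations of `b` over cubes. -/
def OscLE {n : ℕ} (b : E n → ℝ) (B : ℝ≥0∞) : Prop :=
  ∀ (a : E n) (l : ℝ), 0 < l →
    ∫⁻ x in cube a l, ‖b x - ⨍ y in cube a l, b y‖ₑ ≤ B * volume (cube a l)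

theorem oscLE_of_bmoNorm_le {n : ℕ} {b : E n → ℝ} {B : ℝ≥0∞} (h : bmoNorm b ≤ B) : OscLE b B := by
  intro a l hl
  have h1 : (volume (cube a l))⁻¹ * ∫⁻ x in cube a l, ‖b x - ⨍ y in cube a l, b y‖ₑ ≤ B := by
    refine le_trans ?_ h
    exact le_iSup_of_le a (le_iSup_of_le l (le_iSup_of_le hl le_rfl))
  rw [mul_comm]
  exact (ENNReal.inv_mul_le_iff (volume_cube_ne_zero a hl) (volume_cube_ne_top a hl)).1 h1

section JohnNirenberg

variable {n : ℕ} {b : E n → ℝ} {B : ℝ≥0∞}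

/-- A cell is bad for a larger one if the average over it of the distance of `b` to its mean over
the larger one is more than `8 B`. -/
def oscBad (b : E n → ℝ) (B : ℝ≥0∞) (τ : E n) (L : ℝ) (k : ℕ) (z : Fin n → ℤ) (k' : ℕ)
    (z' : Fin n → ℤ) : Prop :=
  8 * B * volume (gridIdx τ L k' ⁻¹' {z'}) <
    ∫⁻ x in gridIdx τ L k' ⁻¹' {z'}, ‖b x - ⨍ y in gridIdx τ L k ⁻¹' {z}, b y‖ₑ

theorem OscLE.gridCell (hB : OscLE b B) (τ : E n) {L : ℝ} (hL : 0 < L) (k : ℕ) (z : Fin n → ℤ) :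
    ∫⁻ x in gridIdx τ L k ⁻¹' {z}, ‖b x - ⨍ y in gridIdx τ L k ⁻¹' {z}, b y‖ₑ ≤
      B * volume (gridIdx τ L k ⁻¹' {z}) := by
  have h := hB (gridCorner τ L k z) (L / 2 ^ k) (by positivity)
  rw [restrict_gridCell τ hL] at h
  rw [volume_gridCell τ hL]
  rwa [volume_cube _ (by positivity)] at h

theorem not_oscBad_self (hB : OscLE b B) (τ : E n) {L : ℝ} (hL : 0 < L) (k : ℕ) (z : Fin n → ℤ) :
    ¬ oscBad b B τ L k z k z := by
  rw [oscBad, not_lt]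
  refine (hB.gridCell τ hL k z).trans ?_
  gcongr
  exact le_mul_of_one_le_left zero_le (by norm_num)

/-- The mean oscillation over the large cell is at most `B`, so by the weak type inequality it
exceeds `8 B` on subcells filling at most an eighth. -/
theorem measure_oscBad_le (hB : OscLE b B) (hB0 : B ≠ 0) (hBt : B ≠ ∞) (τ : E n) {L : ℝ}
    (hL : 0 < L) (k : ℕ) (z : Fin n → ℤ) :
    volume (badSet (gridIdx τ L) (oscBad b B τ L) k z) ≤
      8⁻¹ * volume (gridIdx τ L k ⁻¹' {z}) := by
  have h8 : 8 * B ≠ 0 := mul_ne_zero (by norm_num) hB0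
  have h8t : 8 * B ≠ ∞ := ENNReal.mul_ne_top (by norm_num) hBt
  have hi : (8 * B)⁻¹ ≠ ∞ := ENNReal.inv_ne_top.2 h8
  set c := ⨍ y in gridIdx τ L k ⁻¹' {z}, b y
  calc _ ≤ volume {x | gridIdx τ L k x = z ∧ ∃ i, k ≤ i ∧
        volume (gridIdx τ L i ⁻¹' {gridIdx τ L i x}) <
          ∫⁻ y in gridIdx τ L i ⁻¹' {gridIdx τ L i x}, (8 * B)⁻¹ * ‖b y - c‖ₑ} := by
        refine measure_mono ?_
        rintro x ⟨hx, i, hi', hlt⟩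
        refine ⟨hx, i, hi'.le, ?_⟩
        rw [oscBad, mul_comm] at hlt
        rw [lintegral_const_mul' _ _ hi, mul_comm, ← div_eq_mul_inv]
        exact (ENNReal.lt_div_iff_mul_lt (Or.inl h8) (Or.inl h8t)).2 hlt
    _ ≤ ∫⁻ y in gridIdx τ L k ⁻¹' {z}, (8 * B)⁻¹ * ‖b y - c‖ₑ := (nested_gridIdx τ L).weak_type _ _ k z
    _ = (8 * B)⁻¹ * ∫⁻ y in gridIdx τ L k ⁻¹' {z}, ‖b y - c‖ₑ := lintegral_const_mul' _ _ hi
    _ ≤ (8 * B)⁻¹ * (B * volume (gridIdx τ L k ⁻¹' {z})) := by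
        gcongr
        exact hB.gridCell τ hL k z
    _ = _ := by
        rw [ENNReal.mul_inv (Or.inr hBt) (Or.inr hB0), mul_assoc, ← mul_assoc B⁻¹,
          ENNReal.inv_mul_cancel hB0 hBt, one_mul]

/-- The distance between the means over a cell and over the cell of level `0` is controlled by the
number of selected cells. -/
theorem enorm_gridAverage_sub_le (hb : LocallyIntegrable b volume) (hB : OscLE b B)
    (τ : E n) {L : ℝ} (hL : 0 < L) (k : ℕ) (x : E n) :
    ‖(⨍ y in gridIdx τ L k ⁻¹' {gridIdx τ L k x}, b y) -
        ⨍ y in gridIdx τ L 0 ⁻¹' {gridIdx τ L 0 x}, b y‖ₑ ≤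
      8 * 2 ^ n * B * (1 + selCount (gridIdx τ L) (oscBad b B τ L) k x) := by
  set idx := gridIdx τ L
  set bad := oscBad b B τ L
  let m : ℕ → ℝ := fun k => ⨍ y in idx k ⁻¹' {idx k x}, b y
  have hself := not_oscBad_self hB τ hL
  have hnb : ∀ k, ∫⁻ y in idx k ⁻¹' {idx k x}, ‖b y - m (stopLevel idx bad k x)‖ₑ ≤
      8 * B * volume (idx k ⁻¹' {idx k x}) := fun k =>
    not_lt.1 (not_bad_stopLevel (idx := idx) (bad := bad) hself k x)
  have hcancel : ∀ k (s C : ℝ≥0∞), volume (idx k ⁻¹' {idx k x}) * s ≤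
      C * volume (idx k ⁻¹' {idx k x}) → s ≤ C := by
    intro k s C h
    rw [mul_comm C] at h
    exact (ENNReal.mul_le_mul_iff_right (volume_gridCell_ne_zero τ hL _ _)
      (volume_gridCell_ne_top τ hL _ _)).1 h
  have hjump : ∀ k, ‖m k - m (stopLevel idx bad k x)‖ₑ ≤ 8 * B := fun k =>
    hcancel k _ _ ((mul_enorm_setAverage_sub_le (volume_gridCell_ne_zero τ hL _ _)
      (volume_gridCell_ne_top τ hL _ _) (integrableOn_gridCell hb τ hL k x).2 _).trans (hnb k))
  -- The parent of a newly selected cell is not bad for the previous one, so its average is at most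
  -- `8 B`; passing to the child costs the ratio `2 ^ n` of the volumes.
  have hstep : ∀ k, ‖m (k + 1) - m (stopLevel idx bad k x)‖ₑ ≤ 8 * 2 ^ n * B := by
    intro k
    refine hcancel (k + 1) _ _ ((mul_enorm_setAverage_sub_le (volume_gridCell_ne_zero τ hL _ _)
      (volume_gridCell_ne_top τ hL _ _) (integrableOn_gridCell hb τ hL (k + 1) x).2 _).trans ?_)
    refine le_trans (lintegral_mono_set fun y hy => (nested_gridIdx τ L).succ k y x hy)
      ((hnb k).trans (le_of_eq ?_))
    have hv : volume (idx k ⁻¹' {idx k x}) = 2 ^ n * volume (idx (k + 1) ⁻¹' {idx (k + 1) x}) := by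
      rw [volume_gridCell τ hL, volume_gridCell τ hL]
      rw [show (2 : ℝ≥0∞) ^ n = ENNReal.ofReal (2 ^ n) by
        rw [ENNReal.ofReal_pow zero_le_two, ENNReal.ofReal_ofNat], ← ENNReal.ofReal_mul (by positivity),
        ← mul_pow, pow_succ]
      congr 2
      field_simp
    rw [hv]; ring
  have h82 : (8 : ℝ≥0∞) * B ≤ 8 * 2 ^ n * B := by
    gcongr
    exact le_mul_of_one_le_right zero_le (one_le_pow₀ one_le_two)
  have hsum : ∀ k, ‖m (stopLevel idx bad k x) - m 0‖ₑ ≤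
      8 * 2 ^ n * B * selCount idx bad k x := by
    intro k
    induction k with
    | zero => simp [stopLevel, selCount]
    | succ k ih =>
      by_cases h : stopLevel idx bad (k + 1) x = k + 1
      · have hsel : x ∈ selected idx bad (k + 1) := h
        rw [h, selCount, if_pos hsel]
        calc ‖m (k + 1) - m 0‖ₑ
            = ‖(m (k + 1) - m (stopLevel idx bad k x)) + (m (stopLevel idx bad k x) - m 0)‖ₑ := by
              congr 1; ring
          _ ≤ ‖m (k + 1) - m (stopLevel idx bad k x)‖ₑ + ‖m (stopLevel idx bad k x) - m 0‖ₑ :=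
              enorm_add_le _ _
          _ ≤ 8 * 2 ^ n * B + 8 * 2 ^ n * B * selCount idx bad k x := add_le_add (hstep k) ih
          _ = _ := by push_cast; ring
      · have h' := (stopLevel_succ_or (idx := idx) (bad := bad) k x).resolve_left h
        have hn : x ∉ selected idx bad (k + 1) := h
        rw [h', selCount, if_neg hn, add_zero]
        exact ih
  calc ‖m k - m 0‖ₑ = ‖(m k - m (stopLevel idx bad k x)) + (m (stopLevel idx bad k x) - m 0)‖ₑ := by
        congr 1; ring
    _ ≤ ‖m k - m (stopLevel idx bad k x)‖ₑ + ‖m (stopLevel idx bad k x) - m 0‖ₑ := enorm_add_le _ _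
    _ ≤ 8 * 2 ^ n * B + 8 * 2 ^ n * B * selCount idx bad k x :=
        add_le_add ((hjump k).trans h82) (hsum k)
    _ = _ := by ring

/-- The John–Nirenberg inequality, in the form of the duality between `exp L^{1/σ}` and
`L (log L)^σ`. -/
theorem john_nirenberg_gridCell (hb : LocallyIntegrable b volume) (hB : OscLE b B) (hB0 : B ≠ 0)
    (hBt : B ≠ ∞) {σ : ℝ} (h0 : 0 ≤ σ) (h1 : σ ≤ 1) (τ : E n) {L : ℝ} (hL : 0 < L) (z : Fin n → ℤ)
    (h : E n → ℝ≥0∞) :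
    ∫⁻ x in gridIdx τ L 0 ⁻¹' {z}, (1 + ‖b x - ⨍ y in gridIdx τ L 0 ⁻¹' {z}, b y‖ₑ) ^ σ * h x ≤
      4 * (1 + 8 * 2 ^ n * B) * (volume (gridIdx τ L 0 ⁻¹' {z}) * gridOrl τ L σ h 0 z) := by
  have hN := nested_gridIdx τ L
  set idx := gridIdx τ L with hidx
  set bad := oscBad b B τ L with hbad
  set Q := idx 0 ⁻¹' {z} with hQ
  set M := 8 * 2 ^ n * B with hM
  have hMt : M ≠ ∞ := ENNReal.mul_ne_top (by finiteness) hBt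
  let D : ℕ → Set (E n) := fun i => {x | idx 0 x = z ∧ ∃ k, i ≤ selCount idx bad k x}
  have hD : ∀ i, volume (D i) ≤ 8⁻¹ ^ i * volume Q :=
    hN.measure_selCount_le (measure_oscBad_le hB hB0 hBt τ hL) z
  have hDm : ∀ i, MeasurableSet (D i) := by
    intro i
    have : D i = Q ∩ ⋃ k, {x | i ≤ selCount idx bad k x} := by
      ext x; simp [D, hQ]
    rw [this]
    refine (hN.measurableSet_cell 0 z).inter (.iUnion fun k => ?_)
    exact hN.measurableSet_of_saturated (k := k) fun x y hxy (hx : i ≤ _) =>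
      show i ≤ _ from (hN.selCount_eq hxy) ▸ hx
  -- `W` sums the error terms `4 ^ i` of `one_add_rpow_mul_le`. They are integrable because `D i`
  -- has measure at most `8⁻¹ ^ i` times that of `Q`.
  let W : E n → ℝ≥0∞ := fun x => ∑' i, (D i).indicator (fun _ => 4 ^ i) x
  have hWm : Measurable W := Measurable.tsum fun i => measurable_const.indicator (hDm i)
  have hWint : ∫⁻ x in Q, W x ≤ 2 * volume Q := by
    calc ∫⁻ x in Q, W x = ∑' i, ∫⁻ x in Q, (D i).indicator (fun _ => 4 ^ i) x :=
          lintegral_tsum fun i => (measurable_const.indicator (hDm i)).aemeasurable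
      _ ≤ ∑' i : ℕ, (2⁻¹ : ℝ≥0∞) ^ i * volume Q := by
          refine ENNReal.tsum_le_tsum fun i => ?_
          calc ∫⁻ x in Q, (D i).indicator (fun _ => 4 ^ i) x
              ≤ ∫⁻ x, (D i).indicator (fun _ => 4 ^ i) x := setLIntegral_le_lintegral _ _
            _ = 4 ^ i * volume (D i) := by rw [lintegral_indicator (hDm i), setLIntegral_const]
            _ ≤ 4 ^ i * (8⁻¹ ^ i * volume Q) := by gcongr; exact hD i
            _ = 2⁻¹ ^ i * volume Q := by
              rw [← mul_assoc, ← mul_pow]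
              congr 2
              rw [← div_eq_mul_inv, ENNReal.div_eq_inv_mul]
              rw [show (8 : ℝ≥0∞) = 2 * 4 by norm_num,
                ENNReal.mul_inv (by simp) (by simp), mul_assoc, ENNReal.inv_mul_cancel (by simp) (by simp),
                mul_one]
      _ = 2 * volume Q := by
          rw [ENNReal.tsum_mul_right, ENNReal.tsum_geometric, ENNReal.one_sub_inv_two, inv_inv]
  have hpt : ∀ᵐ x, x ∈ Q → ∀ t : ℝ≥0∞,
      (1 + ‖b x - ⨍ y in Q, b y‖ₑ) ^ σ * t ≤ (1 + M) * (2 * youngLlog σ t + W x) := by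
    filter_upwards [ae_tendsto_gridAverage hb τ hL] with x hx hxQ t
    have hxz : idx 0 x = z := hxQ
    -- Points with unboundedly many selections have `W x = ∞`, and nothing is to prove. At the
    -- others the count is at most some `i`, and Lebesgue differentiation passes the bound from the
    -- means to `b x`.
    by_cases hall : ∀ i, x ∈ D i
    · have : W x = ∞ := by
        refine top_le_iff.1 (le_trans (le_of_eq ?_)
          (ENNReal.tsum_le_tsum (f := fun _ : ℕ => (1 : ℝ≥0∞)) fun i => ?_))
        · exact (ENNReal.tsum_const_eq_top_of_ne_zero one_ne_zero).symm
        · rw [indicator_of_mem (hall i)]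
          exact one_le_pow₀ (by norm_num)
      rw [this, add_top, ENNReal.mul_top (by positivity)]
      exact le_top
    · push Not at hall
      classical
      obtain ⟨i, hi⟩ : ∃ i, x ∈ D i ∧ x ∉ D (i + 1) := by
        have hfind := Nat.find_spec hall
        have hne : Nat.find hall ≠ 0 := by
          intro h00
          rw [h00] at hfind
          exact hfind ⟨hxz, 0, Nat.zero_le _⟩
        obtain ⟨i, hi⟩ := Nat.exists_eq_succ_of_ne_zero hne
        refine ⟨i, not_not.1 (Nat.find_min hall (by omega)), ?_⟩
        rw [hi] at hfind
        exact hfind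
      have hcnt : ∀ k, selCount idx bad k x ≤ i := by
        intro k
        by_contra hcon
        exact hi.2 ⟨hxz, k, by omega⟩
      have hosc : ‖b x - ⨍ y in Q, b y‖ₑ ≤ M * (1 + i) := by
        have hlim := ((hx.sub_const (⨍ y in Q, b y))).enorm
        refine le_of_tendsto hlim (Filter.Eventually.of_forall fun k => ?_)
        have := enorm_gridAverage_sub_le hb hB τ hL k x
        rw [← hidx, hxz, ← hQ] at this
        refine this.trans ?_
        gcongr
        exact hcnt k
      have hWi : 4 ^ i ≤ W x := by
        refine le_trans ?_ (ENNReal.le_tsum i)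
        rw [indicator_of_mem hi.1]
      calc (1 + ‖b x - ⨍ y in Q, b y‖ₑ) ^ σ * t ≤ ((1 + M) * (1 + i)) ^ σ * t := by
            gcongr
            calc 1 + ‖b x - ⨍ y in Q, b y‖ₑ ≤ 1 + M * (1 + i) := by gcongr
              _ ≤ (1 + i) + M * (1 + i) := by gcongr; exact le_self_add
              _ = _ := by ring
        _ = (1 + M) ^ σ * ((1 + (i : ℝ≥0∞)) ^ σ * t) := by
            rw [ENNReal.mul_rpow_of_nonneg _ _ h0, mul_assoc]
        _ ≤ (1 + M) ^ (1 : ℝ) * (2 * youngLlog σ t + 4 ^ i) := by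
            gcongr
            · exact le_self_add
            · exact one_add_rpow_mul_le h0 h1 i t
        _ ≤ _ := by rw [ENNReal.rpow_one]; gcongr
  rw [← mul_assoc]
  refine le_mul_of_forall_lt
    (mul_ne_zero (by positivity) (volume_gridCell_ne_zero τ hL 0 z))
    (ENNReal.mul_ne_top (by finiteness) (volume_gridCell_ne_top τ hL 0 z)) fun r hr hr' => ?_
  have hr0 : r ≠ 0 := (zero_le.trans_lt hr).ne'
  calc ∫⁻ x in Q, (1 + ‖b x - ⨍ y in Q, b y‖ₑ) ^ σ * h x
      ≤ ∫⁻ x in Q, r * ((1 + M) * (2 * youngLlog σ (h x / r) + W x)) := by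
        refine lintegral_mono_ae ?_
        rw [ae_restrict_iff' (hN.measurableSet_cell 0 z)]
        filter_upwards [hpt] with x hx hxQ
        calc (1 + ‖b x - ⨍ y in Q, b y‖ₑ) ^ σ * h x
            = r * ((1 + ‖b x - ⨍ y in Q, b y‖ₑ) ^ σ * (h x / r)) := by
              rw [mul_left_comm, ENNReal.mul_div_cancel hr0 hr'.ne]
          _ ≤ _ := mul_le_mul' le_rfl (hx hxQ _)
    _ = r * ((1 + M) * (2 * (∫⁻ x in Q, youngLlog σ (h x / r)) + ∫⁻ x in Q, W x)) := by
        rw [lintegral_const_mul' _ _ hr'.ne, lintegral_const_mul' _ _ (by finiteness),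
          lintegral_add_right _ hWm, lintegral_const_mul' _ _ (by simp)]
    _ ≤ r * ((1 + M) * (2 * volume Q + 2 * volume Q)) := by
        gcongr
        have := lintegral_young_le_of_orl_lt h0 hr
        rwa [Measure.restrict_apply_univ] at this
    _ = _ := by ring

/-- Any cube is, up to a null set, the cell of level `0` and index `0` in the grid with its corner
as offset and its side as largest side. -/
theorem john_nirenberg (hb : LocallyIntegrable b volume) (hB : OscLE b B) (hB0 : B ≠ 0)
    (hBt : B ≠ ∞) {σ : ℝ} (h0 : 0 ≤ σ) (h1 : σ ≤ 1) (a : E n) {l : ℝ} (hl : 0 < l)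
    (h : E n → ℝ≥0∞) :
    ∫⁻ x in cube a l, (1 + ‖b x - ⨍ y in cube a l, b y‖ₑ) ^ σ * h x ≤
      4 * (1 + 8 * 2 ^ n * B) * (volume (cube a l) * avg (normLlog σ) a l h) := by
  have hc : gridCorner a l 0 0 = a := by
    ext i; simp [gridCorner]
  have h2 := john_nirenberg_gridCell hb hB hB0 hBt h0 h1 a hl 0 h
  have h3 := restrict_gridCell a hl 0 0
  rw [hc, pow_zero, div_one] at h3
  rw [← h3, gridOrl_eq_avg a hl, hc, pow_zero, div_one, volume_gridCell a hl, pow_zero, div_one] at h2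
  rwa [volume_cube a hl.le]

end JohnNirenberg

/-! ### Domination of the potential operator by sums over dyadic cubes -/

theorem lintegral_pi_prod {Ω : Type*} [MeasurableSpace Ω] {m : ℕ} (μ : Fin m → Measure Ω)
    [∀ i, SigmaFinite (μ i)] (f : Fin m → Ω → ℝ≥0∞) (hf : ∀ i, AEMeasurable (f i) (μ i)) :
    ∫⁻ y, ∏ i, f i (y i) ∂Measure.pi μ = ∏ i, ∫⁻ x, f i x ∂μ i := by
  induction m with
  | zero => simp
  | succ m ih =>
    have hmp := measurePreserving_piFinSuccAbove μ 0
    have htail : AEMeasurable (fun z : Fin m → Ω => ∏ j, f j.succ (z j))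
        (Measure.pi fun j => μ (Fin.succAbove 0 j)) := by
      refine Finset.aemeasurable_fun_prod _ fun j _ => ?_
      exact (hf j.succ).comp_quasiMeasurePreserving (Measure.quasiMeasurePreserving_eval _ j)
    have h1 := hmp.lintegral_comp_emb (MeasurableEquiv.measurableEmbedding _)
      (fun p : Ω × (Fin m → Ω) => f 0 p.1 * ∏ j, f j.succ (p.2 j))
    rw [lintegral_prod_mul (hf 0) htail] at h1
    rw [Fin.prod_univ_succ, ← ih (fun j => μ j.succ) (fun j => f j.succ) fun j => hf j.succ]
    rw [show (fun j : Fin m => μ (Fin.succAbove 0 j)) = fun j => μ j.succ from rfl] at h1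
    rw [← h1]
    refine lintegral_congr fun y => ?_
    rw [Fin.prod_univ_succ]
    rfl

theorem setLIntegral_pi_prod {n m : ℕ} (Q : Set (E n)) (f : Fin m → E n → ℝ≥0∞)
    (hf : ∀ i, AEMeasurable (f i) volume) :
    ∫⁻ y in Set.univ.pi fun _ : Fin m => Q, ∏ i, f i (y i) = ∏ i, ∫⁻ x in Q, f i x := by
  rw [volume_pi, Measure.restrict_pi_pi]
  exact lintegral_pi_prod _ f fun i => (hf i).restrict

/-- The integral of the kernel over the annulus of radius `2 ^ k`. -/
def shell {n m : ℕ} (φ : (Fin m → E n) → ℝ) (δ ε : ℝ) (k : ℤ) : ℝ≥0∞ :=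
  ∫⁻ y in annulus n m ((2 : ℝ) ^ k) δ ε, ENNReal.ofReal (φ y)

theorem measurableSet_annulus (n m : ℕ) (t δ ε : ℝ) : MeasurableSet (annulus n m t δ ε) := by
  have hm : Measurable fun y : Fin m → E n => ∑ i, ‖y i‖ := by fun_prop
  exact (measurableSet_lt measurable_const hm).inter (measurableSet_le hm measurable_const)

theorem ConditionD.exists_growth {n m : ℕ} {φ : (Fin m → E n) → ℝ} {δ ε : ℝ}
    (hφ : ConditionD φ δ ε) : ∃ C : ℝ≥0, ∀ k : ℤ, ∀ w ∈ annulus n m ((2 : ℝ) ^ k) 1 0,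
      ENNReal.ofReal (φ w) ≤ C * (ENNReal.ofReal (((2 : ℝ) ^ k) ^ (n * m)))⁻¹ * shell φ δ ε k := by
  obtain ⟨C, hC⟩ := hφ.growth
  -- The given constant may be negative; its positive part still serves, since the integral of `φ`
  -- is nonnegative. The annulus is bounded, so local integrability makes that integral a genuine
  -- one.
  refine ⟨C.toNNReal, fun k w hw => ?_⟩
  have hint : IntegrableOn φ (annulus n m ((2 : ℝ) ^ k) δ ε) volume := by
    refine (hφ.locallyIntegrable.integrableOn_isCompact
      (isCompact_closedBall 0 (|δ * (1 + ε) * (2 * (2 : ℝ) ^ k)|))).mono_set fun y hy => ?_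
    rw [mem_closedBall_zero_iff, pi_norm_le_iff_of_nonneg (abs_nonneg _)]
    intro i
    exact (Finset.single_le_sum (f := fun i => ‖y i‖) (fun _ _ => norm_nonneg _)
      (Finset.mem_univ i)).trans (hy.2.trans (le_abs_self _))
  have hI : ENNReal.ofReal (∫ y in annulus n m ((2 : ℝ) ^ k) δ ε, φ y) = shell φ δ ε k :=
    ofReal_integral_eq_lintegral_ofReal hint (Filter.Eventually.of_forall fun y => hφ.nonneg y)
  have hpow : ((2 : ℝ) ^ k) ^ (n * m) = (2 : ℝ) ^ (k * n * m) := by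
    rw [← zpow_natCast, ← zpow_mul]; push_cast; ring_nf
  have hI0 : 0 ≤ ∫ y in annulus n m ((2 : ℝ) ^ k) δ ε, φ y := integral_nonneg hφ.nonneg
  have h1 : φ w ≤ max C 0 * (((2 : ℝ) ^ k) ^ (n * m))⁻¹ *
      ∫ y in annulus n m ((2 : ℝ) ^ k) δ ε, φ y := by
    refine (hC k w hw).trans ?_
    rw [hpow, div_eq_mul_inv]
    gcongr
    exact le_max_left _ _
  calc ENNReal.ofReal (φ w) ≤ _ := ENNReal.ofReal_le_ofReal h1
    _ = _ := by
      rw [ENNReal.ofReal_mul (by positivity), ENNReal.ofReal_mul (by positivity), hI,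
        ENNReal.ofReal_inv_of_pos (by positivity)]
      congr 2
      rw [ENNReal.ofReal, Real.toNNReal, Real.toNNReal]
      simp

/-- The potential operator with the kernel `φ (1 + λ |bⱼ(x) - bⱼ(yⱼ)|)`, applied to `|fᵢ|`. -/
def majorant {n m : ℕ} (φ : (Fin m → E n) → ℝ) (lam : ℝ≥0∞) (b : E n → ℝ) (j : Fin m)
    (f : Fin m → E n → ℝ≥0∞) (x : E n) (y : Fin m → E n) : ℝ≥0∞ :=
  ENNReal.ofReal (φ fun i => x - y i) * ((1 + lam * ‖b x - b (y j)‖ₑ) * ∏ i, f i (y i))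

/-- The points `y` for which `x - y` lies in the annulus of radius `2 ^ k`. -/
def shellAt {n : ℕ} (m : ℕ) (x : E n) (k : ℤ) : Set (Fin m → E n) :=
  {y | (fun i => x - y i) ∈ annulus n m ((2 : ℝ) ^ k) 1 0}

theorem mem_shellAt {n m : ℕ} {x : E n} {k : ℤ} {y : Fin m → E n} :
    y ∈ shellAt m x k ↔ (2 : ℝ) ^ k < ∑ i, ‖x - y i‖ ∧ ∑ i, ‖x - y i‖ ≤ (2 : ℝ) ^ (k + 1) := by
  rw [zpow_add_one₀ two_ne_zero, mul_comm ((2 : ℝ) ^ k) 2]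
  show (1 * (1 - 0) * (2 : ℝ) ^ k < _ ∧ _ ≤ 1 * (1 + 0) * (2 * (2 : ℝ) ^ k)) ↔ _
  simp only [sub_zero, add_zero, one_mul]

theorem norm_sub_le_of_mem_shellAt {n m : ℕ} {x : E n} {k : ℤ} {y : Fin m → E n}
    (hy : y ∈ shellAt m x k) (i : Fin m) : ‖x - y i‖ ≤ (2 : ℝ) ^ (k + 1) :=
  (Finset.single_le_sum (f := fun i => ‖x - y i‖) (fun _ _ => norm_nonneg _)
    (Finset.mem_univ i)).trans (mem_shellAt.1 hy).2

/-- The dyadic annuli miss only the single point all of whose components are `x`, which is null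
because `n` and `m` are positive. -/
theorem lintegral_eq_tsum_shellAt {n m : ℕ} (hn : 1 ≤ n) (hm : 1 ≤ m) (x : E n)
    (F : (Fin m → E n) → ℝ≥0∞) : ∫⁻ y, F y = ∑' k : ℤ, ∫⁻ y in shellAt m x k, F y := by
  have : Nonempty (Fin m) := ⟨⟨0, hm⟩⟩
  have : Nonempty (Fin n) := ⟨⟨0, hn⟩⟩
  have hmeas : ∀ k, MeasurableSet (shellAt m x k) := fun k => by
    have hms : Measurable fun y : Fin m → E n => (fun i => x - y i) := by fun_prop
    exact hms (measurableSet_annulus n m _ _ _)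
  have hdisj : Pairwise (Function.onFun Disjoint (shellAt m x)) := by
    have key : ∀ a b : ℤ, a < b → Disjoint (shellAt m x a) (shellAt m x b) := by
      intro a b hab
      refine Set.disjoint_left.2 fun y hy hy' => ?_
      have h1 := (mem_shellAt.1 hy).2
      have h2 := (mem_shellAt.1 hy').1
      have h3 : (2 : ℝ) ^ (a + 1) ≤ 2 ^ b := zpow_le_zpow_right₀ one_le_two hab
      linarith
    intro a b hab
    rcases lt_or_gt_of_ne hab with h | h
    · exact key a b h
    · exact (key b a h).symm
  have hU : (⋃ k, shellAt m x k) = {fun _ => x}ᶜ := by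
    ext y
    simp only [mem_iUnion, mem_compl_iff, mem_singleton_iff]
    constructor
    · rintro ⟨k, hk⟩ rfl
      have h1 := (mem_shellAt.1 hk).1
      simp only [sub_self, norm_zero, Finset.sum_const_zero] at h1
      exact absurd h1 (not_lt.2 (by positivity))
    · intro hy
      have hpos : 0 < ∑ i, ‖x - y i‖ := by
        refine lt_of_le_of_ne (Finset.sum_nonneg fun i _ => norm_nonneg _) fun h0 => hy ?_
        ext1 i
        have := (Finset.sum_eq_zero_iff_of_nonneg fun i _ => norm_nonneg (x - y i)).1 h0.symm i
          (Finset.mem_univ i)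
        rw [norm_eq_zero, sub_eq_zero] at this
        exact this.symm
      obtain ⟨k, hk1, hk2⟩ := exists_mem_Ioc_zpow hpos one_lt_two
      exact ⟨k, mem_shellAt.2 ⟨hk1, hk2⟩⟩
  rw [← lintegral_iUnion hmeas hdisj, hU]
  have hnull : volume ({fun _ => x} : Set (Fin m → E n)) = 0 := by
    have : Nontrivial (E n) := inferInstanceAs (Nontrivial (WithLp 2 (Fin n → ℝ)))
    rw [volume_pi, Measure.pi_singleton]
    exact Finset.prod_eq_zero (Finset.mem_univ (⟨0, hm⟩ : Fin m)) (measure_singleton x)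
  have : ({fun _ => x}ᶜ : Set (Fin m → E n)) =ᵐ[volume] univ := by
    rw [ae_eq_univ, compl_compl]; exact hnull
  rw [setLIntegral_congr this, setLIntegral_univ]

/-- The bound for the part of the potential operator that comes from one annulus. -/
theorem setLIntegral_shellAt_le {n m : ℕ} {φ : (Fin m → E n) → ℝ} {δ ε : ℝ} {C : ℝ≥0}
    (hC : ∀ k : ℤ, ∀ w ∈ annulus n m ((2 : ℝ) ^ k) 1 0,
      ENNReal.ofReal (φ w) ≤ C * (ENNReal.ofReal (((2 : ℝ) ^ k) ^ (n * m)))⁻¹ * shell φ δ ε k)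
    {b : E n → ℝ} (hb : LocallyIntegrable b volume) {B : ℝ≥0∞} (hB : OscLE b B) (hB0 : B ≠ 0)
    (hBt : B ≠ ∞) {lam : ℝ≥0∞} (j : Fin m)
    {f : Fin m → E n → ℝ≥0∞} (hf : ∀ i, AEMeasurable (f i) volume) (x : E n) (k : ℤ)
    {a : E n} {l : ℝ} (hl : l = 16 * (2 : ℝ) ^ k)
    (hsub : shellAt m x k ⊆ Set.univ.pi fun _ => cube a l) :
    ∫⁻ y in shellAt m x k, majorant φ lam b j f x y ≤
      C * 16 ^ (n * m) * (shell φ δ ε k * (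
        (1 + lam * ‖b x - ⨍ y in cube a l, b y‖ₑ) * ∏ i, avg (normLlog 0) a l (f i) +
        lam * (4 * (1 + 8 * 2 ^ n * B)) *
          ∏ i, avg (normLlog (if i = j then 1 else 0)) a l (f i))) := by
  have hl0 : 0 < l := by rw [hl]; positivity
  set c := ⨍ y in cube a l, b y with hc
  set CB := 4 * (1 + 8 * 2 ^ n * B) with hCB
  set V := volume (cube a l) with hV
  set K := (C : ℝ≥0∞) * (ENNReal.ofReal (((2 : ℝ) ^ k) ^ (n * m)))⁻¹ * shell φ δ ε k with hK
  have hV0 : V ≠ 0 := volume_cube_ne_zero a hl0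
  have hVt : V ≠ ∞ := volume_cube_ne_top a hl0
  have hmeasS : MeasurableSet (shellAt m x k) := by
    have hms : Measurable fun y : Fin m → E n => (fun i => x - y i) := by fun_prop
    exact hms (measurableSet_annulus n m _ _ _)
  -- The oscillation at `yⱼ` is moved into the `j`-th function. The integrand is then a sum of two
  -- products that factor over the variables, and John–Nirenberg is applied to the `j`-th factor.
  let g : Fin m → E n → ℝ≥0∞ := fun i y => if i = j then ‖b y - c‖ₑ * f i y else f i y
  have hg : ∀ i, AEMeasurable (g i) volume := by
    intro i
    by_cases hi : i = j
    · simp only [g, hi, if_true]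
      exact ((hb.aestronglyMeasurable.sub aestronglyMeasurable_const).enorm).mul (hf j)
    · simp only [g, hi, if_false]
      exact hf i
  have hprodg : ∀ y : Fin m → E n, ∏ i, g i (y i) = ‖b (y j) - c‖ₑ * ∏ i, f i (y i) := by
    intro y
    have : ∀ i, g i (y i) = (if i = j then ‖b (y j) - c‖ₑ else 1) * f i (y i) := by
      intro i
      by_cases hi : i = j
      · subst hi; simp [g]
      · simp [g, hi]
    simp_rw [this, Finset.prod_mul_distrib]
    simp
  have hprodm : AEMeasurable (fun y : Fin m → E n => ∏ i, f i (y i)) volume := by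
    refine Finset.aemeasurable_fun_prod _ fun i _ => ?_
    exact (hf i).comp_quasiMeasurePreserving (Measure.quasiMeasurePreserving_eval _ i)
  have hfi : ∀ i, ∫⁻ y in cube a l, f i y ≤ V * avg (normLlog 0) a l (f i) := by
    intro i
    rw [avg_normLlog _ _ hl0]
    have := lintegral_le_orl (h := f i) (α := 0) (μ := volume.restrict (cube a l)) le_rfl
      (by rwa [Measure.restrict_apply_univ]) (by rwa [Measure.restrict_apply_univ])
    rwa [Measure.restrict_apply_univ] at this
  have hgi : ∀ i, ∫⁻ y in cube a l, g i y ≤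
      (if i = j then CB else 1) * (V * avg (normLlog (if i = j then 1 else 0)) a l (f i)) := by
    intro i
    by_cases hi : i = j
    · simp only [g, hi, if_true]
      refine le_trans (lintegral_mono fun y => ?_)
        (john_nirenberg hb hB hB0 hBt zero_le_one le_rfl a hl0 (f j))
      rw [ENNReal.rpow_one]
      gcongr
      exact le_add_self
    · simp only [g, hi, if_false, one_mul]
      exact hfi i
  calc ∫⁻ y in shellAt m x k, majorant φ lam b j f x y
      ≤ ∫⁻ y in shellAt m x k, K * ((1 + lam * ‖b x - c‖ₑ) * ∏ i, f i (y i) +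
          lam * ∏ i, g i (y i)) := by
        refine setLIntegral_mono' hmeasS fun y hy => ?_
        rw [majorant, hprodg, ← mul_assoc lam, ← add_mul]
        refine mul_le_mul' (hC k _ hy) (mul_le_mul' ?_ le_rfl)
        · have h1 : ‖b x - b (y j)‖ₑ ≤ ‖b x - c‖ₑ + ‖b (y j) - c‖ₑ := by
            have : b x - b (y j) = (b x - c) - (b (y j) - c) := by ring
            rw [this]
            exact enorm_sub_le
          calc 1 + lam * ‖b x - b (y j)‖ₑ ≤ 1 + lam * (‖b x - c‖ₑ + ‖b (y j) - c‖ₑ) := by gcongr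
            _ = _ := by rw [mul_add, add_assoc]
    _ ≤ ∫⁻ y in Set.univ.pi fun _ : Fin m => cube a l, K * ((1 + lam * ‖b x - c‖ₑ) *
          ∏ i, f i (y i) + lam * ∏ i, g i (y i)) := lintegral_mono_set hsub
    _ ≤ K * ((1 + lam * ‖b x - c‖ₑ) * (∏ i, ∫⁻ y in cube a l, f i y) +
          lam * ∏ i, ∫⁻ y in cube a l, g i y) := by
        have hm1 : AEMeasurable (fun y : Fin m → E n => (1 + lam * ‖b x - c‖ₑ) * ∏ i, f i (y i))
            (volume.restrict (Set.univ.pi fun _ : Fin m => cube a l)) :=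
          (hprodm.const_mul _).restrict
        have hm2 : AEMeasurable (fun y : Fin m → E n => ∏ i, g i (y i))
            (volume.restrict (Set.univ.pi fun _ : Fin m => cube a l)) := by
          refine AEMeasurable.restrict (Finset.aemeasurable_fun_prod _ fun i _ => ?_)
          exact (hg i).comp_quasiMeasurePreserving (Measure.quasiMeasurePreserving_eval _ i)
        have hm3 : AEMeasurable (fun y : Fin m → E n => (1 + lam * ‖b x - c‖ₑ) * ∏ i, f i (y i) +
            lam * ∏ i, g i (y i)) (volume.restrict (Set.univ.pi fun _ : Fin m => cube a l)) :=
          hm1.add (hm2.const_mul _)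
        rw [lintegral_const_mul'' _ hm3, lintegral_add_left' hm1,
          lintegral_const_mul'' _ hprodm.restrict, lintegral_const_mul'' _ hm2,
          setLIntegral_pi_prod _ f hf, setLIntegral_pi_prod _ g hg]
    _ ≤ K * ((1 + lam * ‖b x - c‖ₑ) * (∏ i, V * avg (normLlog 0) a l (f i)) +
          lam * ∏ i, (if i = j then CB else 1) *
            (V * avg (normLlog (if i = j then 1 else 0)) a l (f i))) := by
        gcongr with i _ i _
        · exact hfi i
        · exact hgi i
    _ = K * V ^ m * ((1 + lam * ‖b x - c‖ₑ) * ∏ i, avg (normLlog 0) a l (f i) +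
        lam * CB * ∏ i, avg (normLlog (if i = j then 1 else 0)) a l (f i)) := by
        simp only [Finset.prod_mul_distrib, Finset.prod_const, Finset.card_univ, Fintype.card_fin,
          Finset.prod_ite_eq', Finset.mem_univ, if_true]
        ring
    _ = _ := by
        -- The volume of the `m`-fold product cube cancels the normalization in the growth
        -- condition, up to `16 ^ (n * m)`.
        have hVm : V ^ m = 16 ^ (n * m) * ENNReal.ofReal (((2 : ℝ) ^ k) ^ (n * m)) := by
          rw [hV, volume_cube a hl0.le, ← ENNReal.ofReal_pow (by positivity), ← pow_mul, hl, mul_pow,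
            ENNReal.ofReal_mul (by positivity), ENNReal.ofReal_pow (by norm_num),
            ENNReal.ofReal_ofNat]
        have hKV : K * V ^ m = C * 16 ^ (n * m) * shell φ δ ε k := by
          rw [hK, hVm]
          set R := ENNReal.ofReal (((2 : ℝ) ^ k) ^ (n * m)) with hR
          have hR0 : R ≠ 0 := by rw [hR]; positivity
          calc (C : ℝ≥0∞) * R⁻¹ * shell φ δ ε k * (16 ^ (n * m) * R)
              = C * 16 ^ (n * m) * shell φ δ ε k * (R⁻¹ * R) := by ring
            _ = _ := by rw [ENNReal.inv_mul_cancel hR0 ENNReal.ofReal_ne_top, mul_one]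
        rw [hKV]; ring

/-- The one-third trick: for a pair of grids, one of which is shifted by a third of the largest
side, short intervals lie in a cell of one of them. -/
theorem floor_const_or_shift {s : ℝ} (hs : 0 < s) (i : ℕ) (x : ℝ) :
    (∀ y, |y - x| ≤ s / 8 → ⌊y / s⌋ = ⌊x / s⌋) ∨
      ∀ y, |y - x| ≤ s / 8 → ⌊(y - 2 ^ i * s / 3) / s⌋ = ⌊(x - 2 ^ i * s / 3) / s⌋ := by
  -- An interval of radius `1/8` around `X` can meet two unit cells only if `X` is within `1/8` of
  -- an integer.
  have key : ∀ X Y : ℝ, |Y - X| ≤ 1 / 8 → ⌊Y⌋ ≠ ⌊X⌋ → ∃ p : ℤ, |X - p| ≤ 1 / 8 := by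
    intro X Y hXY hne
    rw [abs_le] at hXY
    rcases lt_or_gt_of_ne hne with h | h
    · refine ⟨⌊X⌋, abs_le.2 ⟨?_, ?_⟩⟩
      · linarith [Int.floor_le X]
      · have := Int.floor_lt.1 h
        linarith
    · refine ⟨⌊Y⌋, abs_le.2 ⟨?_, ?_⟩⟩
      · linarith [Int.floor_le Y]
      · have := Int.floor_lt.1 h
        linarith
  by_contra hcon
  push Not at hcon
  obtain ⟨⟨y, hy, hne⟩, y', hy', hne'⟩ := hcon
  have hdiv : ∀ u v : ℝ, |u - v| ≤ s / 8 → |u / s - v / s| ≤ 1 / 8 := by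
    intro u v huv
    rw [← sub_div, abs_div, abs_of_pos hs, div_le_iff₀ hs]
    linarith
  obtain ⟨p, hp⟩ := key _ _ (hdiv _ _ hy) hne
  obtain ⟨p', hp'⟩ := key _ _ (hdiv _ _ (by rwa [sub_sub_sub_cancel_right])) hne'
  have hx : (x - 2 ^ i * s / 3) / s = x / s - 2 ^ i / 3 := by field_simp
  rw [hx] at hp'
  rw [abs_le] at hp hp'
  -- If both grids fail, `2 ^ i / 3` is within `1/4` of the integer `p - p'`. Multiplication by 3
  -- gives an integer of modulus at most `3/4`, so 3 would divide a power of 2.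
  have h1 : |((3 * (p - p') - 2 ^ i : ℤ) : ℝ)| < 1 := by
    push_cast
    rw [abs_lt]
    constructor <;> linarith [hp.1, hp.2, hp'.1, hp'.2]
  have h2 : (3 * (p - p') - 2 ^ i : ℤ) = 0 := by
    rw [← Int.abs_lt_one_iff]
    exact_mod_cast h1
  have h3 : (3 : ℤ) ∣ 2 ^ i := ⟨p - p', by linarith⟩
  have h4 := Int.prime_three.dvd_of_dvd_pow h3
  norm_num at h4

/-- The offsets of the grids of the one-third trick. -/
def gridShift {n : ℕ} (L : ℝ) (t : Fin n → Bool) : E n :=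
  WithLp.toLp 2 fun i => if t i then L / 3 else 0

/-- The one-third trick is applied to each coordinate separately, which is why all `2 ^ n` choices
of offsets are needed. -/
theorem exists_gridShift {n : ℕ} {L : ℝ} (hL : 0 < L) (i : ℕ) (x : E n) :
    ∃ t : Fin n → Bool, ∀ y : E n, ‖x - y‖ ≤ L / 2 ^ i / 8 →
      gridIdx (gridShift L t) L i y = gridIdx (gridShift L t) L i x := by
  have hs : 0 < L / 2 ^ i := by positivity
  have hLs : 2 ^ i * (L / 2 ^ i) / 3 = L / 3 := by field_simp
  have : ∀ d : Fin n, ∃ t : Bool, ∀ y : ℝ, |y - x d| ≤ L / 2 ^ i / 8 →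
      ⌊(y - if t then L / 3 else 0) / (L / 2 ^ i)⌋ =
        ⌊(x d - if t then L / 3 else 0) / (L / 2 ^ i)⌋ := by
    intro d
    rcases floor_const_or_shift hs i (x d) with h | h
    · exact ⟨false, by simpa using h⟩
    · rw [hLs] at h
      exact ⟨true, by simpa using h⟩
  choose t ht using this
  refine ⟨t, fun y hy => ?_⟩
  ext d
  refine ht d (y d) (le_trans ?_ hy)
  rw [norm_sub_rev]
  exact PiLp.norm_apply_le (y - x) d

/-- The coefficients of the dyadic sums over the grids with the largest side `2 ^ N`. -/
def gridCoeff {n m : ℕ} (φ : (Fin m → E n) → ℝ) (δ ε : ℝ) (N i : ℕ) : ℝ≥0∞ :=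
  shell φ δ ε (N - 4 - i)

/-- The dyadic sum in which the oscillation of `b` stands outside of the averages. -/
def outerSum {n m : ℕ} (φ : (Fin m → E n) → ℝ) (δ ε : ℝ) (lam : ℝ≥0∞) (b : E n → ℝ)
    (f : Fin m → E n → ℝ≥0∞) (N : ℕ) (t : Fin n → Bool) (x : E n) : ℝ≥0∞ :=
  ∑' i, gridCoeff φ δ ε N i *
    ((1 + lam * ‖b x - ⨍ y in gridIdx (gridShift (2 ^ N) t) (2 ^ N) i ⁻¹'
        {gridIdx (gridShift (2 ^ N) t) (2 ^ N) i x}, b y‖ₑ) *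
      ∏ d, gridOrl (gridShift (2 ^ N) t) (2 ^ N) 0 (f d) i
        (gridIdx (gridShift (2 ^ N) t) (2 ^ N) i x))

/-- The dyadic sum with the `L log L` average of `fⱼ`. -/
def innerSum {n m : ℕ} (φ : (Fin m → E n) → ℝ) (δ ε : ℝ) (j : Fin m)
    (f : Fin m → E n → ℝ≥0∞) (N : ℕ) (t : Fin n → Bool) (x : E n) : ℝ≥0∞ :=
  ∑' i, gridCoeff φ δ ε N i *
    ∏ d, gridOrl (gridShift (2 ^ N) t) (2 ^ N) (if d = j then 1 else 0) (f d) i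
      (gridIdx (gridShift (2 ^ N) t) (2 ^ N) i x)

/-- Finitely many annuli fit into the grids with largest side `2 ^ N` as soon as `N` is large. The
integral is the supremum over finite families of annuli, so it lies below the limit inferior. -/
theorem lintegral_majorant_le_liminf {n m : ℕ} (hn : 1 ≤ n) (hm : 1 ≤ m) {φ : (Fin m → E n) → ℝ}
    {δ ε : ℝ} {C : ℝ≥0}
    (hC : ∀ k : ℤ, ∀ w ∈ annulus n m ((2 : ℝ) ^ k) 1 0,
      ENNReal.ofReal (φ w) ≤ C * (ENNReal.ofReal (((2 : ℝ) ^ k) ^ (n * m)))⁻¹ * shell φ δ ε k)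
    {b : E n → ℝ} (hb : LocallyIntegrable b volume) {B : ℝ≥0∞} (hB : OscLE b B) (hB0 : B ≠ 0)
    (hBt : B ≠ ∞) {lam : ℝ≥0∞} (j : Fin m)
    {f : Fin m → E n → ℝ≥0∞} (hf : ∀ i, AEMeasurable (f i) volume) (x : E n) (w : ℝ≥0∞) :
    (∫⁻ y, majorant φ lam b j f x y) * w ≤ Filter.liminf (fun N : ℕ => C * 16 ^ (n * m) *
      (∑ t : Fin n → Bool, (outerSum φ δ ε lam b f N t x +
        lam * (4 * (1 + 8 * 2 ^ n * B)) * innerSum φ δ ε j f N t x)) * w) Filter.atTop := by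
  rw [lintegral_eq_tsum_shellAt hn hm x, ENNReal.tsum_eq_iSup_sum, ENNReal.iSup_mul]
  refine iSup_le fun s => ?_
  refine Filter.le_liminf_of_le (by isBoundedDefault) ?_
  obtain ⟨N0, hN0⟩ : ∃ N0 : ℕ, ∀ k ∈ s, k + 4 ≤ N0 := by
    obtain ⟨M, hM⟩ := s.exists_le
    exact ⟨(M + 4).toNat, fun k hk => by have := hM k hk; omega⟩
  filter_upwards [Filter.eventually_ge_atTop N0] with N hN
  refine mul_le_mul' ?_ le_rfl
  set CB := 4 * (1 + 8 * 2 ^ n * B)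
  have hL : (0 : ℝ) < 2 ^ N := by positivity
  let idx : (Fin n → Bool) → ℕ → E n → Fin n → ℤ := fun t => gridIdx (gridShift (2 ^ N) t) (2 ^ N)
  let T : (Fin n → Bool) → ℕ → ℝ≥0∞ := fun t i => gridCoeff φ δ ε N i *
      ((1 + lam * ‖b x - ⨍ y in idx t i ⁻¹' {idx t i x}, b y‖ₑ) *
        (∏ d, gridOrl (gridShift (2 ^ N) t) (2 ^ N) 0 (f d) i (idx t i x)) +
      lam * CB * ∏ d, gridOrl (gridShift (2 ^ N) t) (2 ^ N) (if d = j then 1 else 0) (f d) i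
        (idx t i x))
  have hT : ∀ t, ∑' i, T t i = outerSum φ δ ε lam b f N t x +
      lam * CB * innerSum φ δ ε j f N t x := by
    intro t
    rw [outerSum, innerSum, ← ENNReal.tsum_mul_left, ← ENNReal.tsum_add]
    congr 1; ext i
    simp only [T, idx]
    ring
  have hone : ∀ k ∈ s, ∫⁻ y in shellAt m x k, majorant φ lam b j f x y ≤
      C * 16 ^ (n * m) * ∑ t, T t ((N : ℤ) - 4 - k).toNat := by
    intro k hk
    set i := ((N : ℤ) - 4 - k).toNat with hi
    have hik : (i : ℤ) = N - 4 - k := by have := hN0 k hk; omega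
    -- The radius `2 ^ (k + 1)` of the annulus has to be an eighth of the side of the cell, so the
    -- side is `16 * 2 ^ k`, that is, `i = N - 4 - k`.
    have hside : (2 : ℝ) ^ N / 2 ^ i = 16 * (2 : ℝ) ^ k := by
      have h1 : (N : ℤ) = i + k + 4 := by omega
      have h2 : (2 : ℝ) ^ N = 2 ^ i * 2 ^ k * 16 := by
        rw [← zpow_natCast, h1, zpow_add₀ two_ne_zero, zpow_add₀ two_ne_zero, zpow_natCast]
        norm_num
      rw [h2]; field_simp
    obtain ⟨t, ht⟩ := exists_gridShift hL i x
    have hsub : shellAt m x k ⊆ Set.univ.pi fun _ =>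
        cube (gridCorner (gridShift (2 ^ N) t) (2 ^ N) i (idx t i x)) (2 ^ N / 2 ^ i) := by
      intro y hy d _
      refine gridCell_subset_cube _ hL i _ (ht (y d) ?_)
      refine (norm_sub_le_of_mem_shellAt hy d).trans (le_of_eq ?_)
      rw [hside, zpow_add_one₀ two_ne_zero]; ring
    have hmain := setLIntegral_shellAt_le hC hb hB hB0 hBt (lam := lam) j hf x k hside hsub
    rw [restrict_gridCell _ hL] at hmain
    simp only [← gridOrl_eq_avg _ hL] at hmain
    refine hmain.trans ?_
    gcongr
    refine le_trans (le_of_eq ?_) (Finset.single_le_sum (f := fun t => T t i)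
      (fun _ _ => zero_le) (Finset.mem_univ t))
    simp only [T, gridCoeff, hik]
    congr 2
    ring
  calc ∑ k ∈ s, ∫⁻ y in shellAt m x k, majorant φ lam b j f x y
      ≤ ∑ k ∈ s, C * 16 ^ (n * m) * ∑ t, T t ((N : ℤ) - 4 - k).toNat := Finset.sum_le_sum hone
    _ = C * 16 ^ (n * m) * ∑ t, ∑ k ∈ s, T t ((N : ℤ) - 4 - k).toNat := by
      rw [← Finset.mul_sum, Finset.sum_comm]
    _ ≤ C * 16 ^ (n * m) * ∑ t, ∑' i, T t i := by
      gcongr with t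
      have hinj : Set.InjOn (fun k : ℤ => ((N : ℤ) - 4 - k).toNat) s := by
        intro a ha b hb hab
        have h1 := hN0 a ha
        have h2 := hN0 b hb
        simp only at hab
        omega
      rw [← Finset.sum_image (f := T t) hinj]
      exact ENNReal.sum_le_tsum _
    _ = _ := by simp_rw [hT]

/-! ### Estimates on a single cube -/

theorem aemeasurable_comp_smul {n : ℕ} {l : ℝ} (hl : 0 < l) {f : E n → ℝ≥0∞}
    (hf : AEMeasurable f volume) : AEMeasurable (fun x => f (l • x)) volume := by
  refine hf.comp_quasiMeasurePreserving ⟨by fun_prop, ?_⟩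
  rw [Measure.map_addHaar_smul volume hl.ne']
  exact Measure.smul_absolutelyContinuous

/-- This local embedding into `L¹` is what makes a function with finite average finite almost
everywhere on the cube, and one with zero average zero there. -/
theorem exists_setLIntegral_le_avg {n : ℕ} (X : BanachFunctionSpace n) (a : E n) {l : ℝ}
    (hl : 0 < l) : ∃ C : ℝ≥0∞, C ≠ ∞ ∧ ∀ f, AEMeasurable f volume →
      ∫⁻ x in cube a l, f x ≤ C * avg X.norm a l f := by
  set A : Set (E n) := (fun x => l • x) ⁻¹' cube a l with hA
  have hAm : MeasurableSet A := (measurableSet_cube a l).preimage (by fun_prop)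
  have hAv : volume A < ∞ := by
    rw [hA, Measure.addHaar_preimage_smul _ hl.ne']
    exact ENNReal.mul_lt_top ENNReal.ofReal_lt_top (volume_cube_ne_top a hl).lt_top
  obtain ⟨C, hC⟩ := X.lintegral_le A hAm hAv
  refine ⟨ENNReal.ofReal (l ^ n) * C, ENNReal.mul_ne_top ENNReal.ofReal_ne_top ENNReal.coe_ne_top,
    fun f hf => ?_⟩
  have h1 := hC (fun x => (cube a l).indicator f (l • x))
    (aemeasurable_comp_smul hl (hf.indicator (measurableSet_cube a l)))
  have h2 : ∫⁻ x in A, (cube a l).indicator f (l • x) = ∫⁻ x, (cube a l).indicator f (l • x) := by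
    rw [← lintegral_indicator hAm]
    refine lintegral_congr fun x => ?_
    by_cases hx : x ∈ A
    · rw [indicator_of_mem hx]
    · rw [indicator_of_notMem hx, indicator_of_notMem]
      exact hx
  rw [h2, lintegral_comp_smul hl, lintegral_indicator (measurableSet_cube a l),
    ENNReal.inv_mul_le_iff (by positivity) ENNReal.ofReal_ne_top, ← mul_assoc] at h1
  exact h1

/-- The estimate of `L (log L)^α` averages of `fᵢ` through the generalized Hölder inequality, with
the weights `vᵢ` controlled by a Fefferman–Phong type condition. -/
theorem mul_prod_avg_le {n m : ℕ} {Y Y' : Fin m → BanachFunctionSpace n} {αs : Fin m → ℝ}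
    (hY : ∀ i, GenHolder (αs i) (Y i) (Y' i)) {v : Fin m → E n → ℝ≥0}
    (hv : ∀ i, AEMeasurable (v i) volume) {f : Fin m → E n → ℝ≥0∞}
    (hf : ∀ i, AEMeasurable (f i) volume) (a : E n) {l : ℝ} (hl : 0 < l) {s W : ℝ≥0∞} {e : ℝ}
    (hWt : W ≠ ∞)
    (hW : s * volume (cube a l) ^ (-e) * ∏ i, avg (Y i).norm a l (fun x => (v i x : ℝ≥0∞)⁻¹) ≤ W) :
    s * ∏ i, avg (normLlog (αs i)) a l (f i) ≤
      2 ^ m * W * (volume (cube a l) ^ e * ∏ i, avg (Y' i).norm a l (fun x => f i x * v i x)) := by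
  set V := volume (cube a l) with hV
  have hV0 : V ≠ 0 := volume_cube_ne_zero a hl
  have hVt : V ≠ ∞ := volume_cube_ne_top a hl
  rcases eq_or_ne s 0 with rfl | hs
  · simp
  have hvm : ∀ i, AEMeasurable (fun x => (v i x : ℝ≥0∞)⁻¹) volume := fun i =>
    (hv i).coe_nnreal_ennreal.inv
  -- The weights are finite, so `v⁻¹` vanishes nowhere and its averages are positive. Hence a
  -- bounded product forces each of them to be finite when `s ≠ 0`.
  have hY0 : ∀ i, avg (Y i).norm a l (fun x => (v i x : ℝ≥0∞)⁻¹) ≠ 0 := by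
    intro i h0
    obtain ⟨C, -, hC⟩ := exists_setLIntegral_le_avg (Y i) a hl
    have h1 := hC _ (hvm i)
    rw [h0, mul_zero, nonpos_iff_eq_zero, lintegral_eq_zero_iff' (hvm i).restrict] at h1
    have h2 : ∀ᵐ x ∂volume.restrict (cube a l), False := by
      filter_upwards [h1] with x hx
      simp at hx
    rw [Filter.eventually_false_iff_eq_bot, ae_eq_bot, Measure.restrict_eq_zero] at h2
    exact hV0 h2
  have hYt : ∀ i, avg (Y i).norm a l (fun x => (v i x : ℝ≥0∞)⁻¹) ≠ ∞ := by
    intro i hi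
    have hpt : ∏ i, avg (Y i).norm a l (fun x => (v i x : ℝ≥0∞)⁻¹) = ∞ := by
      rw [← Finset.mul_prod_erase _ _ (Finset.mem_univ i), hi, ENNReal.top_mul]
      exact Finset.prod_ne_zero_iff.2 fun j _ => hY0 j
    rw [hpt, ENNReal.mul_top (mul_ne_zero hs (by simp [ENNReal.rpow_eq_zero_iff, hV0, hVt]))] at hW
    exact hWt (top_le_iff.1 hW)
  have hone : ∀ i, avg (normLlog (αs i)) a l (f i) ≤
      2 * avg (Y i).norm a l (fun x => (v i x : ℝ≥0∞)⁻¹) *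
        avg (Y' i).norm a l (fun x => f i x * v i x) := by
    intro i
    refine le_trans (le_of_eq ?_) (hY i _ _ (hvm i) ((hf i).mul (hv i).coe_nnreal_ennreal) a l hl)
    rw [avg_normLlog _ _ hl, avg_normLlog _ _ hl]
    refine orl_congr ?_
    obtain ⟨C, hCt, hC⟩ := exists_setLIntegral_le_avg (Y i) a hl
    -- A finite average of `v⁻¹` means that `v > 0` almost everywhere on the cube, so that `v⁻¹ (f
    -- v) = f` there in spite of the convention `∞ * 0 = 0`.
    have h1 := ae_lt_top' (hvm i).restrict
      (lt_of_le_of_lt (hC _ (hvm i)) (ENNReal.mul_lt_top hCt.lt_top (hYt i).lt_top)).ne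
    filter_upwards [h1] with x hx
    have hx0 : (v i x : ℝ≥0∞) ≠ 0 := by
      intro h0; rw [h0] at hx; simp at hx
    rw [Pi.mul_apply, mul_comm (f i x), ← mul_assoc, ENNReal.inv_mul_cancel hx0 ENNReal.coe_ne_top, one_mul]
  have hVe : V ^ (-e) * V ^ e = 1 := by
    rw [← ENNReal.rpow_add _ _ hV0 hVt]; simp
  calc s * ∏ i, avg (normLlog (αs i)) a l (f i)
      ≤ s * ∏ i, 2 * avg (Y i).norm a l (fun x => (v i x : ℝ≥0∞)⁻¹) *
        avg (Y' i).norm a l (fun x => f i x * v i x) := by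
        gcongr with i
        exact hone i
    _ = s * (V ^ (-e) * V ^ e) * (2 ^ m * (∏ i, avg (Y i).norm a l (fun x => (v i x : ℝ≥0∞)⁻¹)) *
        ∏ i, avg (Y' i).norm a l (fun x => f i x * v i x)) := by
        rw [hVe, mul_one]
        simp only [Finset.prod_mul_distrib, Finset.prod_const, Finset.card_univ, Fintype.card_fin]
    _ = 2 ^ m * (s * V ^ (-e) * ∏ i, avg (Y i).norm a l (fun x => (v i x : ℝ≥0∞)⁻¹)) * (V ^ e *
        ∏ i, avg (Y' i).norm a l (fun x => f i x * v i x)) := by ring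
    _ ≤ _ := by gcongr

theorem prod_avg_le_maximal {n m : ℕ} (X : Fin m → BanachFunctionSpace n)
    (f : Fin m → E n → ℝ≥0∞) {a : E n} {l : ℝ} (hl : 0 < l) {x : E n} (hx : x ∈ cube a l) :
    ∏ i, avg (X i).norm a l (f i) ≤ maximal X f x :=
  le_iSup_of_le a (le_iSup_of_le l (le_iSup_of_le hl (le_iSup_of_le hx le_rfl)))

/-- The maximal function is at least the product `P` of the averages on the whole cube `Q`, so
`|Q|^(1/p) P` is at most its `L^p` norm. This is raised to the power `1 - p/q`, and the remaining
`P^(p/q)` is kept. -/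
theorem rpow_volume_mul_prod_avg_le {n m : ℕ} (X : Fin m → BanachFunctionSpace n)
    (f : Fin m → E n → ℝ≥0∞) (a : E n) {l : ℝ} (hl : 0 < l) {p q : ℝ} (hp : 0 < p) (hpq : p ≤ q) :
    volume (cube a l) ^ (1 / p - 1 / q) * ∏ i, avg (X i).norm a l (f i) ≤
      lpNorm p (maximal X f) ^ (1 - p / q) * (∏ i, avg (X i).norm a l (f i)) ^ (p / q) := by
  have hq : 0 < q := hp.trans_le hpq
  set P := ∏ i, avg (X i).norm a l (f i) with hP
  set V := volume (cube a l) with hV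
  have h1 : V * P ^ p ≤ ∫⁻ x, maximal X f x ^ p := by
    calc V * P ^ p = ∫⁻ _ in cube a l, P ^ p := by rw [setLIntegral_const, mul_comm]
      _ ≤ ∫⁻ x in cube a l, maximal X f x ^ p := by
        refine setLIntegral_mono' (measurableSet_cube a l) fun x hx => ?_
        gcongr
        exact prod_avg_le_maximal X f hl hx
      _ ≤ _ := setLIntegral_le_lintegral _ _
  have h2 : V ^ (1 / p) * P ≤ lpNorm p (maximal X f) := by
    calc V ^ (1 / p) * P = (V * P ^ p) ^ (1 / p) := by
          rw [ENNReal.mul_rpow_of_nonneg _ _ (by positivity), ← ENNReal.rpow_mul,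
            mul_one_div_cancel hp.ne', ENNReal.rpow_one]
      _ ≤ _ := by rw [lpNorm]; gcongr
  have he : 0 ≤ 1 - p / q := by
    rw [sub_nonneg, div_le_one hq]; exact hpq
  have he' : 0 ≤ p / q := by positivity
  calc V ^ (1 / p - 1 / q) * P = (V ^ (1 / p) * P) ^ (1 - p / q) * P ^ (p / q) := by
        rw [ENNReal.mul_rpow_of_nonneg _ _ he, ← ENNReal.rpow_mul, mul_assoc,
          ← ENNReal.rpow_add_of_nonneg _ _ he he', sub_add_cancel, ENNReal.rpow_one]
        congr 2
        field_simp
    _ ≤ _ := by gcongr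

/-- The tail of the coefficients is controlled by `Φ_θ`. -/
theorem tsum_gridCoeff_le {n m : ℕ} (φ : (Fin m → E n) → ℝ) (δ ε : ℝ) {θ : ℝ} (hθ : 0 < θ)
    (N j : ℕ) :
    ∑' k, gridCoeff φ δ ε N (j + k) ^ θ ≤ bigPhi φ δ ε θ (2 ^ N / 2 ^ j) ^ θ := by
  rw [bigPhi, ← ENNReal.rpow_mul, one_div_mul_cancel hθ.ne', ENNReal.rpow_one]
  -- The coefficient of a cell belongs to an annulus radius of one sixteenth of its side, so all the
  -- levels from `j` on are among those counted by `Φ_θ` at the side of level `j`.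
  have hmem : ∀ k : ℕ, (2 : ℝ) ^ (-(-((N : ℤ) - 4 - (j + k : ℕ)))) ≤ 2 ^ N / 2 ^ j := by
    intro k
    rw [neg_neg, ← zpow_natCast, ← zpow_natCast, ← zpow_sub₀ two_ne_zero]
    exact zpow_le_zpow_right₀ one_le_two (by push_cast; omega)
  let g : ℕ → {ν : ℤ // (2 : ℝ) ^ (-ν) ≤ 2 ^ N / 2 ^ j} := fun k =>
    ⟨-((N : ℤ) - 4 - (j + k : ℕ)), hmem k⟩
  have hinj : Function.Injective g := by
    intro a b hab
    have := congrArg Subtype.val hab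
    simp only [g] at this
    push_cast at this
    omega
  refine le_trans (le_of_eq ?_) (ENNReal.tsum_comp_le_tsum_of_injective hinj
    (fun ν : {ν : ℤ // (2 : ℝ) ^ (-ν) ≤ 2 ^ N / 2 ^ j} =>
      (∫⁻ y in annulus n m ((2 : ℝ) ^ (-(ν : ℤ))) δ ε, ENNReal.ofReal (φ y)) ^ θ))
  congr 1; ext k
  simp only [g, gridCoeff, shell, neg_neg]

/-! ### Sparse domination on dyadic grids -/

/-- The sum over the selected cells, restricted to their disjoint parts. -/
def lastSum {Ω ι : Type*} (idx : ℕ → Ω → ι) (bad : ℕ → ι → ℕ → ι → Prop) (G : ℕ → ι → ℝ≥0∞)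
    (x : Ω) : ℝ≥0∞ :=
  ∑' j, (lastSelected idx bad j).indicator (fun x => G j (idx j x)) x

/-- The disjoint parts leave at most one term at each point, the same for all `G`. Products and
powers can therefore be handled term by term. -/
theorem lastSum_eq {Ω ι : Type*} (idx : ℕ → Ω → ι) (bad : ℕ → ι → ℕ → ι → Prop) (x : Ω) :
    (∀ G, lastSum idx bad G x = 0) ∨ ∃ j, ∀ G, lastSum idx bad G x = G j (idx j x) := by
  by_cases h : ∃ j, x ∈ lastSelected idx bad j
  · obtain ⟨j, hj⟩ := h
    refine Or.inr ⟨j, fun G => ?_⟩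
    rw [lastSum, tsum_eq_single j, indicator_of_mem hj]
    intro i hi
    exact indicator_of_notMem
      (fun hx => Set.disjoint_left.1 (lastSelected_disjoint (bad := bad) hi) hx hj) _
  · push Not at h
    refine Or.inl fun G => ?_
    rw [lastSum]
    simp [h]

/-- A cell is bad for a larger one if the average of one of the functions is much larger. -/
def orlBad {n m : ℕ} (τ : E n) (L : ℝ) (αs : Fin m → ℝ) (f : Fin m → E n → ℝ≥0∞) (k : ℕ)
    (z : Fin n → ℤ) (k' : ℕ) (z' : Fin n → ℤ) : Prop :=
  ∃ d, 2 * (2 * m : ℝ≥0∞) * gridOrl τ L (αs d) (f d) k z < gridOrl τ L (αs d) (f d) k' z'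

/-- The product of the averages of the functions over a cell. -/
def gridProd {n m : ℕ} (τ : E n) (L : ℝ) (αs : Fin m → ℝ) (f : Fin m → E n → ℝ≥0∞) (k : ℕ)
    (z : Fin n → ℤ) : ℝ≥0∞ :=
  ∏ d, gridOrl τ L (αs d) (f d) k z

section Sparse

variable {n m : ℕ} (τ : E n) {L : ℝ} (hL : 0 < L) {αs : Fin m → ℝ} {f : Fin m → E n → ℝ≥0∞}

theorem measurable_lastSum {bad : ℕ → (Fin n → ℤ) → ℕ → (Fin n → ℤ) → Prop}
    (L : ℝ) (G : ℕ → (Fin n → ℤ) → ℝ≥0∞) : Measurable (lastSum (gridIdx τ L) bad G) :=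
  Measurable.tsum fun j => ((nested_gridIdx τ L).measurable_comp j (G j)).indicator
    ((nested_gridIdx τ L).measurableSet_lastSelected j)

/-- With `K = 2 m` in `measure_gridOrl_lt_le` each of the `m` functions contributes the proportion
`1 / (2 m)`, in total one half. -/
theorem volume_badSet_orlBad_le (hL : 0 < L) (hm : 1 ≤ m) (hα : ∀ d, 0 ≤ αs d)
    (hf : ∀ d, AEMeasurable (f d) volume) (k : ℕ) (z : Fin n → ℤ) :
    volume (badSet (gridIdx τ L) (orlBad τ L αs f) k z) ≤ 2⁻¹ * volume (gridIdx τ L k ⁻¹' {z}) := by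
  have hm0 : (m : ℝ≥0∞) ≠ 0 := by simp; omega
  have hm1 : (1 : ℝ≥0∞) ≤ m := by exact_mod_cast hm
  have hK : (1 : ℝ≥0∞) ≤ 2 * m := hm1.trans (le_mul_of_one_le_left zero_le one_le_two)
  have hKt : (2 * m : ℝ≥0∞) ≠ ∞ := ENNReal.mul_ne_top (by simp) (by simp)
  calc _ ≤ volume (⋃ d : Fin m, {x | gridIdx τ L k x = z ∧ ∃ i, k < i ∧
        2 * (2 * m) * gridOrl τ L (αs d) (f d) k z <
          gridOrl τ L (αs d) (f d) i (gridIdx τ L i x)}) := by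
        refine measure_mono ?_
        rintro x ⟨hx, i, hi, d, hd⟩
        exact mem_iUnion.2 ⟨d, hx, i, hi, hd⟩
    _ ≤ ∑ d : Fin m, volume {x | gridIdx τ L k x = z ∧ ∃ i, k < i ∧
        2 * (2 * m) * gridOrl τ L (αs d) (f d) k z <
          gridOrl τ L (αs d) (f d) i (gridIdx τ L i x)} := measure_iUnion_fintype_le _ _
    _ ≤ ∑ _d : Fin m, (2 * m : ℝ≥0∞)⁻¹ * volume (gridIdx τ L k ⁻¹' {z}) :=
        Finset.sum_le_sum fun d _ => measure_gridOrl_lt_le τ hL (hα d) (hf d) hK hKt k z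
    _ = _ := by
        rw [Finset.sum_const, Finset.card_univ, Fintype.card_fin, nsmul_eq_mul, ← mul_assoc,
          ENNReal.mul_inv (by simp) (by simp), mul_comm 2⁻¹, ← mul_assoc,
          ENNReal.mul_inv_cancel hm0 (by simp), one_mul]

/-- Sparse domination of dyadic sums. -/
theorem lintegral_gridSum_le (hL : 0 < L) (hm : 1 ≤ m) (hα : ∀ d, 0 ≤ αs d)
    (hf : ∀ d, AEMeasurable (f d) volume) {θ : ℝ} (hθ : 0 ≤ θ) {α : ℝ} (hα0 : 0 ≤ α)
    (c : ℕ → ℝ≥0∞) {β : ℕ → E n → ℝ≥0∞} (hβm : ∀ k, AEMeasurable (β k) volume)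
    {h : E n → ℝ≥0∞} (hh : AEMeasurable h volume) {Cβ : ℝ≥0∞}
    (hβ : ∀ k z, ∫⁻ x in gridIdx τ L k ⁻¹' {z}, β k x * h x ≤
      Cβ * (volume (gridIdx τ L k ⁻¹' {z}) * gridOrl τ L α h k z)) :
    ∫⁻ x, ∑' k, c k * (β k x * h x * gridProd τ L αs f k (gridIdx τ L k x) ^ θ) ≤
      Cβ * ((4 * m) ^ m) ^ θ * 4 * ∫⁻ x, lastSum (gridIdx τ L) (orlBad τ L αs f)
        (fun j z => (∑' k, c (j + k)) * (gridOrl τ L α h j z * gridProd τ L αs f j z ^ θ)) x := by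
  have hN := nested_gridIdx τ L
  set idx := gridIdx τ L with hidx
  set bad := orlBad τ L αs f with hbad
  have hm1 : (1 : ℝ≥0∞) ≤ m := by exact_mod_cast hm
  have hself : ∀ k z, ¬ bad k z k z := by
    rintro k z ⟨d, hd⟩
    refine absurd hd (not_lt.2 (le_mul_of_one_le_left zero_le ?_))
    exact hm1.trans ((le_mul_of_one_le_left zero_le one_le_two).trans
      (le_mul_of_one_le_left zero_le one_le_two))
  have hF : ∀ j z k z', ¬ bad j z k z' → gridProd τ L αs f k z' ^ θ ≤
      ((4 * m) ^ m) ^ θ * gridProd τ L αs f j z ^ θ := by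
    intro j z k z' hnb
    rw [← ENNReal.mul_rpow_of_nonneg _ _ hθ]
    gcongr
    simp only [hbad, orlBad, not_exists, not_lt] at hnb
    calc gridProd τ L αs f k z' ≤ ∏ d, 2 * (2 * m : ℝ≥0∞) * gridOrl τ L (αs d) (f d) j z :=
          Finset.prod_le_prod' fun d _ => hnb d
      _ = _ := by
        rw [Finset.prod_mul_distrib, Finset.prod_const, Finset.card_univ, Fintype.card_fin, gridProd]
        congr 2
        ring
  have hmeasF : ∀ k, Measurable fun x => gridProd τ L αs f k (idx k x) ^ θ := fun k =>
    hN.measurable_comp k fun z => gridProd τ L αs f k z ^ θ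
  have hmeasH : ∀ k, Measurable fun x => gridOrl τ L α h k (idx k x) := fun k =>
    hN.measurable_comp k _
  have hm2 : ∀ k, AEMeasurable (fun x => β k x * h x * gridProd τ L αs f k (idx k x) ^ θ) volume :=
    fun k => ((hβm k).mul hh).mul (hmeasF k).aemeasurable
  have hm3 : ∀ k, Measurable fun x => gridOrl τ L α h k (idx k x) *
      gridProd τ L αs f k (idx k x) ^ θ := fun k => (hmeasH k).mul (hmeasF k)
  -- The product of averages is constant on the cells, so only `β h` is integrated there, and it may
  -- be replaced by the average of `h`.
  have h1 : ∫⁻ x, ∑' k, c k * (β k x * h x * gridProd τ L αs f k (idx k x) ^ θ) ≤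
      Cβ * ∫⁻ x, ∑' k, c k * (gridOrl τ L α h k (idx k x) *
        gridProd τ L αs f k (idx k x) ^ θ) := by
    rw [lintegral_tsum fun k => (hm2 k).const_mul _,
      lintegral_tsum fun k => ((hm3 k).const_mul _).aemeasurable, ← ENNReal.tsum_mul_left]
    refine ENNReal.tsum_le_tsum fun k => ?_
    rw [lintegral_const_mul'' _ (hm2 k), lintegral_const_mul _ (hm3 k), mul_left_comm,
      ← lintegral_const_mul _ (hm3 k), ← setLIntegral_univ, ← setLIntegral_univ (μ := volume)
      (fun x => Cβ * (gridOrl τ L α h k (idx k x) * gridProd τ L αs f k (idx k x) ^ θ))]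
    refine mul_le_mul' le_rfl ?_
    refine hN.lintegral_le_of_saturated (k := k) (fun _ _ _ _ => mem_univ _) fun x _ => ?_
    have hcell := hN.measurableSet_cell k (idx k x)
    calc ∫⁻ y in idx k ⁻¹' {idx k x}, β k y * h y * gridProd τ L αs f k (idx k y) ^ θ
        = ∫⁻ y in idx k ⁻¹' {idx k x}, β k y * h y * gridProd τ L αs f k (idx k x) ^ θ := by
          refine setLIntegral_congr_fun hcell fun y hy => ?_
          have : idx k y = idx k x := hy
          simp only [this]
      _ = (∫⁻ y in idx k ⁻¹' {idx k x}, β k y * h y) * gridProd τ L αs f k (idx k x) ^ θ :=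
          lintegral_mul_const'' _ ((hβm k).mul hh).restrict
      _ ≤ Cβ * (volume (idx k ⁻¹' {idx k x}) * gridOrl τ L α h k (idx k x)) *
          gridProd τ L αs f k (idx k x) ^ θ := by gcongr; exact hβ k _
      _ = Cβ * (gridOrl τ L α h k (idx k x) * gridProd τ L αs f k (idx k x) ^ θ) *
          volume (idx k ⁻¹' {idx k x}) := by ring
      _ = ∫⁻ _ in idx k ⁻¹' {idx k x}, Cβ * (gridOrl τ L α h k (idx k x) *
          gridProd τ L αs f k (idx k x) ^ θ) := by rw [setLIntegral_const]
      _ = _ := by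
          refine setLIntegral_congr_fun hcell fun y hy => ?_
          have : idx k y = idx k x := hy
          simp only [this]
  refine h1.trans ?_
  have h2 := hN.lintegral_tsum_le_selected (μ := volume) hself c (gridOrl τ L α h)
    (fun k z => gridProd τ L αs f k z ^ θ) _ 2 hF
    (fun j k z hjk => setLIntegral_gridOrl_le τ hL hα0 h j k z hjk)
  have h3 : ∀ j, ∫⁻ x in selected idx bad j, (∑' k, c (j + k)) *
      (gridOrl τ L α h j (idx j x) * gridProd τ L αs f j (idx j x) ^ θ) ≤
      2 * ∫⁻ x in lastSelected idx bad j, (∑' k, c (j + k)) *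
      (gridOrl τ L α h j (idx j x) * gridProd τ L αs f j (idx j x) ^ θ) := fun j =>
    hN.lintegral_selected_le (fun k z => (volume_gridCell_ne_top τ hL k z).lt_top)
      (volume_badSet_orlBad_le τ hL hm hα hf)
      (fun z => (∑' k, c (j + k)) * (gridOrl τ L α h j z * gridProd τ L αs f j z ^ θ)) j
  have h4 : ∫⁻ x, lastSum idx bad (fun j z => (∑' k, c (j + k)) *
      (gridOrl τ L α h j z * gridProd τ L αs f j z ^ θ)) x =
      ∑' j, ∫⁻ x in lastSelected idx bad j, (∑' k, c (j + k)) *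
      (gridOrl τ L α h j (idx j x) * gridProd τ L αs f j (idx j x) ^ θ) := by
    simp only [lastSum]
    rw [lintegral_tsum fun j => (((hm3 j).const_mul _).indicator
      (hN.measurableSet_lastSelected j)).aemeasurable]
    congr 1; ext j
    rw [lintegral_indicator (hN.measurableSet_lastSelected j)]
  -- One factor 2 comes from the averages of `h` over subcells, the other from the passage to the
  -- disjoint parts.
  calc _ ≤ Cβ * (((4 * m) ^ m) ^ θ * 2 * ∑' j, 2 * ∫⁻ x in lastSelected idx bad j,
        (∑' k, c (j + k)) * (gridOrl τ L α h j (idx j x) *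
          gridProd τ L αs f j (idx j x) ^ θ)) := by
        refine mul_le_mul' le_rfl (h2.trans (mul_le_mul' le_rfl ?_))
        exact ENNReal.tsum_le_tsum h3
    _ = _ := by
        rw [ENNReal.tsum_mul_left, h4]; ring

end Sparse

/-! ### Norm estimates for dyadic sums -/

/-- The test functions are the powers `G ^ (q - 1)` of truncations of `Z` in height and in space.
Their norms are finite, so one may divide by them before letting the truncation go to infinity. -/
theorem lpNorm_le_of_dual {n : ℕ} {Z : E n → ℝ≥0∞} (hZ : AEMeasurable Z volume) {q : ℝ}
    (hq : 1 < q) {C : ℝ≥0∞}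
    (H : ∀ g : E n → ℝ≥0∞, AEMeasurable g volume → lpNorm (q / (q - 1)) g < ∞ →
      ∫⁻ x, Z x * g x ≤ C * lpNorm (q / (q - 1)) g) : lpNorm q Z ≤ C := by
  have hq0 : 0 < q := zero_lt_one.trans hq
  have hq1 : 0 < q - 1 := by linarith
  let G : ℕ → E n → ℝ≥0∞ := fun N =>
    (Metric.closedBall (0 : E n) N).indicator fun x => min (Z x) N
  have hball : ∀ N : ℕ, MeasurableSet (Metric.closedBall (0 : E n) N) := fun N =>
    measurableSet_closedBall
  have hGm : ∀ N, AEMeasurable (G N) volume := fun N =>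
    (hZ.min aemeasurable_const).indicator (hball N)
  have hGZ : ∀ N x, G N x ≤ Z x := fun N x =>
    indicator_apply_le' (fun _ => min_le_left _ _) fun _ => zero_le
  have hI : ∀ N, ∫⁻ x, G N x ^ q ≤ C ^ q := by
    intro N
    set I := ∫⁻ x, G N x ^ q with hIdef
    have hIt : I < ∞ := by
      calc I ≤ ∫⁻ x, (Metric.closedBall (0 : E n) N).indicator (fun _ => (N : ℝ≥0∞) ^ q) x := by
            refine lintegral_mono fun x => ?_
            by_cases hx : x ∈ Metric.closedBall (0 : E n) N
            · simp only [G, indicator_of_mem hx]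
              gcongr
              exact min_le_right _ _
            · simp only [G, indicator_of_notMem hx]
              rw [ENNReal.zero_rpow_of_pos hq0]
        _ = (N : ℝ≥0∞) ^ q * volume (Metric.closedBall (0 : E n) N) := by
            rw [lintegral_indicator (hball N), setLIntegral_const]
        _ < ∞ := ENNReal.mul_lt_top (ENNReal.rpow_lt_top_of_nonneg hq0.le (by simp))
            measure_closedBall_lt_top
    rcases eq_or_ne I 0 with hI0 | hI0
    · rw [hI0]; exact zero_le
    have hgp : ∀ x, (G N x ^ (q - 1)) ^ (q / (q - 1)) = G N x ^ q := fun x => by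
      rw [← ENNReal.rpow_mul, mul_div_cancel₀ _ hq1.ne']
    have hexp : 1 / (q / (q - 1)) = 1 - 1 / q := by field_simp
    have hnorm : lpNorm (q / (q - 1)) (fun x => G N x ^ (q - 1)) = I ^ (1 - 1 / q) := by
      simp only [lpNorm, hgp, hexp, hIdef]
    have he : 0 ≤ 1 - 1 / q := by
      rw [sub_nonneg, div_le_one hq0]; exact hq.le
    have h1 := H (fun x => G N x ^ (q - 1)) ((hGm N).pow_const _)
      (by rw [hnorm]; exact ENNReal.rpow_lt_top_of_nonneg he hIt.ne)
    rw [hnorm] at h1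
    have h2 : I ≤ C * I ^ (1 - 1 / q) := by
      refine le_trans (lintegral_mono fun x => ?_) h1
      calc G N x ^ q = G N x ^ (1 : ℝ) * G N x ^ (q - 1) := by
            rw [← ENNReal.rpow_add_of_nonneg _ _ zero_le_one hq1.le]; ring_nf
        _ ≤ Z x * G N x ^ (q - 1) := by
            rw [ENNReal.rpow_one]
            gcongr
            exact hGZ N x
    have h3 : I = I ^ (1 / q) * I ^ (1 - 1 / q) := by
      rw [← ENNReal.rpow_add _ _ hI0 hIt.ne]; simp
    have h4 : I ^ (1 / q) ≤ C := by
      nth_rw 1 [h3] at h2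
      exact (ENNReal.mul_le_mul_iff_left
        (by simp [ENNReal.rpow_eq_zero_iff, hI0, hIt.ne])
        (ENNReal.rpow_lt_top_of_nonneg he hIt.ne).ne).1 h2
    calc I = (I ^ (1 / q)) ^ q := by
          rw [← ENNReal.rpow_mul, one_div_mul_cancel hq0.ne', ENNReal.rpow_one]
      _ ≤ C ^ q := by gcongr
  have hlim : Filter.Tendsto (fun N => ∫⁻ x, G N x ^ q) Filter.atTop (nhds (∫⁻ x, Z x ^ q)) := by
    refine lintegral_tendsto_of_tendsto_of_monotone (fun N => (hGm N).pow_const _)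
      (Filter.Eventually.of_forall fun x => ?_) (Filter.Eventually.of_forall fun x => ?_)
    · intro N M hNM
      have hc : (N : ℝ) ≤ M := by exact_mod_cast hNM
      refine ENNReal.rpow_le_rpow ?_ hq0.le
      refine indicator_apply_le' (fun hx => ?_) fun _ => zero_le
      have hx' : x ∈ Metric.closedBall (0 : E n) M := Metric.closedBall_subset_closedBall hc hx
      simp only [G, indicator_of_mem hx']
      gcongr
    · refine (ENNReal.continuous_rpow_const.tendsto (Z x)).comp ?_
      have h1 : Filter.Tendsto (fun N : ℕ => min (Z x) (N : ℝ≥0∞)) Filter.atTop (nhds (Z x)) := by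
        have := (tendsto_const_nhds (x := Z x)).min ENNReal.tendsto_nat_nhds_top
        rwa [min_eq_left le_top] at this
      refine h1.congr' ?_
      obtain ⟨N0, hN0⟩ := exists_nat_ge ‖x‖
      filter_upwards [Filter.eventually_ge_atTop N0] with N hN
      have hx : x ∈ Metric.closedBall (0 : E n) N := by
        rw [mem_closedBall_zero_iff]
        exact hN0.trans (by exact_mod_cast hN)
      simp only [G, indicator_of_mem hx]
  have := le_of_tendsto' hlim hI
  calc lpNorm q Z ≤ (C ^ q) ^ (1 / q) := by rw [lpNorm]; gcongr
    _ = C := by rw [← ENNReal.rpow_mul, mul_one_div_cancel hq0.ne', ENNReal.rpow_one]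

theorem rpow_tsum_le_tsum_rpow {ι : Type*} (a : ι → ℝ≥0∞) {q : ℝ} (hq0 : 0 < q) (hq1 : q ≤ 1) :
    (∑' i, a i) ^ q ≤ ∑' i, a i ^ q := by
  have hfin : ∀ s : Finset ι, (∑ i ∈ s, a i) ^ q ≤ ∑ i ∈ s, a i ^ q := by
    classical
    intro s
    induction s using Finset.induction_on with
    | empty => simp [hq0]
    | insert i s hi ih =>
      rw [Finset.sum_insert hi, Finset.sum_insert hi]
      exact (ENNReal.rpow_add_le_add_rpow _ _ hq0.le hq1).trans (by gcongr)
  refine le_of_tendsto' ((ENNReal.continuous_rpow_const.tendsto _).comp ENNReal.summable.hasSum)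
    fun s => (hfin s).trans (ENNReal.sum_le_tsum s)

section Pieces

variable {n m : ℕ} (τ : E n) {L : ℝ}

/-- The product of the averages `‖fᵢ‖_{Yᵢ,Q}` over a cell. -/
def gridAvgProd (τ : E n) (L : ℝ) (Y : Fin m → BanachFunctionSpace n) (f : Fin m → E n → ℝ≥0∞)
    (k : ℕ) (z : Fin n → ℤ) : ℝ≥0∞ :=
  ∏ d, avg (Y d).norm (gridCorner τ L k z) (L / 2 ^ k) (f d)

theorem gridAvgProd_le_maximal (hL : 0 < L) (Y : Fin m → BanachFunctionSpace n)
    (f : Fin m → E n → ℝ≥0∞) (k : ℕ) (x : E n) :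
    gridAvgProd τ L Y f k (gridIdx τ L k x) ≤ maximal Y f x :=
  prod_avg_le_maximal Y f (by positivity) (gridCell_subset_cube τ hL k _ rfl)

/-- At each point the sum has at most one term, and that term is below the maximal function. -/
theorem lintegral_lastSum_rpow_le (hL : 0 < L) (Y : Fin m → BanachFunctionSpace n)
    (f : Fin m → E n → ℝ≥0∞) (bad : ℕ → (Fin n → ℤ) → ℕ → (Fin n → ℤ) → Prop) {p r s : ℝ}
    (hr : 0 ≤ r) (hs : 0 < s) (hrs : r * s = p) :
    ∫⁻ x, lastSum (gridIdx τ L) bad (fun k z => gridAvgProd τ L Y f k z ^ r) x ^ s ≤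
      ∫⁻ x, maximal Y f x ^ p := by
  refine lintegral_mono fun x => ?_
  rcases lastSum_eq (gridIdx τ L) bad x with h | ⟨j, h⟩
  · rw [h, ENNReal.zero_rpow_of_pos hs]; exact zero_le
  · rw [h, ← ENNReal.rpow_mul, hrs]
    exact ENNReal.rpow_le_rpow (gridAvgProd_le_maximal τ hL Y f j x) (hrs ▸ by positivity)

variable {αs : Fin m → ℝ} {f : Fin m → E n → ℝ≥0∞} {Y Y' : Fin m → BanachFunctionSpace n}
  {v : Fin m → E n → ℝ≥0} {u : E n → ℝ≥0} {p q α : ℝ} {c Φ : ℕ → ℝ≥0∞} {β : ℕ → E n → ℝ≥0∞}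
  {Cβ W : ℝ≥0∞}

/-- The estimate on one cell in terms of the maximal function. -/
theorem cell_estimate (hL : 0 < L) (hf : ∀ d, AEMeasurable (f d) volume) (hp : 0 < p) (hpq : p ≤ q)
    (hY : ∀ d, GenHolder (αs d) (Y d) (Y' d)) (hv : ∀ d, AEMeasurable (v d) volume) (hWt : W ≠ ∞)
    {s : ℝ≥0∞} (j : ℕ) (z : Fin n → ℤ)
    (hW : s * volume (cube (gridCorner τ L j z) (L / 2 ^ j)) ^ (1 / q - 1 / p) *
      gridAvgProd τ L Y (fun d x => (v d x : ℝ≥0∞)⁻¹) j z ≤ W) :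
    s * gridProd τ L αs f j z ≤ 2 ^ m * W *
      (lpNorm p (maximal Y' fun d x => f d x * v d x) ^ (1 - p / q) *
        gridAvgProd τ L Y' (fun d x => f d x * v d x) j z ^ (p / q)) := by
  have hl : 0 < L / 2 ^ j := by positivity
  have h1 := mul_prod_avg_le (e := 1 / p - 1 / q) hY hv hf (gridCorner τ L j z) hl (s := s) hWt
    (by rw [neg_sub]; exact hW)
  simp only [gridProd, gridOrl_eq_avg τ hL]
  exact h1.trans (mul_le_mul' le_rfl (rpow_volume_mul_prod_avg_le Y' _ _ hl hp hpq))

/-- The estimate of a dyadic sum for `q > 1`. -/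
theorem lpNorm_gridSum_le (hL : 0 < L) (hm : 1 ≤ m) (hα : ∀ d, 0 ≤ αs d)
    (hf : ∀ d, AEMeasurable (f d) volume) (hα0 : 0 ≤ α) (hβm : ∀ k, AEMeasurable (β k) volume)
    (hβ : ∀ h : E n → ℝ≥0∞, AEMeasurable h volume → ∀ k z,
      ∫⁻ x in gridIdx τ L k ⁻¹' {z}, β k x * h x ≤
        Cβ * (volume (gridIdx τ L k ⁻¹' {z}) * gridOrl τ L α h k z))
    (hu : AEMeasurable u volume) (hv : ∀ d, AEMeasurable (v d) volume)
    (hp : 0 < p) (hpq : p ≤ q) (hq : 1 < q) {X X' : BanachFunctionSpace n} (hX : GenHolder α X X')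
    {CX : ℝ≥0∞}
    (hMX : ∀ g : E n → ℝ≥0∞, AEMeasurable g volume → lpNorm (q / (q - 1)) g < ∞ →
      lpNorm (q / (q - 1)) (maximal (fun _ : Fin 1 => X') fun _ => g) ≤ CX * lpNorm (q / (q - 1)) g)
    (hY : ∀ d, GenHolder (αs d) (Y d) (Y' d)) (hWt : W ≠ ∞)
    (hΦ : ∀ j, ∑' k, c (j + k) ≤ Φ j)
    (hW : ∀ j z, Φ j * avg X.norm (gridCorner τ L j z) (L / 2 ^ j) (fun x => (u x : ℝ≥0∞)) *
      volume (cube (gridCorner τ L j z) (L / 2 ^ j)) ^ (1 / q - 1 / p) *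
      gridAvgProd τ L Y (fun d x => (v d x : ℝ≥0∞)⁻¹) j z ≤ W) :
    lpNorm q (fun x => (∑' k, c k * (β k x * gridProd τ L αs f k (gridIdx τ L k x))) * u x) ≤
      Cβ * (4 * m) ^ m * 4 * (2 ^ (m + 1) * W) * CX *
        lpNorm p (maximal Y' fun d x => f d x * v d x) := by
  have hN := nested_gridIdx τ L
  have hq0 : 0 < q := zero_lt_one.trans hq
  have hmeasF : ∀ k, Measurable fun x => gridProd τ L αs f k (gridIdx τ L k x) := fun k =>
    hN.measurable_comp k _
  have hZm : AEMeasurable (fun x => (∑' k, c k * (β k x *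
      gridProd τ L αs f k (gridIdx τ L k x))) * u x) volume :=
    (AEMeasurable.tsum fun k => ((hβm k).mul (hmeasF k).aemeasurable).const_mul _).mul
      hu.coe_nnreal_ennreal
  refine lpNorm_le_of_dual hZm hq fun g hg hgt => ?_
  set R := lpNorm p (maximal Y' fun d x => f d x * v d x) with hR
  set bad := orlBad τ L αs f
  let h : E n → ℝ≥0∞ := fun x => u x * g x
  have hh : AEMeasurable h volume := hu.coe_nnreal_ennreal.mul hg
  have h1 := lintegral_gridSum_le τ hL hm hα hf zero_le_one hα0 c hβm hh (hβ h hh)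
  simp only [ENNReal.rpow_one] at h1
  let A : ℕ → (Fin n → ℤ) → ℝ≥0∞ := gridAvgProd τ L (fun _ : Fin 1 => X') fun _ => g
  let P : ℕ → (Fin n → ℤ) → ℝ≥0∞ := gridAvgProd τ L Y' fun d x => f d x * v d x
  -- Hölder's inequality for `X` and `X'` separates `u` from `g`; the average of `u` completes the
  -- Fefferman–Phong quantity. The exponent `1` on `A` is kept so that `lintegral_lastSum_rpow_le`
  -- applies to both factors.
  have hpt : ∀ j z, (∑' k, c (j + k)) * (gridOrl τ L α h j z * gridProd τ L αs f j z) ≤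
      2 ^ (m + 1) * W * R ^ (1 - p / q) * (A j z ^ (1 : ℝ) * P j z ^ (p / q)) := by
    intro j z
    have hl : 0 < L / 2 ^ j := by positivity
    have h2 := hX _ _ hu.coe_nnreal_ennreal hg (gridCorner τ L j z) (L / 2 ^ j) hl
    rw [← gridOrl_eq_avg τ hL] at h2
    have hA : avg X'.norm (gridCorner τ L j z) (L / 2 ^ j) g = A j z := by simp [A, gridAvgProd]
    rw [hA] at h2
    have h3 := cell_estimate τ hL hf hp hpq hY hv hWt j z (hW j z)
    rw [ENNReal.rpow_one]
    set xu := avg X.norm (gridCorner τ L j z) (L / 2 ^ j) fun x => (u x : ℝ≥0∞)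
    calc (∑' k, c (j + k)) * (gridOrl τ L α h j z * gridProd τ L αs f j z)
        ≤ Φ j * (2 * xu * A j z * gridProd τ L αs f j z) := by
          gcongr
          exact hΦ j
      _ = 2 * A j z * (Φ j * xu * gridProd τ L αs f j z) := by ring
      _ ≤ 2 * A j z * (2 ^ m * W * (R ^ (1 - p / q) * P j z ^ (p / q))) := by gcongr
      _ = _ := by ring
  let lA := lastSum (gridIdx τ L) bad fun j z => A j z ^ (1 : ℝ)
  let lP := lastSum (gridIdx τ L) bad fun j z => P j z ^ (p / q)
  have hlA : Measurable lA := measurable_lastSum τ L _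
  have hlP : Measurable lP := measurable_lastSum τ L _
  have hconj : (q / (q - 1)).HolderConjugate q := by
    have : q.HolderConjugate (q / (q - 1)) := Real.HolderConjugate.conjExponent hq
    exact this.symm
  have hq' : 0 < q / (q - 1) := hconj.pos
  have h4 : ∫⁻ x, lastSum (gridIdx τ L) bad (fun j z => (∑' k, c (j + k)) *
      (gridOrl τ L α h j z * gridProd τ L αs f j z)) x ≤
      ∫⁻ x, 2 ^ (m + 1) * W * R ^ (1 - p / q) * (lA x * lP x) := by
    refine lintegral_mono fun x => ?_
    rcases lastSum_eq (gridIdx τ L) bad x with h0 | ⟨j, h0⟩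
    · rw [h0]; exact zero_le
    · simp only [lA, lP, h0]
      exact hpt j _
  -- The power `R ^ (p / q)` obtained here recombines with `R ^ (1 - p / q)` from the cell estimate
  -- to `R`.
  have h5 : ∫⁻ x, lA x * lP x ≤ CX * lpNorm (q / (q - 1)) g * R ^ (p / q) := by
    refine (ENNReal.lintegral_mul_le_Lp_mul_Lq volume hconj hlA.aemeasurable
      hlP.aemeasurable).trans ?_
    refine mul_le_mul' ?_ ?_
    · refine le_trans ?_ (hMX g hg hgt)
      exact ENNReal.rpow_le_rpow
        (lintegral_lastSum_rpow_le τ hL _ _ bad zero_le_one hq' (one_mul _)) (by positivity)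
    · rw [hR, lpNorm, ← ENNReal.rpow_mul, one_div_mul_eq_div, div_div_cancel_left' hp.ne', ← one_div]
      exact ENNReal.rpow_le_rpow (lintegral_lastSum_rpow_le τ hL _ _ bad (div_pos hp hq0).le hq0
        (div_mul_cancel₀ _ hq0.ne')) (by positivity)
  have he : 0 ≤ 1 - p / q := by
    rw [sub_nonneg, div_le_one hq0]; exact hpq
  calc ∫⁻ x, (∑' k, c k * (β k x * gridProd τ L αs f k (gridIdx τ L k x))) * u x * g x
      = ∫⁻ x, ∑' k, c k * (β k x * h x * gridProd τ L αs f k (gridIdx τ L k x)) := by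
        refine lintegral_congr fun x => ?_
        rw [mul_assoc, ← ENNReal.tsum_mul_right]
        congr 1; ext k
        simp only [h]
        ring
    _ ≤ _ := h1
    _ ≤ Cβ * (4 * m) ^ m * 4 * (2 ^ (m + 1) * W * R ^ (1 - p / q) *
          (CX * lpNorm (q / (q - 1)) g * R ^ (p / q))) := by
        refine mul_le_mul' le_rfl (h4.trans ?_)
        have hlAP : Measurable fun x => lA x * lP x := hlA.mul hlP
        rw [lintegral_const_mul _ hlAP]
        exact mul_le_mul' le_rfl h5
    _ = Cβ * (4 * m) ^ m * 4 * (2 ^ (m + 1) * W) * CX * (R ^ (1 - p / q) * R ^ (p / q)) *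
          lpNorm (q / (q - 1)) g := by ring
    _ = _ := by
        rw [← ENNReal.rpow_add_of_nonneg _ _ he (by positivity), sub_add_cancel, ENNReal.rpow_one]

/-- The estimate of a dyadic sum for `q ≤ 1`. -/
theorem lintegral_rpow_gridSum_le (hL : 0 < L) (hm : 1 ≤ m) (hα : ∀ d, 0 ≤ αs d)
    (hf : ∀ d, AEMeasurable (f d) volume) (hα0 : 0 ≤ α) (hβm : ∀ k, AEMeasurable (β k) volume)
    (hu : AEMeasurable u volume) (hv : ∀ d, AEMeasurable (v d) volume)
    (hp : 0 < p) (hpq : p ≤ q) (hq : q ≤ 1)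
    (hβ : ∀ k z, ∫⁻ x in gridIdx τ L k ⁻¹' {z}, β k x ^ q * (u x : ℝ≥0∞) ^ q ≤
        Cβ * (volume (gridIdx τ L k ⁻¹' {z}) * gridOrl τ L α (fun x => (u x : ℝ≥0∞) ^ q) k z))
    (hY : ∀ d, GenHolder (αs d) (Y d) (Y' d)) (hWt : W ≠ ∞)
    (hΦ : ∀ j, ∑' k, c (j + k) ^ q ≤ Φ j ^ q) {xu : ℕ → (Fin n → ℤ) → ℝ≥0∞}
    (hxu : ∀ j z, gridOrl τ L α (fun x => (u x : ℝ≥0∞) ^ q) j z ≤ xu j z ^ q)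
    (hW : ∀ j z, Φ j * xu j z *
      volume (cube (gridCorner τ L j z) (L / 2 ^ j)) ^ (1 / q - 1 / p) *
      gridAvgProd τ L Y (fun d x => (v d x : ℝ≥0∞)⁻¹) j z ≤ W) :
    ∫⁻ x, ((∑' k, c k * (β k x * gridProd τ L αs f k (gridIdx τ L k x))) * u x) ^ q ≤
      Cβ * ((4 * m) ^ m) ^ q * 4 *
        (2 ^ m * W * lpNorm p (maximal Y' fun d x => f d x * v d x)) ^ q := by
  have hN := nested_gridIdx τ L
  have hq0 : 0 < q := hp.trans_le hpq
  set R := lpNorm p (maximal Y' fun d x => f d x * v d x) with hR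
  set bad := orlBad τ L αs f
  let h : E n → ℝ≥0∞ := fun x => (u x : ℝ≥0∞) ^ q
  have hh : AEMeasurable h volume := hu.coe_nnreal_ennreal.pow_const _
  have h1 := lintegral_gridSum_le τ hL hm hα hf hq0.le hα0 (fun k => c k ^ q)
    (fun k => (hβm k).pow_const q) hh hβ
  let P : ℕ → (Fin n → ℤ) → ℝ≥0∞ := gridAvgProd τ L Y' fun d x => f d x * v d x
  -- The `q`-th power of the cell estimate leaves exactly `P ^ p`, whose sum over the disjoint parts
  -- has integral at most `R ^ p`; no duality is needed.
  have hpt : ∀ j z, (∑' k, c (j + k) ^ q) * (gridOrl τ L α h j z * gridProd τ L αs f j z ^ q) ≤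
      (2 ^ m * W * R ^ (1 - p / q)) ^ q * P j z ^ p := by
    intro j z
    have h3 := cell_estimate τ hL hf hp hpq hY hv hWt j z (hW j z)
    calc (∑' k, c (j + k) ^ q) * (gridOrl τ L α h j z * gridProd τ L αs f j z ^ q)
        ≤ Φ j ^ q * (xu j z ^ q * gridProd τ L αs f j z ^ q) := by
          gcongr
          · exact hΦ j
          · exact hxu j z
      _ = (Φ j * xu j z * gridProd τ L αs f j z) ^ q := by
          rw [ENNReal.mul_rpow_of_nonneg _ _ hq0.le, ENNReal.mul_rpow_of_nonneg _ _ hq0.le, mul_assoc]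
      _ ≤ (2 ^ m * W * (R ^ (1 - p / q) * P j z ^ (p / q))) ^ q := by gcongr
      _ = _ := by
          rw [← mul_assoc, ENNReal.mul_rpow_of_nonneg _ _ hq0.le, ← ENNReal.rpow_mul (P j z),
            div_mul_cancel₀ _ hq0.ne']
  let lP := lastSum (gridIdx τ L) bad fun j z => P j z ^ p
  have hlP : Measurable lP := measurable_lastSum τ L _
  have h4 : ∫⁻ x, lastSum (gridIdx τ L) bad (fun j z => (∑' k, c (j + k) ^ q) *
      (gridOrl τ L α h j z * gridProd τ L αs f j z ^ q)) x ≤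
      ∫⁻ x, (2 ^ m * W * R ^ (1 - p / q)) ^ q * lP x := by
    refine lintegral_mono fun x => ?_
    rcases lastSum_eq (gridIdx τ L) bad x with h0 | ⟨j, h0⟩
    · rw [h0]; exact zero_le
    · simp only [lP, h0]
      exact hpt j _
  have h5 : ∫⁻ x, lP x ≤ R ^ p := by
    rw [hR, lpNorm, ← ENNReal.rpow_mul, one_div_mul_cancel hp.ne', ENNReal.rpow_one]
    have := lintegral_lastSum_rpow_le τ hL Y' (fun d x => f d x * v d x) bad hp.le
      zero_lt_one (mul_one p)
    simpa only [ENNReal.rpow_one] using this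
  have he : 0 ≤ 1 - p / q := by
    rw [sub_nonneg, div_le_one hq0]; exact hpq
  calc ∫⁻ x, ((∑' k, c k * (β k x * gridProd τ L αs f k (gridIdx τ L k x))) * u x) ^ q
      ≤ ∫⁻ x, ∑' k, c k ^ q * (β k x ^ q * h x *
          gridProd τ L αs f k (gridIdx τ L k x) ^ q) := by
        refine lintegral_mono fun x => ?_
        rw [ENNReal.mul_rpow_of_nonneg _ _ hq0.le]
        refine (mul_le_mul' (rpow_tsum_le_tsum_rpow _ hq0 hq) le_rfl).trans (le_of_eq ?_)
        rw [← ENNReal.tsum_mul_right]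
        congr 1; ext k
        rw [ENNReal.mul_rpow_of_nonneg _ _ hq0.le, ENNReal.mul_rpow_of_nonneg _ _ hq0.le]
        simp only [h]
        ring
    _ ≤ _ := h1
    _ ≤ Cβ * ((4 * m) ^ m) ^ q * 4 * ((2 ^ m * W * R ^ (1 - p / q)) ^ q * R ^ p) := by
        refine mul_le_mul' le_rfl (h4.trans ?_)
        rw [lintegral_const_mul _ hlP]
        exact mul_le_mul' le_rfl h5
    _ = _ := by
        congr 1
        have : R ^ p = (R ^ (p / q)) ^ q := by
          rw [← ENNReal.rpow_mul, div_mul_cancel₀ _ hq0.ne']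
        rw [this, ← ENNReal.mul_rpow_of_nonneg _ _ hq0.le, mul_assoc,
          ← ENNReal.rpow_add_of_nonneg _ _ he (by positivity), sub_add_cancel, ENNReal.rpow_one]

end Pieces

/-! ### Quasinorms -/

section lpNorm

variable {n : ℕ} {q : ℝ}

theorem lpNorm_le_iff (hq : 0 < q) {F : E n → ℝ≥0∞} {M : ℝ≥0∞} :
    lpNorm q F ≤ M ↔ ∫⁻ x, F x ^ q ≤ M ^ q := by
  rw [lpNorm, one_div, ENNReal.rpow_inv_le_iff hq]

/-- Each term is bounded by the `ℓ^q` sum of all of them. The constant is not sharp, but the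
argument covers `q < 1`, where the triangle inequality fails. -/
theorem lpNorm_sum_le {T : Type*} [Fintype T] (hq : 0 < q) {F : T → E n → ℝ≥0∞}
    (hF : ∀ t, AEMeasurable (F t) volume) {M : ℝ≥0∞} (hM : ∀ t, lpNorm q (F t) ≤ M) :
    lpNorm q (fun x => ∑ t, F t x) ≤ (Fintype.card T : ℝ≥0∞) ^ (1 + 1 / q) * M := by
  rw [lpNorm_le_iff hq]
  set N : ℝ≥0∞ := ((Fintype.card T : ℕ) : ℝ≥0∞) with hN
  have hpt : ∀ x, (∑ t, F t x) ^ q ≤ N ^ q * ∑ t, F t x ^ q := by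
    intro x
    have h1 : ∑ t, F t x ≤ N * (∑ t, F t x ^ q) ^ (1 / q) := by
      calc ∑ t, F t x ≤ ∑ _t : T, (∑ t, F t x ^ q) ^ (1 / q) := by
            refine Finset.sum_le_sum fun t _ => ?_
            rw [one_div, ENNReal.le_rpow_inv_iff hq]
            exact Finset.single_le_sum (f := fun t => F t x ^ q) (fun _ _ => zero_le)
              (Finset.mem_univ t)
        _ = _ := by rw [Finset.sum_const, nsmul_eq_mul, Finset.card_univ]
    calc (∑ t, F t x) ^ q ≤ (N * (∑ t, F t x ^ q) ^ (1 / q)) ^ q := by gcongr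
      _ = _ := by
        rw [ENNReal.mul_rpow_of_nonneg _ _ hq.le, ← ENNReal.rpow_mul, one_div_mul_cancel hq.ne',
          ENNReal.rpow_one]
  calc ∫⁻ x, (∑ t, F t x) ^ q ≤ ∫⁻ x, N ^ q * ∑ t, F t x ^ q := lintegral_mono hpt
    _ = N ^ q * ∑ t, ∫⁻ x, F t x ^ q := by
      rw [lintegral_const_mul'' _ (Finset.aemeasurable_fun_sum _ fun t _ => (hF t).pow_const q),
        lintegral_finsetSum' _ fun t _ => (hF t).pow_const q]
    _ ≤ N ^ q * ∑ _t : T, M ^ q := by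
      gcongr with t
      exact (lpNorm_le_iff hq).1 (hM t)
    _ = (N ^ (1 + 1 / q) * M) ^ q := by
      rw [Finset.sum_const, nsmul_eq_mul, Finset.card_univ, ← hN,
        ENNReal.mul_rpow_of_nonneg _ _ hq.le, ← ENNReal.rpow_mul, add_mul, one_mul,
        one_div_mul_cancel hq.ne', ENNReal.rpow_add_of_nonneg _ _ hq.le zero_le_one,
        ENNReal.rpow_one, mul_assoc]

theorem lpNorm_add_le (hq : 0 < q) {F G : E n → ℝ≥0∞} (hF : AEMeasurable F volume)
    (hG : AEMeasurable G volume) {M : ℝ≥0∞} (hFM : lpNorm q F ≤ M) (hGM : lpNorm q G ≤ M) :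
    lpNorm q (fun x => F x + G x) ≤ 2 ^ (1 + 1 / q) * M := by
  have := lpNorm_sum_le (T := Bool) (F := fun b => bif b then F else G) hq
    (by rintro (_ | _); exacts [hG, hF]) (M := M) (by rintro (_ | _); exacts [hGM, hFM])
  simpa using this

theorem lpNorm_const_mul (hq : 0 < q) {F : E n → ℝ≥0∞} (hF : AEMeasurable F volume) (c : ℝ≥0∞) :
    lpNorm q (fun x => c * F x) = c * lpNorm q F := by
  simp only [lpNorm, ENNReal.mul_rpow_of_nonneg _ _ hq.le]
  rw [lintegral_const_mul'' _ (hF.pow_const q), ENNReal.mul_rpow_of_nonneg _ _ (by positivity),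
    ← ENNReal.rpow_mul, mul_one_div_cancel hq.ne', ENNReal.rpow_one]

theorem lpNorm_mono (hq : 0 < q) {F G : E n → ℝ≥0∞} (h : ∀ x, F x ≤ G x) :
    lpNorm q F ≤ lpNorm q G := by
  rw [lpNorm, lpNorm]
  gcongr with x
  exact h x

theorem aemeasurable_liminf {F : ℕ → E n → ℝ≥0∞} (hF : ∀ N, AEMeasurable (F N) volume) :
    AEMeasurable (fun x => Filter.liminf (fun N => F N x) Filter.atTop) volume := by
  refine ⟨fun x => Filter.liminf (fun N => (hF N).mk (F N) x) Filter.atTop,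
    Measurable.liminf fun N => (hF N).measurable_mk, ?_⟩
  filter_upwards [ae_all_iff.2 fun N => (hF N).ae_eq_mk] with x hx
  simp only [hx]

theorem lpNorm_liminf_le (hq : 0 < q) {F : ℕ → E n → ℝ≥0∞} (hF : ∀ N, AEMeasurable (F N) volume)
    {M : ℝ≥0∞} (hM : ∀ N, lpNorm q (F N) ≤ M) :
    lpNorm q (fun x => Filter.liminf (fun N => F N x) Filter.atTop) ≤ M := by
  rw [lpNorm_le_iff hq]
  calc ∫⁻ x, Filter.liminf (fun N => F N x) Filter.atTop ^ q
      = ∫⁻ x, Filter.liminf (fun N => F N x ^ q) Filter.atTop := by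
        refine lintegral_congr fun x => ?_
        exact (ENNReal.orderIsoRpow q hq).liminf_apply
    _ ≤ Filter.liminf (fun N => ∫⁻ x, F N x ^ q) Filter.atTop :=
        lintegral_liminf_le' fun N => (hF N).pow_const q
    _ ≤ M ^ q := by
        refine Filter.liminf_le_of_le (by isBoundedDefault) fun b hb => ?_
        obtain ⟨N, hN⟩ := hb.exists
        exact hN.trans ((lpNorm_le_iff hq).1 (hM N))

end lpNorm

/-! ### Bounds for the dyadic sums of the potential operator -/

section Sums

variable {n m : ℕ}

theorem le_bigW (φ : (Fin m → E n) → ℝ) (δ ε p q : ℝ) (u : E n → ℝ≥0) (v : Fin m → E n → ℝ≥0)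
    (θ γ : ℝ) (ρ : (E n → ℝ≥0∞) → ℝ≥0∞) (Y : Fin m → Fin m → BanachFunctionSpace n) (j : Fin m)
    (a : E n) {l : ℝ} (hl : 0 < l) :
    bigPhi φ δ ε θ l * avg ρ a l (fun x => (u x : ℝ≥0∞) ^ γ) ^ (1 / γ) *
      volume (cube a l) ^ (1 / q - 1 / p) *
      ∏ i, avg (Y i j).norm a l (fun x => (v i x : ℝ≥0∞)⁻¹) ≤ bigW φ δ ε p q u v θ γ ρ Y := by
  refine le_iSup_of_le j (le_iSup_of_le a (le_iSup_of_le l (le_iSup_of_le hl (le_of_eq ?_))))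
  rw [mul_right_comm (bigPhi φ δ ε θ l)]

/-- The oscillation of `b` outside of the averages. -/
def outerWeight (τ : E n) (L : ℝ) (lam : ℝ≥0∞) (b : E n → ℝ) (k : ℕ) (x : E n) : ℝ≥0∞ :=
  1 + lam * ‖b x - ⨍ y in gridIdx τ L k ⁻¹' {gridIdx τ L k x}, b y‖ₑ

theorem aemeasurable_outerWeight (τ : E n) (L : ℝ) (lam : ℝ≥0∞) {b : E n → ℝ}
    (hb : LocallyIntegrable b volume) (k : ℕ) :
    AEMeasurable (outerWeight τ L lam b k) volume := by
  have h1 : Measurable fun x => ⨍ y in gridIdx τ L k ⁻¹' {gridIdx τ L k x}, b y :=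
    (nested_gridIdx τ L).measurable_comp k fun z => ⨍ y in gridIdx τ L k ⁻¹' {z}, b y
  exact ((hb.aestronglyMeasurable.aemeasurable.sub h1.aemeasurable).enorm.const_mul _).const_add _

/-- With `ℓ = 0` the weight is `1` and the average is an `L¹` average; with `ℓ = 1` this is
John–Nirenberg. The exponent `θ` is `1` for `q > 1` and `q` for `q ≤ 1`, which leads to `L (log
L)^(ℓ q)` in the latter case. -/
theorem setLIntegral_outerWeight_le (τ : E n) {L : ℝ} (hL : 0 < L) (ℓ : Fin 2) {b : E n → ℝ}
    (hb : LocallyIntegrable b volume) {B : ℝ≥0∞} (hB : OscLE b B) (hB0 : B ≠ 0) (hBt : B ≠ ∞)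
    {θ : ℝ} (h0 : 0 ≤ θ) (h1 : θ ≤ 1) (h : E n → ℝ≥0∞) (k : ℕ) (z : Fin n → ℤ) :
    ∫⁻ x in gridIdx τ L k ⁻¹' {z}, outerWeight τ L ((ℓ : ℕ) : ℝ≥0∞) b k x ^ θ * h x ≤
      4 * (1 + 8 * 2 ^ n * B) * (volume (gridIdx τ L k ⁻¹' {z}) *
        gridOrl τ L (((ℓ : ℕ) : ℝ) * θ) h k z) := by
  have hcell := (nested_gridIdx τ L).measurableSet_cell k z
  obtain rfl | rfl : ℓ = 0 ∨ ℓ = 1 := by omega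
  · have h2 := lintegral_le_orl (h := h) (α := 0)
      (μ := volume.restrict (gridIdx τ L k ⁻¹' {z})) le_rfl
      (by rw [Measure.restrict_apply_univ]; exact volume_gridCell_ne_zero τ hL _ _)
      (by rw [Measure.restrict_apply_univ]; exact volume_gridCell_ne_top τ hL _ _)
    rw [Measure.restrict_apply_univ] at h2
    simp only [outerWeight, Fin.val_zero, Nat.cast_zero, zero_mul, add_zero, ENNReal.one_rpow,
      one_mul]
    refine h2.trans (le_mul_of_one_le_left zero_le ?_)
    calc (1 : ℝ≥0∞) ≤ 4 * 1 := by norm_num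
      _ ≤ _ := by gcongr; exact le_self_add
  · have h2 := john_nirenberg hb hB hB0 hBt h0 h1 (gridCorner τ L k z) (l := L / 2 ^ k)
      (by positivity) h
    rw [← gridOrl_eq_avg τ hL, restrict_gridCell τ hL, volume_cube _ (by positivity),
      ← volume_gridCell τ hL k z] at h2
    simp only [outerWeight, Fin.val_one, Nat.cast_one, one_mul]
    refine le_trans (le_of_eq ?_) h2
    refine setLIntegral_congr_fun hcell fun y hy => ?_
    have : gridIdx τ L k y = z := hy
    simp only [this]

theorem outerSum_eq (φ : (Fin m → E n) → ℝ) (δ ε : ℝ) (lam : ℝ≥0∞) (b : E n → ℝ)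
    (f : Fin m → E n → ℝ≥0∞) (N : ℕ) (t : Fin n → Bool) (x : E n) :
    outerSum φ δ ε lam b f N t x = ∑' i, gridCoeff φ δ ε N i *
      (outerWeight (gridShift (2 ^ N) t) (2 ^ N) lam b i x *
        gridProd (gridShift (2 ^ N) t) (2 ^ N) (fun _ => 0) f i
          (gridIdx (gridShift (2 ^ N) t) (2 ^ N) i x)) := rfl

theorem innerSum_eq (φ : (Fin m → E n) → ℝ) (δ ε : ℝ) (j : Fin m)
    (f : Fin m → E n → ℝ≥0∞) (N : ℕ) (t : Fin n → Bool) (x : E n) :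
    innerSum φ δ ε j f N t x = ∑' i, gridCoeff φ δ ε N i *
      (1 * gridProd (gridShift (2 ^ N) t) (2 ^ N) (fun d => if d = j then 1 else 0) f i
          (gridIdx (gridShift (2 ^ N) t) (2 ^ N) i x)) := by
  simp only [one_mul]
  rfl

theorem aemeasurable_outerSum (φ : (Fin m → E n) → ℝ) (δ ε : ℝ) (lam : ℝ≥0∞) {b : E n → ℝ}
    (hb : LocallyIntegrable b volume) (f : Fin m → E n → ℝ≥0∞) (N : ℕ) (t : Fin n → Bool) :
    AEMeasurable (outerSum φ δ ε lam b f N t) volume := by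
  simp_rw [funext (outerSum_eq φ δ ε lam b f N t)]
  refine AEMeasurable.tsum fun i => AEMeasurable.const_mul ?_ _
  exact (aemeasurable_outerWeight _ _ _ hb i).mul
    ((nested_gridIdx _ _).measurable_comp i _).aemeasurable

theorem measurable_innerSum (φ : (Fin m → E n) → ℝ) (δ ε : ℝ) (j : Fin m)
    (f : Fin m → E n → ℝ≥0∞) (N : ℕ) (t : Fin n → Bool) :
    Measurable (innerSum φ δ ε j f N t) :=
  Measurable.tsum fun i => Measurable.const_mul ((nested_gridIdx _ _).measurable_comp i fun z =>
    ∏ d, gridOrl (gridShift (2 ^ N) t) (2 ^ N) (if d = j then 1 else 0) (f d) i z) _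

/-- Jensen's inequality for averages over a cell. -/
theorem gridOrl_zero_rpow_le (τ : E n) {L : ℝ} (hL : 0 < L) {q : ℝ} (hq0 : 0 < q) (hq1 : q ≤ 1)
    {w : E n → ℝ≥0∞} (hw : AEMeasurable w volume) (k : ℕ) (z : Fin n → ℤ) :
    gridOrl τ L 0 (fun x => w x ^ q) k z ≤ gridOrl τ L 0 w k z ^ q := by
  set V := volume (gridIdx τ L k ⁻¹' {z}) with hV
  have hV0 : V ≠ 0 := volume_gridCell_ne_zero τ hL k z
  have hVt : V ≠ ∞ := volume_gridCell_ne_top τ hL k z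
  have hu0 : (volume.restrict (gridIdx τ L k ⁻¹' {z})) univ = V := Measure.restrict_apply_univ _
  have h1 := mul_orl_zero_le (h := fun x => w x ^ q) (μ := volume.restrict (gridIdx τ L k ⁻¹' {z}))
    (by rwa [hu0]) (by rwa [hu0]) (hw.pow_const q).restrict
  have h2 := lintegral_le_orl (h := w) (α := 0) (μ := volume.restrict (gridIdx τ L k ⁻¹' {z}))
    le_rfl (by rwa [hu0]) (by rwa [hu0])
  rw [hu0] at h1 h2
  have h3 : ∫⁻ x in gridIdx τ L k ⁻¹' {z}, w x ^ q ≤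
      (∫⁻ x in gridIdx τ L k ⁻¹' {z}, w x) ^ q * V ^ (1 - q) := by
    rcases eq_or_lt_of_le hq1 with rfl | hlt
    · simp
    have hconj : (1 / q).HolderConjugate (1 / (1 - q)) := by
      rw [Real.holderConjugate_iff]
      refine ⟨by rw [lt_div_iff₀ hq0]; linarith, ?_⟩
      simp
    have h4 := ENNReal.lintegral_mul_le_Lp_mul_Lq (volume.restrict (gridIdx τ L k ⁻¹' {z})) hconj
      (hw.pow_const q).restrict (aemeasurable_const (b := (1 : ℝ≥0∞)))
    simp only [Pi.mul_apply, mul_one, ← ENNReal.rpow_mul, mul_one_div_cancel hq0.ne',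
      ENNReal.rpow_one, ENNReal.one_rpow, lintegral_const, one_mul, one_div_one_div, hu0] at h4
    exact h4
  have h5 : V * gridOrl τ L 0 (fun x => w x ^ q) k z ≤ V * gridOrl τ L 0 w k z ^ q := by
    calc V * gridOrl τ L 0 (fun x => w x ^ q) k z
        ≤ (V * gridOrl τ L 0 w k z) ^ q * V ^ (1 - q) :=
          h1.trans (h3.trans (mul_le_mul' (ENNReal.rpow_le_rpow h2 hq0.le) le_rfl))
      _ = (V ^ q * V ^ (1 - q)) * gridOrl τ L 0 w k z ^ q := by
          rw [ENNReal.mul_rpow_of_nonneg _ _ hq0.le]; ring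
      _ = _ := by
          rw [← ENNReal.rpow_add_of_nonneg _ _ hq0.le (by linarith), add_sub_cancel,
            ENNReal.rpow_one]
  exact (ENNReal.mul_le_mul_iff_right hV0 hVt).1 h5

variable {ps : Fin m → ℝ} {p q : ℝ} {φ : (Fin m → E n) → ℝ} {δ ε : ℝ}
  {u : E n → ℝ≥0} {v : Fin m → E n → ℝ≥0}

/-- The Orlicz spaces of a dyadic sum with the weight `β` outside of the averages, and the
Fefferman–Phong type conditions for them, give the bound of the sum. -/
theorem exists_gridSum_bound (hm : 1 ≤ m) (hp : 0 < p) (hpq : p ≤ q)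
    (hu : AEMeasurable u volume) (hv : ∀ d, AEMeasurable (v d) volume)
    {αs : Fin m → ℝ} (hα : ∀ d, 0 ≤ αs d) {a : ℝ} (ha : 0 ≤ a) {j : Fin m}
    {Y Y' : Fin m → Fin m → BanachFunctionSpace n}
    (hY : ∀ d, GenHolder (αs d) (Y d j) (Y' d j)) (hMY : MaximalBounded (fun d => Y' d j) ps p)
    (H : (1 < q ∧ ∃ X X' : BanachFunctionSpace n, GenHolder a X X' ∧
        MaximalBounded (fun _ : Fin 1 => X') (fun _ => q / (q - 1)) (q / (q - 1)) ∧
        bigW φ δ ε p q u v 1 1 X.norm Y < ∞) ∨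
      (q ≤ 1 ∧ (bigW φ δ ε p q u v q q (normLlog (a * q)) Y < ∞ ∨
        (a = 0 ∧ bigW φ δ ε p q u v q 1 (normLlog 0) Y < ∞)))) :
    ∃ K : ℝ≥0∞ → ℝ≥0∞, (∀ C, C ≠ ∞ → K C ≠ ∞) ∧ ∀ (Cβ : ℝ≥0∞) (N : ℕ) (t : Fin n → Bool)
      (β : ℕ → E n → ℝ≥0∞), (∀ k, AEMeasurable (β k) volume) →
      (∀ θ : ℝ, 0 ≤ θ → θ ≤ 1 → ∀ h : E n → ℝ≥0∞, AEMeasurable h volume → ∀ k z,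
        ∫⁻ x in gridIdx (gridShift (2 ^ N) t) (2 ^ N) k ⁻¹' {z}, β k x ^ θ * h x ≤
          Cβ * (volume (gridIdx (gridShift (2 ^ N) t) (2 ^ N) k ⁻¹' {z}) *
            gridOrl (gridShift (2 ^ N) t) (2 ^ N) (a * θ) h k z)) →
      ∀ f : Fin m → E n → ℝ≥0∞, (∀ d, AEMeasurable (f d) volume) →
        (∀ d, lpNorm (ps d) (fun x => f d x * v d x) < ∞) →
        lpNorm q (fun x => (∑' k, gridCoeff φ δ ε N k * (β k x *
          gridProd (gridShift (2 ^ N) t) (2 ^ N) αs f k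
            (gridIdx (gridShift (2 ^ N) t) (2 ^ N) k x))) * u x) ≤
          K Cβ * ∏ d, lpNorm (ps d) (fun x => f d x * v d x) := by
  have hq0 : 0 < q := hp.trans_le hpq
  obtain ⟨CY, hCY⟩ := hMY
  have hR : ∀ f : Fin m → E n → ℝ≥0∞, (∀ d, AEMeasurable (f d) volume) →
      (∀ d, lpNorm (ps d) (fun x => f d x * v d x) < ∞) →
      lpNorm p (maximal (fun d => Y' d j) fun d x => f d x * v d x) ≤
        CY * ∏ d, lpNorm (ps d) (fun x => f d x * v d x) := fun f hf hft =>
    hCY _ (fun d => (hf d).mul (hv d).coe_nnreal_ennreal) hft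
  have h4m : (4 * m : ℝ≥0∞) ^ m ≠ ∞ := by finiteness
  rcases H with ⟨hq, X, X', hX, ⟨CX, hCX⟩, hW⟩ | ⟨hq, hW⟩
  · set W := bigW φ δ ε p q u v 1 1 X.norm Y with hWdef
    refine ⟨fun C => C * (4 * m) ^ m * 4 * (2 ^ (m + 1) * W) * CX * CY, fun C hC => ?_, ?_⟩
    · have := hW.ne
      finiteness
    intro Cβ N t β hβm hβ f hf hft
    have hL : (0 : ℝ) < 2 ^ N := by positivity
    refine (lpNorm_gridSum_le (gridShift (2 ^ N) t) hL hm hα hf ha hβm (Cβ := Cβ) ?_ hu hv hp hpq hq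
      hX (CX := CX) ?_ hY hW.ne (Φ := fun k => bigPhi φ δ ε 1 (2 ^ N / 2 ^ k)) ?_ ?_).trans ?_
    · intro h hh k z
      simpa using hβ 1 zero_le_one le_rfl h hh k z
    · intro g hg hgt
      simpa using hCX (fun _ => g) (fun _ => hg) fun _ => hgt
    · intro i
      simpa using tsum_gridCoeff_le φ δ ε zero_lt_one N i
    · intro i z
      have := le_bigW φ δ ε p q u v 1 1 X.norm Y j (gridCorner (gridShift (2 ^ N) t) (2 ^ N) i z)
        (l := 2 ^ N / 2 ^ i) (by positivity)
      simp only [ENNReal.rpow_one, one_div_one] at this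
      exact this
    · rw [mul_assoc _ (CY : ℝ≥0∞)]
      exact mul_le_mul' le_rfl (hR f hf hft)
  -- Both forms of the condition for `q ≤ 1` are brought to one: either averages of `u ^ q` are used
  -- directly, or, without oscillation outside, Jensen's inequality bounds them by powers of
  -- averages of `u`.
  · obtain ⟨W, hWt, α, hα0, hαa, xu, hxu, hW⟩ : ∃ W : ℝ≥0∞, W ≠ ∞ ∧ ∃ α : ℝ, 0 ≤ α ∧ α = a * q ∧
        ∃ xu : ∀ (N : ℕ) (t : Fin n → Bool), ℕ → (Fin n → ℤ) → ℝ≥0∞,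
        (∀ N t i z, gridOrl (gridShift (2 ^ N) t) (2 ^ N) α (fun x => (u x : ℝ≥0∞) ^ q) i z ≤
          xu N t i z ^ q) ∧
        ∀ N t i z, bigPhi φ δ ε q (2 ^ N / 2 ^ i) * xu N t i z *
          volume (cube (gridCorner (gridShift (2 ^ N) t) (2 ^ N) i z) (2 ^ N / 2 ^ i)) ^
            (1 / q - 1 / p) *
          gridAvgProd (gridShift (2 ^ N) t) (2 ^ N) (fun d => Y d j)
            (fun d x => (v d x : ℝ≥0∞)⁻¹) i z ≤ W := by
      rcases hW with hW | ⟨rfl, hW⟩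
      · refine ⟨_, hW.ne, a * q, by positivity, rfl, fun N t i z =>
          gridOrl (gridShift (2 ^ N) t) (2 ^ N) (a * q) (fun x => (u x : ℝ≥0∞) ^ q) i z ^ (1 / q),
          fun N t i z => ?_, fun N t i z => ?_⟩
        · rw [← ENNReal.rpow_mul, one_div_mul_cancel hq0.ne', ENNReal.rpow_one]
        · beta_reduce
          rw [gridOrl_eq_avg _ (by positivity)]
          exact le_bigW φ δ ε p q u v q q _ Y j _ (by positivity)
      · refine ⟨_, hW.ne, 0, le_rfl, by simp, fun N t i z =>
          gridOrl (gridShift (2 ^ N) t) (2 ^ N) 0 (fun x => (u x : ℝ≥0∞)) i z,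
          fun N t i z => ?_, fun N t i z => ?_⟩
        · exact gridOrl_zero_rpow_le _ (by positivity) hq0 hq hu.coe_nnreal_ennreal i z
        · have := le_bigW φ δ ε p q u v q 1 (normLlog 0) Y j
            (gridCorner (gridShift (2 ^ N) t) (2 ^ N) i z) (l := 2 ^ N / 2 ^ i) (by positivity)
          simp only [ENNReal.rpow_one, one_div_one] at this
          beta_reduce
          rw [gridOrl_eq_avg _ (by positivity)]
          exact this
    have h4q : ((4 * m : ℝ≥0∞) ^ m) ^ q ≠ ∞ := ENNReal.rpow_ne_top_of_nonneg hq0.le h4m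
    refine ⟨fun C => (C * ((4 * m) ^ m) ^ q * 4) ^ (1 / q) * (2 ^ m * W) * CY, fun C hC => ?_, ?_⟩
    · have : (C * ((4 * m : ℝ≥0∞) ^ m) ^ q * 4) ^ (1 / q) ≠ ∞ :=
        ENNReal.rpow_ne_top_of_nonneg (by positivity) (by finiteness)
      finiteness
    intro Cβ N t β hβm hβ f hf hft
    have hL : (0 : ℝ) < 2 ^ N := by positivity
    have hmain := lintegral_rpow_gridSum_le (gridShift (2 ^ N) t) hL hm hα hf hα0 hβm (Cβ := Cβ)
      hu hv hp hpq hq (by rw [hαa]; exact hβ q hq0.le hq _ (hu.coe_nnreal_ennreal.pow_const _))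
      hY hWt (Φ := fun k => bigPhi φ δ ε q (2 ^ N / 2 ^ k)) (c := gridCoeff φ δ ε N)
      (fun i => tsum_gridCoeff_le φ δ ε hq0 N i) (hxu N t) (hW N t)
    rw [lpNorm_le_iff hq0]
    refine hmain.trans ?_
    have h1 : ∀ T : ℝ≥0∞, T = (T ^ (1 / q)) ^ q := fun T => by
      rw [← ENNReal.rpow_mul, one_div_mul_cancel hq0.ne', ENNReal.rpow_one]
    rw [h1 (Cβ * ((4 * m : ℝ≥0∞) ^ m) ^ q * 4), ← ENNReal.mul_rpow_of_nonneg _ _ hq0.le]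
    refine ENNReal.rpow_le_rpow ?_ hq0.le
    rw [mul_assoc _ (CY : ℝ≥0∞), mul_assoc _ (2 ^ m * W)]
    exact mul_le_mul' le_rfl (mul_le_mul' le_rfl (hR f hf hft))

end Sums

/-! ### Domination of the operator -/

section Domination

variable {n m : ℕ} {ps : Fin m → ℝ} {p q : ℝ} {φ : (Fin m → E n) → ℝ} {δ ε : ℝ}
  {u : E n → ℝ≥0} {v : Fin m → E n → ℝ≥0} {X X' : Fin 2 → BanachFunctionSpace n}
  {Y Y' : Fin 2 → Fin m → Fin m → BanachFunctionSpace n} {ℓ : Fin 2}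

/-- Here all logarithms are on the side of `u`: the `fᵢ` enter through `L¹` averages, with the
spaces `Y⁰`, and `u` through `X^ℓ` or `L (log L)^(ℓ q)`. -/
theorem exists_outerSum_bound (hm : 1 ≤ m) (hp : 0 < p) (hpq : p ≤ q)
    (hX : ∀ k ≤ ℓ, GenHolder ((k : ℕ) : ℝ) (X k) (X' k))
    (hY : ∀ k ≤ ℓ, ∀ i j, GenHolder (if i = j then ((k : ℕ) : ℝ) else 0) (Y k i j) (Y' k i j))
    (hMY : ∀ k ≤ ℓ, ∀ j, MaximalBounded (fun i => Y' k i j) ps p)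
    (hu : AEMeasurable u volume) (hv : ∀ i, AEMeasurable (v i) volume)
    (h : (1 < q ∧
        (∀ k ≤ ℓ, MaximalBounded (fun _ : Fin 1 => X' k) (fun _ => q / (q - 1)) (q / (q - 1))) ∧
        bigW φ δ ε p q u v 1 1 (X ℓ).norm (Y 0) < ∞) ∨
      (q ≤ 1 ∧ bigW φ δ ε p q u v q q (normLlog (((ℓ : ℕ) : ℝ) * q)) (Y 0) < ∞)) (j : Fin m) :
    ∃ K : ℝ≥0∞ → ℝ≥0∞, (∀ B, B ≠ ∞ → K B ≠ ∞) ∧ ∀ (B : ℝ≥0∞) (b : E n → ℝ),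
      B ≠ 0 → B ≠ ∞ → LocallyIntegrable b volume → OscLE b B →
      ∀ f : Fin m → E n → ℝ≥0∞, (∀ d, AEMeasurable (f d) volume) →
        (∀ d, lpNorm (ps d) (fun x => f d x * v d x) < ∞) → ∀ (N : ℕ) (t : Fin n → Bool),
        lpNorm q (fun x => outerSum φ δ ε ((ℓ : ℕ) : ℝ≥0∞) b f N t x * u x) ≤
          K B * ∏ d, lpNorm (ps d) (fun x => f d x * v d x) := by
  have hℓ : (0 : Fin 2) ≤ ℓ := Fin.zero_le ℓ
  obtain ⟨K, hK, hKb⟩ := exists_gridSum_bound (φ := φ) (δ := δ) (ε := ε) (ps := ps) hm hp hpq hu hv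
    (αs := fun _ => 0) (fun _ => le_rfl) (a := ((ℓ : ℕ) : ℝ)) (by positivity) (j := j)
    (Y := Y 0) (Y' := Y' 0) (fun d => by simpa using hY 0 hℓ d j) (hMY 0 hℓ j)
    (h.imp (fun ⟨h1, h2, h3⟩ => ⟨h1, X ℓ, X' ℓ, hX ℓ le_rfl, h2 ℓ le_rfl, h3⟩)
      (fun ⟨h1, h2⟩ => ⟨h1, Or.inl h2⟩))
  refine ⟨fun B => K (4 * (1 + 8 * 2 ^ n * B)), fun B hB => hK _ (by finiteness), ?_⟩
  intro B b hB0 hBt hb hB f hf hft N t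
  simp only [outerSum_eq]
  exact hKb _ N t (outerWeight (gridShift (2 ^ N) t) (2 ^ N) ((ℓ : ℕ) : ℝ≥0∞) b)
    (aemeasurable_outerWeight _ _ _ hb)
    (fun θ h0 h1 h _ k z => setLIntegral_outerWeight_le _ (by positivity) ℓ hb hB hB0 hBt h0 h1
      h k z) f hf hft

/-- Here the logarithm is on `fⱼ`, through `Y¹`, and nothing is left outside of the averages, so `u`
enters through `X⁰` or `L`. The factor `ℓ` makes the term vanish for `ℓ = 0`. -/
theorem exists_innerSum_bound (hm : 1 ≤ m) (hp : 0 < p) (hpq : p ≤ q)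
    (hX : ∀ k ≤ ℓ, GenHolder ((k : ℕ) : ℝ) (X k) (X' k))
    (hY : ∀ k ≤ ℓ, ∀ i j, GenHolder (if i = j then ((k : ℕ) : ℝ) else 0) (Y k i j) (Y' k i j))
    (hMY : ∀ k ≤ ℓ, ∀ j, MaximalBounded (fun i => Y' k i j) ps p)
    (hu : AEMeasurable u volume) (hv : ∀ i, AEMeasurable (v i) volume)
    (h : (1 < q ∧
        (∀ k ≤ ℓ, MaximalBounded (fun _ : Fin 1 => X' k) (fun _ => q / (q - 1)) (q / (q - 1))) ∧
        ((ℓ : ℕ) : ℝ≥0∞) * bigW φ δ ε p q u v 1 1 (X 0).norm (Y 1) < ∞) ∨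
      (q ≤ 1 ∧ ((ℓ : ℕ) : ℝ≥0∞) * bigW φ δ ε p q u v q 1 (normLlog 0) (Y 1) < ∞)) (j : Fin m) :
    ∃ K : ℝ≥0∞, K ≠ ∞ ∧
      ∀ f : Fin m → E n → ℝ≥0∞, (∀ d, AEMeasurable (f d) volume) →
        (∀ d, lpNorm (ps d) (fun x => f d x * v d x) < ∞) → ∀ (N : ℕ) (t : Fin n → Bool),
        lpNorm q (fun x => ((ℓ : ℕ) : ℝ≥0∞) * (innerSum φ δ ε j f N t x * u x)) ≤
          K * ∏ d, lpNorm (ps d) (fun x => f d x * v d x) := by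
  have hq : 0 < q := hp.trans_le hpq
  obtain rfl | rfl : ℓ = 0 ∨ ℓ = 1 := by omega
  · refine ⟨0, by simp, fun f _ _ N t => ?_⟩
    simp [lpNorm, hq]
  simp only [Fin.val_one, Nat.cast_one, one_mul] at h hX hY ⊢
  have hα : ∀ d : Fin m, (0 : ℝ) ≤ if d = j then 1 else 0 := fun d => by split_ifs <;> norm_num
  obtain ⟨K, hK, hKb⟩ := exists_gridSum_bound (φ := φ) (δ := δ) (ε := ε) (ps := ps) hm hp hpq hu hv
    (αs := fun d => if d = j then 1 else 0) hα (a := 0) le_rfl (j := j)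
    (Y := Y 1) (Y' := Y' 1) (fun d => by simpa using hY 1 le_rfl d j) (hMY 1 le_rfl j)
    (h.imp (fun ⟨h1, h2, h3⟩ => ⟨h1, X 0, X' 0, by simpa using hX 0 (Fin.zero_le _),
      h2 0 (Fin.zero_le _), h3⟩) (fun ⟨h1, h2⟩ => ⟨h1, Or.inr ⟨rfl, h2⟩⟩))
  refine ⟨K 1, hK _ (by simp), fun f hf hft N t => ?_⟩
  have hL : (0 : ℝ) < 2 ^ N := by positivity
  simp only [innerSum_eq]
  refine hKb 1 N t (fun _ _ => 1) (fun _ => aemeasurable_const) ?_ f hf hft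
  intro θ _ _ h _ k z
  have h2 := lintegral_le_orl (h := h) (α := 0)
    (μ := volume.restrict (gridIdx (gridShift (2 ^ N) t) (2 ^ N) k ⁻¹' {z})) le_rfl
    (by rw [Measure.restrict_apply_univ]; exact volume_gridCell_ne_zero _ hL _ _)
    (by rw [Measure.restrict_apply_univ]; exact volume_gridCell_ne_top _ hL _ _)
  rw [Measure.restrict_apply_univ] at h2
  simp only [ENNReal.one_rpow, one_mul, zero_mul]
  exact h2

/-- The measurable dominating function `D`, a limit inferior of dyadic sums, yields finiteness
almost everywhere without measurability in `x` of the integral itself. -/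
theorem exists_majorant_bound (hn : 1 ≤ n) (hm : 1 ≤ m) (hp : 0 < p) (hpq : p ≤ q)
    (hφ : ConditionD φ δ ε)
    (hX : ∀ k ≤ ℓ, GenHolder ((k : ℕ) : ℝ) (X k) (X' k))
    (hY : ∀ k ≤ ℓ, ∀ i j, GenHolder (if i = j then ((k : ℕ) : ℝ) else 0) (Y k i j) (Y' k i j))
    (hMY : ∀ k ≤ ℓ, ∀ j, MaximalBounded (fun i => Y' k i j) ps p)
    (hu : AEMeasurable u volume) (hv : ∀ i, AEMeasurable (v i) volume)
    (h :
      (1 < q ∧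
        (∀ k ≤ ℓ, MaximalBounded (fun _ : Fin 1 => X' k) (fun _ => q / (q - 1)) (q / (q - 1))) ∧
        max (bigW φ δ ε p q u v 1 1 (X ℓ).norm (Y 0))
          (((ℓ : ℕ) : ℝ≥0∞) * bigW φ δ ε p q u v 1 1 (X 0).norm (Y 1)) < ∞) ∨
      (q ≤ 1 ∧
        max (bigW φ δ ε p q u v q q (normLlog (((ℓ : ℕ) : ℝ) * q)) (Y 0))
          (((ℓ : ℕ) : ℝ≥0∞) * bigW φ δ ε p q u v q 1 (normLlog 0) (Y 1)) < ∞)) (j : Fin m) :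
    ∃ K : ℝ≥0∞ → ℝ≥0∞, (∀ B, B ≠ ∞ → K B ≠ ∞) ∧ ∀ (B : ℝ≥0∞) (b : E n → ℝ),
      B ≠ 0 → B ≠ ∞ → LocallyIntegrable b volume → OscLE b B →
      ∀ f : Fin m → E n → ℝ≥0∞, (∀ d, AEMeasurable (f d) volume) →
        (∀ d, lpNorm (ps d) (fun x => f d x * v d x) < ∞) →
        ∃ D : E n → ℝ≥0∞, AEMeasurable D volume ∧
          (∀ x, (∫⁻ y, majorant φ ((ℓ : ℕ) : ℝ≥0∞) b j f x y) * u x ≤ D x) ∧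
          lpNorm q D ≤ K B * ∏ d, lpNorm (ps d) (fun x => f d x * v d x) := by
  have hq : 0 < q := hp.trans_le hpq
  simp only [max_lt_iff] at h
  obtain ⟨C, hC⟩ := hφ.exists_growth
  obtain ⟨K₁, hK₁, hout⟩ := exists_outerSum_bound hm hp hpq hX hY hMY hu hv
    (h.imp (fun h => ⟨h.1, h.2.1, h.2.2.1⟩) (fun h => ⟨h.1, h.2.1⟩)) j
  obtain ⟨K₂, hK₂, hin⟩ := exists_innerSum_bound hm hp hpq hX hY hMY hu hv
    (h.imp (fun h => ⟨h.1, h.2.1, h.2.2.2⟩) (fun h => ⟨h.1, h.2.2⟩)) j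
  have hq1 : (0 : ℝ) ≤ 1 + 1 / q := by positivity
  have h2q : (2 : ℝ≥0∞) ^ (1 + 1 / q) ≠ ∞ := ENNReal.rpow_ne_top_of_nonneg hq1 (by simp)
  set c : ℝ≥0∞ := (Fintype.card (Fin n → Bool) : ℝ≥0∞) ^ (1 + 1 / q) with hc
  have hct : c ≠ ∞ := ENNReal.rpow_ne_top_of_nonneg hq1 (by simp)
  -- The factor `c` pays for the sum over the `2 ^ n` grids, and `2 ^ (1 + 1 / q)` for that of the
  -- outer and the inner part.
  refine ⟨fun B => C * 16 ^ (n * m) * (c * (2 ^ (1 + 1 / q) *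
    (K₁ B + 4 * (1 + 8 * 2 ^ n * B) * K₂))), fun B hB => ?_, ?_⟩
  · have := hK₁ B hB
    finiteness
  intro B b hB0 hBt hb hB f hf hft
  set P := ∏ d, lpNorm (ps d) (fun x => f d x * v d x) with hP
  set lam : ℝ≥0∞ := ((ℓ : ℕ) : ℝ≥0∞) with hlam
  set A : ℝ≥0∞ := 4 * (1 + 8 * 2 ^ n * B) with hA
  have huE : AEMeasurable (fun x => (u x : ℝ≥0∞)) volume := hu.coe_nnreal_ennreal
  have hO : ∀ N t, AEMeasurable (fun x => outerSum φ δ ε lam b f N t x * u x) volume :=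
    fun N t => (aemeasurable_outerSum φ δ ε lam hb f N t).mul huE
  have hI : ∀ N t, AEMeasurable (fun x => lam * (innerSum φ δ ε j f N t x * u x)) volume :=
    fun N t => (((measurable_innerSum φ δ ε j f N t).aemeasurable).mul huE).const_mul lam
  have hS : ∀ N t, AEMeasurable (fun x => outerSum φ δ ε lam b f N t x * u x +
      A * (lam * (innerSum φ δ ε j f N t x * u x))) volume :=
    fun N t => (hO N t).add ((hI N t).const_mul A)
  have hF : ∀ N, AEMeasurable (fun x => C * 16 ^ (n * m) *
      ∑ t, (outerSum φ δ ε lam b f N t x * u x +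
        A * (lam * (innerSum φ δ ε j f N t x * u x)))) volume :=
    fun N => (Finset.aemeasurable_fun_sum _ fun t _ => hS N t).const_mul _
  refine ⟨_, aemeasurable_liminf hF, fun x => ?_, lpNorm_liminf_le hq hF fun N => ?_⟩
  · refine (lintegral_majorant_le_liminf hn hm hC hb hB hB0 hBt j hf x (u x)).trans (le_of_eq ?_)
    congr 1
    funext N
    rw [mul_assoc, Finset.sum_mul]
    congr 1
    refine Finset.sum_congr rfl fun t _ => ?_
    rw [← hA]
    ring
  · rw [lpNorm_const_mul hq (Finset.aemeasurable_fun_sum _ fun t _ => hS N t)]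
    beta_reduce
    rw [mul_assoc (C * 16 ^ (n * m) : ℝ≥0∞), mul_assoc c, mul_assoc (2 ^ (1 + 1 / q))]
    refine mul_le_mul' le_rfl ?_
    refine lpNorm_sum_le hq (hS N) fun t => ?_
    refine lpNorm_add_le hq (hO N t) ((hI N t).const_mul A) ?_ ?_
    · exact (hout B b hB0 hBt hb hB f hf hft N t).trans (mul_le_mul' le_self_add le_rfl)
    · rw [lpNorm_const_mul hq (hI N t)]
      refine (mul_le_mul' le_rfl (hin f hf hft N t)).trans ?_
      rw [← mul_assoc]
      exact mul_le_mul' le_add_self le_rfl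

variable {b f : Fin m → E n → ℝ}

theorem integrand_mulAt (φ : (Fin m → E n) → ℝ) (b f : Fin m → E n → ℝ) (j : Fin m) (x : E n)
    (y : Fin m → E n) : integrand φ (mulAt b f j) x y = b j (y j) * integrand φ f x y := by
  have : ∏ i, mulAt b f j i (y i) = b j (y j) * ∏ i, f i (y i) := by
    rw [← Finset.mul_prod_erase _ _ (Finset.mem_univ j),
      ← Finset.mul_prod_erase _ (fun i => f i (y i)) (Finset.mem_univ j), ← mul_assoc]
    congr 1
    · simp [mulAt]
    · refine Finset.prod_congr rfl fun i hi => ?_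
      rw [mulAt, Function.update_of_ne (Finset.ne_of_mem_erase hi)]
  rw [integrand, this, integrand]
  ring

theorem enorm_integrand (hφ : ∀ y, 0 ≤ φ y) (x : E n) (y : Fin m → E n) :
    ‖integrand φ f x y‖ₑ = ENNReal.ofReal (φ fun i => x - y i) * ∏ i, ‖f i (y i)‖ₑ := by
  rw [integrand, enorm_mul, Real.enorm_of_nonneg (hφ _)]
  simp only [enorm_eq_nnnorm, nnnorm_prod, ENNReal.ofNNReal_finsetProd]

theorem majorant_eq (hφ : ∀ y, 0 ≤ φ y) (lam : ℝ≥0∞) (g : E n → ℝ) (j : Fin m) (x : E n)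
    (y : Fin m → E n) : majorant φ lam g j (fun i x => ‖f i x‖ₑ) x y =
      (1 + lam * ‖g x - g (y j)‖ₑ) * ‖integrand φ f x y‖ₑ := by
  rw [majorant, enorm_integrand hφ]
  ring

theorem aestronglyMeasurable_integrand (hφ : AEStronglyMeasurable φ volume)
    (hf : ∀ i, AEStronglyMeasurable (f i) volume) (x : E n) :
    AEStronglyMeasurable (integrand φ f x) volume := by
  have : (volume : Measure (Fin m → E n)).IsNegInvariant :=
    Measure.pi.isNegInvariant fun _ => (volume : Measure (E n))
  have h1 : MeasurePreserving (fun y : Fin m → E n => (fun _ => x) - y) volume volume :=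
    Measure.measurePreserving_sub_left volume _
  have h2 : AEStronglyMeasurable (fun y : Fin m → E n => φ fun i => x - y i) volume :=
    hφ.comp_measurePreserving h1
  have h3 : ∀ i, AEStronglyMeasurable (fun y : Fin m → E n => f i (y i)) volume := fun i =>
    (hf i).comp_quasiMeasurePreserving (Measure.quasiMeasurePreserving_eval _ i)
  exact h2.mul (Finset.aestronglyMeasurable_fun_prod _ fun i _ => h3 i)

/-- The summand `1` of the majorant controls the integrand of the potential. The integrand with `bⱼ
fⱼ` is `bⱼ(x)` times it minus the one with `bⱼ(x) - bⱼ(yⱼ)`, which the other summand controls. -/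
theorem operatorDefinedAt_of_lintegral_ne_top (hm : 1 ≤ m) (hφ : ConditionD φ δ ε)
    (hb : ∀ j, AEStronglyMeasurable (b j) volume) (hf : ∀ i, AEStronglyMeasurable (f i) volume)
    {x : E n}
    (hx : ∀ j, ∫⁻ y, majorant φ ((ℓ : ℕ) : ℝ≥0∞) (b j) j (fun i x => ‖f i x‖ₑ) x y ≠ ∞) :
    OperatorDefinedAt ℓ φ b f x := by
  have hmeas := aestronglyMeasurable_integrand hφ.locallyIntegrable.aestronglyMeasurable hf x
  simp only [majorant_eq hφ.nonneg] at hx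
  have hint : Integrable (integrand φ f x) volume := by
    refine ⟨hmeas, lt_of_le_of_lt (lintegral_mono fun y => ?_) (hx ⟨0, hm⟩).lt_top⟩
    exact le_mul_of_one_le_left zero_le le_self_add
  refine ⟨hint, ?_⟩
  rintro rfl j
  have hdiff : Integrable (fun y => (b j x - b j (y j)) * integrand φ f x y) volume := by
    refine ⟨?_, lt_of_le_of_lt (lintegral_mono fun y => ?_) (hx j).lt_top⟩
    · exact (aestronglyMeasurable_const.sub ((hb j).comp_quasiMeasurePreserving
        (Measure.quasiMeasurePreserving_eval _ j))).mul hmeas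
    · rw [enorm_mul]
      simp only [Fin.val_one, Nat.cast_one, one_mul]
      exact mul_le_mul' le_add_self le_rfl
  refine ((hint.const_mul (b j x)).sub hdiff).congr (ae_of_all _ fun y => ?_)
  simp only [Pi.sub_apply, integrand_mulAt]
  ring

/-- Where some majorant has infinite integral the bound is trivial, so the default value of a
divergent integral does no harm. Elsewhere the two terms of the commutator may be combined under one
integral. -/
theorem enorm_operator_le (hm : 1 ≤ m) (hφ : ConditionD φ δ ε)
    (hb : ∀ j, AEStronglyMeasurable (b j) volume) (hf : ∀ i, AEStronglyMeasurable (f i) volume)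
    (x : E n) :
    ‖operator ℓ φ b f x‖ₑ ≤
      ∑ j, ∫⁻ y, majorant φ ((ℓ : ℕ) : ℝ≥0∞) (b j) j (fun i x => ‖f i x‖ₑ) x y := by
  by_cases hx : ∀ j, ∫⁻ y, majorant φ ((ℓ : ℕ) : ℝ≥0∞) (b j) j (fun i x => ‖f i x‖ₑ) x y ≠ ∞
  swap
  · push Not at hx
    obtain ⟨j, hj⟩ := hx
    rw [(ENNReal.sum_eq_top).2 ⟨j, Finset.mem_univ j, hj⟩]
    exact le_top
  have hdef := operatorDefinedAt_of_lintegral_ne_top hm hφ hb hf hx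
  obtain rfl | rfl : ℓ = 0 ∨ ℓ = 1 := by omega
  · rw [operator, if_pos rfl, potential]
    refine (enorm_integral_le_lintegral_enorm _).trans (le_trans ?_ (Finset.single_le_sum
      (fun _ _ => zero_le) (Finset.mem_univ (⟨0, hm⟩ : Fin m))))
    refine lintegral_mono fun y => ?_
    rw [majorant_eq hφ.nonneg]
    exact le_mul_of_one_le_left zero_le le_self_add
  · rw [operator, if_neg (by decide), commutator]
    refine (enorm_sum_le _ _).trans (Finset.sum_le_sum fun j _ => ?_)
    rw [potential, potential, ← integral_const_mul,
      ← integral_sub (hdef.1.const_mul _) (hdef.2 rfl j)]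
    refine (enorm_integral_le_lintegral_enorm _).trans (lintegral_mono fun y => ?_)
    rw [majorant_eq hφ.nonneg, integrand_mulAt, ← sub_mul, enorm_mul]
    simp only [Fin.val_one, Nat.cast_one, one_mul]
    exact mul_le_mul' le_add_self le_rfl

end Domination

end MultPot

end

/-! ### The two-weight inequality -/

open MeasureTheory MultPot
open scoped ENNReal NNReal

theorem mainTheorem1 {n m : ℕ} (hn : 1 ≤ n) (hm : 1 ≤ m) (ℓ : Fin 2)
    (ps : Fin m → ℝ) (p q : ℝ) (hps : ∀ i, 1 < ps i) (hp : 1 / p = ∑ i, 1 / ps i)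
    (hmp : 1 / (m : ℝ) < p) (hpq : p ≤ q)
    (φ : (Fin m → E n) → ℝ) (δ ε : ℝ) (hφ : ConditionD φ δ ε)
    (X X' : Fin 2 → BanachFunctionSpace n)
    (Y Y' : Fin 2 → Fin m → Fin m → BanachFunctionSpace n)
    (hX : ∀ k ≤ ℓ, GenHolder ((k : ℕ) : ℝ) (X k) (X' k))
    (hY : ∀ k ≤ ℓ, ∀ i j, GenHolder (if i = j then ((k : ℕ) : ℝ) else 0) (Y k i j) (Y' k i j))
    (hMY : ∀ k ≤ ℓ, ∀ j, MaximalBounded (fun i => Y' k i j) ps p)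
    (u : E n → ℝ≥0) (v : Fin m → E n → ℝ≥0)
    (hu : AEMeasurable u volume) (hv : ∀ i, AEMeasurable (v i) volume)
    (h :
      (1 < q ∧
        (∀ k ≤ ℓ, MaximalBounded (fun _ : Fin 1 => X' k) (fun _ => q / (q - 1)) (q / (q - 1))) ∧
        max (bigW φ δ ε p q u v 1 1 (X ℓ).norm (Y 0))
          (((ℓ : ℕ) : ℝ≥0∞) * bigW φ δ ε p q u v 1 1 (X 0).norm (Y 1)) < ∞) ∨
      (q ≤ 1 ∧
        max (bigW φ δ ε p q u v q q (normLlog (((ℓ : ℕ) : ℝ) * q)) (Y 0))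
          (((ℓ : ℕ) : ℝ≥0∞) * bigW φ δ ε p q u v q 1 (normLlog 0) (Y 1)) < ∞)) :
    ∃ C : ℝ≥0∞ → ℝ≥0, ∀ b : Fin m → E n → ℝ, (∀ j, IsBMO (b j)) →
      ∀ f : Fin m → E n → ℝ, (∀ i, AEStronglyMeasurable (f i) volume) →
        (∀ i, wNorm (ps i) (v i) (f i) < ∞) →
        (∀ᵐ x ∂volume, u x ≠ 0 → OperatorDefinedAt ℓ φ b f x) ∧
        wNorm q u (operator ℓ φ b f) ≤ C (⨆ j, bmoNorm (b j)) * ∏ i, wNorm (ps i) (v i) (f i) := by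
  have hm0 : (0 : ℝ) < m := by exact_mod_cast hm
  have hp0 : 0 < p := lt_trans (by positivity) hmp
  have hq0 : 0 < q := hp0.trans_le hpq
  choose K hK hKb using exists_majorant_bound hn hm hp0 hpq hφ hX hY hMY hu hv h
  set c : ℝ≥0∞ := (Fintype.card (Fin m) : ℝ≥0∞) ^ (1 + 1 / q) with hc
  have hct : c ≠ ∞ := ENNReal.rpow_ne_top_of_nonneg (by positivity) (by simp)
  -- `B + 1` replaces the largest seminorm `B`, because the John–Nirenberg estimate divides by the
  -- bound for the oscillations and `B` may be `0`.
  refine ⟨fun B => (c * ∑ j, K j (B + 1)).toNNReal, fun b hb f hf hft => ?_⟩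
  have hBt : (⨆ j, bmoNorm (b j)) ≠ ∞ := by
    refine ne_top_of_le_ne_top (b := ∑ j, bmoNorm (b j)) ?_ (iSup_le fun j =>
      Finset.single_le_sum (f := fun j => bmoNorm (b j)) (fun _ _ => zero_le) (Finset.mem_univ j))
    exact ENNReal.sum_ne_top.2 fun j _ => (hb j).2.ne
  set B := ⨆ j, bmoNorm (b j) with hB
  have hB1 : B + 1 ≠ ∞ := by finiteness
  have hbm : ∀ j, AEStronglyMeasurable (b j) volume := fun j => (hb j).1.aestronglyMeasurable
  choose D hDm hD hDn using fun j => hKb j (B + 1) (b j) (by simp) hB1 (hb j).1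
    (oscLE_of_bmoNorm_le ((le_iSup (fun j => bmoNorm (b j)) j).trans le_self_add))
    (fun i x => ‖f i x‖ₑ) (fun i => (hf i).enorm) hft
  have hcK : c * ∑ j, K j (B + 1) ≠ ∞ :=
    ENNReal.mul_ne_top hct (ENNReal.sum_ne_top.2 fun j _ => hK j _ hB1)
  have hP : ∏ i, wNorm (ps i) (v i) (f i) ≠ ∞ := ENNReal.prod_ne_top fun i _ => (hft i).ne
  have hsum : lpNorm q (fun x => ∑ j, D j x) ≤
      c * ((∑ j, K j (B + 1)) * ∏ i, wNorm (ps i) (v i) (f i)) := by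
    refine lpNorm_sum_le hq0 hDm fun j => (hDn j).trans (mul_le_mul' ?_ le_rfl)
    exact Finset.single_le_sum (f := fun j => K j (B + 1)) (fun _ _ => zero_le) (Finset.mem_univ j)
  constructor
  · have hfin : ∀ j, ∀ᵐ x ∂volume, D j x < ∞ := by
      intro j
      have h1 : ∫⁻ x, D j x ^ q ≠ ∞ := by
        refine ne_top_of_le_ne_top ?_ ((lpNorm_le_iff hq0).1 (hDn j))
        exact ENNReal.rpow_ne_top_of_nonneg hq0.le (ENNReal.mul_ne_top (hK j _ hB1) hP)
      filter_upwards [ae_lt_top' ((hDm j).pow_const q) h1] with x hx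
      by_contra hcon
      rw [not_lt_top_iff] at hcon
      simp [hcon, hq0] at hx
    filter_upwards [ae_all_iff.2 hfin] with x hx hux
    -- An infinite integral times `u x ≠ 0` would be infinite, against `D j x < ∞`; where `u`
    -- vanishes nothing can be concluded.
    refine operatorDefinedAt_of_lintegral_ne_top hm hφ hbm hf fun j htop => ?_
    have h1 := (hD j x).trans_lt (hx j)
    rw [htop, ENNReal.top_mul (by exact_mod_cast hux)] at h1
    exact lt_irrefl _ h1
  · rw [ENNReal.coe_toNNReal hcK, mul_assoc]
    refine le_trans (lpNorm_mono hq0 fun x => ?_) hsum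
    calc ‖operator ℓ φ b f x‖ₑ * (u x : ℝ≥0∞) ≤ _ :=
          mul_le_mul' (enorm_operator_le hm hφ hbm hf x) le_rfl
      _ = _ := Finset.sum_mul _ _ _
      _ ≤ _ := Finset.sum_le_sum fun j _ => hD j x
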